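/- **Setting.** Let $\mathrm{fin}_2(\mathcal P)$ be the set of multisets of size 2 of elements of $\mathcal P$, and let $\mathbb N=\{1,2,\dots\}$. A *binary interaction process* is a map $\mathcal I:\mathbb N\to\mathrm{fin}_2(\mathcal P)$ with $\mathcal P$ countable (without loss of generality $\mathcal P=\mathbb Z$). Two such processes $\mathcal I,\mathcal I'$ induce the same *edge-labeled network* $\mathcal E_{\mathcal I}=\mathcal E_{\mathcal I'}$ if there is a bijection $\rho$ from the set of vertices occurring in $\mathcal I$ onto the set of vertices occurring in $\mathcal I'$ such that $\mathcal I'(n)=\rho(\mathcal I(n))$ for all $n$. The set $\mathfrak E_{\mathbb N}$ of binary edge-labeled networks carries the product-discrete topology (the coarsest topology making all restrictions $\mathcal E\mapsto\mathcal E|_{[n]}$ to the first $n$ edges continuous for the discrete topology) and its Borel $\sigma$-field. For a permutation $\sigma$ of $\mathbb N$, $\mathcal E_{\mathcal I}^\sigma$ is the network induced by $n\mapsto\mathcal I(\sigma^{-1}(n))$. A random element $\mathcal Y$ of $\mathfrak E_{\mathbb N}$ is *edge exchangeable* if $\mathcal Y^\sigma$ and $\mathcal Y$ have the same distribution for every permutation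 $\sigma$ of $\mathbb N$. **The simplex.** The $\mathrm{fin}_2(\mathbb N)$-simplex is the set of all $f=(f_{i,j})_{j\ge i\ge -1}$ with $f_{i,j}\ge 0$, $f_{-1,i}=0$ for all $i\ne 0$ and $\sum_{j\ge i\ge-1}f_{i,j}=1$, with the metric $d(f,f')=\sum_{j\ge i\ge -1}|f_{i,j}-f'_{i,j}|$ and its Borel $\sigma$-field. Put $f_{j,i}=f_{i,j}$, and for $i\ge1$ put $f_\bullet^{(i)}=\sum_{j\ge0}f_{i,j}$ and $A_f=\{i\ge1:f_\bullet^{(i)}>0\}$. Call $g$ a *reordering* of $f$ if there is a bijection $\pi:A_f\to A_g$ such that, with $\pi(-1)=-1$ and $\pi(0)=0$, $g_{\pi(i),\pi(j)}=f_{i,j}$ for all $i,j\in A_f\cup\{-1,0\}$. Call $f$ *ranked* if $f_\bullet^{(i)}\ge f_\bullet^{(i+1)}$ for all $i\ge1$. Let $\mathcal F^\downarrow$ be the space of rank-reordered elements, with ties broken lexicographically: the set of ranked $f$ such that no ranked reordering $g$ of $f$ comes before $f$, where $g$ comes before $f$ if at the first pair in the list $(1,1),(1,2),(2,2),(1,3),(2,3),(3,3),\dots$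 at which they differ, $g$ has the larger entry. $\mathcal F^\downarrow$ carries the trace $\sigma$-field. **The network generated by $f$.** Given $f$ in the simplex, let $X_1,X_2,\dots$ be i.i.d. with $\mathrm{pr}(X_k=\{i,j\})=f_{i,j}$, $j\ge i\ge-1$. Put $m_0=0$, and for $n\ge1$ let $z=m_{n-1}$. If $0\notin X_n$, put $\mathcal X(n)=X_n$, $m_n=z$; if $X_n=\{0,j\}$ with $j\ge1$, put $\mathcal X(n)=\{z-1,j\}$, $m_n=z-1$; if $X_n=\{0,0\}$, put $\mathcal X(n)=\{z-1,z-1\}$, $m_n=z-1$; if $X_n=\{-1,0\}$, put $\mathcal X(n)=\{z-1,z-2\}$, $m_n=z-2$. Let $\epsilon_f$ be the distribution of $\mathcal E_{\mathcal X}$. (Thus the special labels $-1$ and $0$ account for "blips", that is, vertices which occur in one edge only.) **Theorem A.2 (Supplement).** Let $\mathcal Y$ be an edge exchangeable random binary edge-labeled network in $\mathfrak E_{\mathbb N}$. Then there exists a unique probability measure $\phi$ on $\mathcal F^\downarrow$ such that $\mathcal Y\sim\epsilon_\phi$, where $$\epsilon_\phi(\cdot)=\int_{\mathcal F^\downarrow}\epsilon_f(\cdot)\,\phi(df).$$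 -/

import Mathlib

open MeasureTheory Set

namespace EdgeExch

/-! ### Edge-labeled networks

Vertices are taken from the countably infinite population `ℤ`.  The edge labels `1, 2, 3, …` are
represented by the natural numbers `0, 1, 2, …`, and `{1, …, n}` by `Fin n`. -/

/-- A binary interaction process: each edge label in `S` is sent to a multiset of two vertices. -/
abbrev Interactions (S : Type) : Type := S → Sym2 ℤ

/-- The vertices that take part in at least one interaction of the process. -/
def Interactions.vertices {S : Type} (I : Interactions S) : Set ℤ := {v | ∃ n, v ∈ I n}

/-- Two processes induce the same edge-labeled network when a bijection between the vertices that
occur in them carries one to the other. -/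
def SameNetwork {S : Type} (I J : Interactions S) : Prop :=
  ∃ ρ : ℤ → ℤ, InjOn ρ I.vertices ∧ ∀ n, J n = (I n).map ρ

theorem SameNetwork.refl {S : Type} (I : Interactions S) : SameNetwork I I :=
  ⟨id, injOn_id _, fun n => by simp⟩

theorem SameNetwork.symm {S : Type} {I J : Interactions S} (h : SameNetwork I J) :
    SameNetwork J I := by
  obtain ⟨ρ, hρ, hJ⟩ := h
  have hinv : ∀ v ∈ I.vertices, Function.invFunOn ρ I.vertices (ρ v) = v :=
    fun v hv => hρ.leftInvOn_invFunOn hv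
  refine ⟨Function.invFunOn ρ I.vertices, ?_, fun n => ?_⟩
  · rintro a ⟨n, ha⟩ b ⟨m, hb⟩ hab
    rw [hJ, Sym2.mem_map] at ha hb
    obtain ⟨a', ha', rfl⟩ := ha
    obtain ⟨b', hb', rfl⟩ := hb
    rw [hinv _ ⟨n, ha'⟩, hinv _ ⟨m, hb'⟩] at hab
    rw [hab]
  · rw [hJ, Sym2.map_map]
    have h := Sym2.map_congr (s := I n) (f := Function.invFunOn ρ I.vertices ∘ ρ) (g := id)
      fun v hv => hinv v ⟨n, hv⟩
    rw [h, Sym2.map_id, id]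

theorem SameNetwork.trans {S : Type} {I J K : Interactions S} (h : SameNetwork I J)
    (h' : SameNetwork J K) : SameNetwork I K := by
  obtain ⟨ρ, hρ, hJ⟩ := h
  obtain ⟨τ, hτ, hK⟩ := h'
  have hmem : ∀ v ∈ I.vertices, ρ v ∈ J.vertices := by
    rintro v ⟨n, hv⟩
    exact ⟨n, by rw [hJ, Sym2.mem_map]; exact ⟨v, hv, rfl⟩⟩
  refine ⟨τ ∘ ρ, hτ.comp hρ hmem, fun n => ?_⟩
  rw [hK, hJ, Sym2.map_map]

theorem SameNetwork.comp {S T : Type} (g : T → S) {I J : Interactions S} (h : SameNetwork I J) :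
    SameNetwork (I ∘ g) (J ∘ g) := by
  obtain ⟨ρ, hρ, hJ⟩ := h
  refine ⟨ρ, hρ.mono ?_, fun n => hJ (g n)⟩
  rintro v ⟨n, hv⟩
  exact ⟨g n, hv⟩

instance processSetoid (S : Type) : Setoid (Interactions S) where
  r := SameNetwork
  iseqv := ⟨SameNetwork.refl, SameNetwork.symm, SameNetwork.trans⟩

/-- Binary edge-labeled networks with edges labeled by `S`. -/
def Network (S : Type) : Type := Quotient (processSetoid S)

/-- The edge-labeled network induced by an interaction process. -/
def inducedNetwork {S : Type} (I : Interactions S) : Network S := Quotient.mk _ I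

/-- The network whose edge labeled `t` is the edge of `E` labeled `g t`. -/
def Network.pullback {S T : Type} (g : T → S) (E : Network S) : Network T :=
  Quotient.map (fun I : Interactions S => (I ∘ g : Interactions T)) (fun _ _ h => SameNetwork.comp g h) E

/-- The network `E ^ σ`, in which the edge labeled `i` is the edge of `E` labeled `σ⁻¹ i`. -/
def Network.relabel {S : Type} (σ : Equiv.Perm S) (E : Network S) : Network S :=
  E.pullback σ.symm

/-- The restriction of a network to its first `n` edges. -/
def Network.restrict (n : ℕ) (E : Network ℕ) : Network (Fin n) :=
  E.pullback Fin.val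

instance (n : ℕ) : TopologicalSpace (Network (Fin n)) := ⊥

instance (n : ℕ) : DiscreteTopology (Network (Fin n)) := ⟨rfl⟩

/-- The product-discrete topology: the coarsest topology that makes all restrictions to finitely
many edges continuous. -/
instance : TopologicalSpace (Network ℕ) :=
  TopologicalSpace.induced (fun (E : Network ℕ) (n : ℕ) => E.restrict n) inferInstance

instance : MeasurableSpace (Network ℕ) := borel _

instance : BorelSpace (Network ℕ) := ⟨rfl⟩

instance (n : ℕ) : Countable (Network (Fin n)) :=
  inferInstanceAs (Countable (Quotient (processSetoid (Fin n))))

/-- The Borel sets of networks are generated by the restrictions to finitely many edges. -/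
theorem network_measurableSpace_eq :
    (inferInstance : MeasurableSpace (Network ℕ)) =
      ⨆ n, MeasurableSpace.comap (Network.restrict n) ⊤ := by
  let _ : ∀ n, MeasurableSpace (Network (Fin n)) := fun _ => ⊤
  have _ : ∀ n, BorelSpace (Network (Fin n)) := fun n => ⟨borel_eq_top_of_discrete.symm⟩
  have h : (inferInstance : MeasurableSpace (Network ℕ)) =
      MeasurableSpace.comap (fun (E : Network ℕ) (n : ℕ) => E.restrict n)
        (borel (∀ n, Network (Fin n))) := borel_comap
  rw [h, ← BorelSpace.measurable_eq (α := ∀ n, Network (Fin n))]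
  simp only [MeasurableSpace.pi, MeasurableSpace.comap_iSup, MeasurableSpace.comap_comp]
  rfl

/-- A random edge-labeled network is edge exchangeable if relabeling its edges by any permutation
does not change its distribution. -/
def EdgeExchangeable {Ω : Type*} [MeasurableSpace Ω] (P : Measure Ω) (Y : Ω → Network ℕ) : Prop :=
  ∀ σ : Equiv.Perm ℕ, P.map (fun ω => (Y ω).relabel σ) = P.map Y

/-! ### The simplex of pair frequencies -/

/-- The `fin₂(ℕ)`-simplex: families `(f_{i,j})`, `j ≥ i ≥ -1`, of nonnegative reals with sum `1`
such that `f_{-1,i} = 0` for `i ≠ 0`, extended by `0` to the pairs with a label below `-1`. -/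
@[ext]
structure PairSimplex where
  /-- the mass of an unordered pair of labels -/
  mass : Sym2 ℤ → ℝ
  nonneg : ∀ s, 0 ≤ mass s
  label_ge : ∀ s, ∀ i ∈ s, i < -1 → mass s = 0
  neg_one : ∀ i : ℤ, i ≠ 0 → mass s(-1, i) = 0
  hasSum_one : HasSum mass 1

namespace PairSimplex

theorem summable_abs_sub (f g : PairSimplex) : Summable fun s => |f.mass s - g.mass s| :=
  (f.hasSum_one.summable.sub g.hasSum_one.summable).abs

/-- The simplex carries the `ℓ¹` distance. -/
noncomputable instance : MetricSpace PairSimplex where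
  dist f g := ∑' s, |f.mass s - g.mass s|
  dist_self f := by simp
  dist_comm f g := by simp only [abs_sub_comm]
  dist_triangle f g h := by
    rw [← (summable_abs_sub f g).tsum_add (summable_abs_sub g h)]
    exact (summable_abs_sub f h).tsum_le_tsum (fun s => abs_sub_le _ _ _)
      ((summable_abs_sub f g).add (summable_abs_sub g h))
  eq_of_dist_eq_zero := by
    intro f g h
    have h' := (summable_abs_sub f g).hasSum
    change HasSum _ (∑' s, |f.mass s - g.mass s|) at h'
    rw [show ∑' s, |f.mass s - g.mass s| = 0 from h,
      hasSum_zero_iff_of_nonneg (fun s => abs_nonneg _)] at h'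
    ext s
    exact sub_eq_zero.1 (abs_eq_zero.1 (congrFun h' s))

theorem dist_eq (f g : PairSimplex) : dist f g = ∑' s, |f.mass s - g.mass s| := rfl

noncomputable instance : MeasurableSpace PairSimplex := borel _

instance : BorelSpace PairSimplex := ⟨rfl⟩

theorem continuous_mass : Continuous (mass : PairSimplex → Sym2 ℤ → ℝ) := by
  refine continuous_pi fun s => ?_
  refine LipschitzWith.continuous (K := 1) (LipschitzWith.of_dist_le_mul fun f g => ?_)
  rw [NNReal.coe_one, one_mul, dist_eq, Real.dist_eq]
  exact (summable_abs_sub f g).le_tsum s fun _ _ => abs_nonneg _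

/-- On the simplex the `ℓ¹` distance induces the topology of pointwise convergence. -/
theorem isInducing_mass : Topology.IsInducing (mass : PairSimplex → Sym2 ℤ → ℝ) := by
  rw [Topology.isInducing_iff_nhds]
  intro f
  refine le_antisymm (continuous_mass.tendsto f).le_comap ?_
  change Filter.Tendsto id (Filter.comap mass (nhds f.mass)) (nhds f)
  rw [tendsto_iff_dist_tendsto_zero]
  have hd : ∀ g : PairSimplex, dist (id g) f = 2 * ∑' s, max (f.mass s - g.mass s) 0 := by
    intro g
    have ha : HasSum (fun s => f.mass s - g.mass s) 0 := by
      simpa using f.hasSum_one.sub g.hasSum_one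
    have hb := (summable_abs_sub f g).hasSum
    have hc : HasSum (fun s => max (f.mass s - g.mass s) 0)
        ((0 + ∑' s, |f.mass s - g.mass s|) / 2) := by
      have he : (fun s => max (f.mass s - g.mass s) 0) =
          fun s => (f.mass s - g.mass s + |f.mass s - g.mass s|) / 2 := by
        funext s
        rcases le_total 0 (f.mass s - g.mass s) with h | h
        · rw [max_eq_left h, abs_of_nonneg h]; ring
        · rw [max_eq_right h, abs_of_nonpos h]; ring
      rw [he]
      exact (ha.add hb).div_const 2
    rw [hc.tsum_eq, dist_comm, dist_eq]
    simp only [id]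
    ring
  simp only [hd]
  suffices h : Filter.Tendsto (fun g : PairSimplex => ∑' s, max (f.mass s - g.mass s) 0)
      (Filter.comap mass (nhds f.mass)) (nhds (∑' _ : Sym2 ℤ, (0 : ℝ))) by
    simpa using h.const_mul 2
  refine tendsto_tsum_of_dominated_convergence
    f.hasSum_one.summable (fun s => ?_) (Filter.Eventually.of_forall fun g s => ?_)
  · have hs : Filter.Tendsto (fun g : PairSimplex => g.mass s)
        (Filter.comap mass (nhds f.mass)) (nhds (f.mass s)) :=
      ((continuous_apply s).tendsto f.mass).comp Filter.tendsto_comap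
    simpa using ((tendsto_const_nhds (x := f.mass s)).sub hs).max (tendsto_const_nhds (x := (0 : ℝ)))
  · rw [Real.norm_of_nonneg (le_max_right _ _)]
    exact max_le (by linarith [g.nonneg s]) (f.nonneg s)

/-- The Borel sets of the simplex are generated by the coordinates. -/
theorem measurableSpace_eq :
    (inferInstance : MeasurableSpace PairSimplex) = MeasurableSpace.comap mass inferInstance := by
  have h : (inferInstance : MeasurableSpace PairSimplex) = borel PairSimplex := rfl
  rw [h, isInducing_mass.eq_induced, borel_comap, ← BorelSpace.measurable_eq]

/-- The total mass `∑_{j ≥ 0} f_{i,j}` of the pairs that involve the label `i ≥ 1`. -/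
noncomputable def degree (f : PairSimplex) (i : ℤ) : ℝ := ∑' j : ℕ, f.mass s(i, (j : ℤ))

/-- The labels `i ≥ 1` that occur with positive frequency. -/
def active (f : PairSimplex) : Set ℤ := {i | 1 ≤ i ∧ 0 < f.degree i}

/-- `g` is obtained from `f` by renaming the active labels among `1, 2, …`; the labels `-1` and
`0` keep their meaning. -/
def IsReordering (f g : PairSimplex) : Prop :=
  ∃ ρ : ℤ → ℤ, ρ (-1) = -1 ∧ ρ 0 = 0 ∧ BijOn ρ f.active g.active ∧
    ∀ s : Sym2 ℤ, (∀ i ∈ s, i = -1 ∨ i = 0 ∨ i ∈ f.active) → g.mass (s.map ρ) = f.mass s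

/-- The labels `1, 2, …` are in order of nonincreasing total mass. -/
def IsRanked (f : PairSimplex) : Prop := ∀ i : ℤ, 1 ≤ i → f.degree (i + 1) ≤ f.degree i

/-- `f` comes before `g` in the lexicographic ordering: at the first place where they differ in
the list `(1,1), (1,2), (2,2), (1,3), (2,3), (3,3), …` of pairs, `f` has the larger entry. -/
def LexBefore (f g : PairSimplex) : Prop :=
  ∃ i j : ℤ, 1 ≤ i ∧ i ≤ j ∧ g.mass s(i, j) < f.mass s(i, j) ∧
    ∀ k l : ℤ, 1 ≤ k → k ≤ l → (l < j ∨ (l = j ∧ k < i)) → f.mass s(k, l) = g.mass s(k, l)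

end PairSimplex

/-- The space `F↓` of rank-reordered elements of the simplex: the labels `1, 2, …` are in order of
nonincreasing total mass, and ties are broken lexicographically, so that among all the ranked
reorderings of an element the one that comes first in the lexicographic ordering is selected. -/
def RankedSimplex : Set PairSimplex :=
  {f | f.IsRanked ∧ ∀ g : PairSimplex, f.IsReordering g → g.IsRanked → ¬ g.LexBefore f}

/-! ### The network generated by an element of the simplex -/

/-- Every set of pairs of labels is measurable. -/
instance : DiscreteMeasurableSpace (Sym2 ℤ) where
  forall_measurableSet s :=
    show MeasurableSet (Quot.mk (Sym2.Rel ℤ) ⁻¹' s) from MeasurableSet.of_discrete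

/-- The distribution on pairs of labels that gives `{i, j}` the probability `f_{i,j}`. -/
noncomputable def pairLaw (f : PairSimplex) : Measure (Sym2 ℤ) :=
  Measure.sum fun s => ENNReal.ofReal (f.mass s) • Measure.dirac s

instance (f : PairSimplex) : IsProbabilityMeasure (pairLaw f) := ⟨by
  rw [pairLaw, Measure.sum_apply _ MeasurableSet.univ]
  simp only [Measure.smul_apply, measure_univ, smul_eq_mul, mul_one]
  rw [← ENNReal.ofReal_tsum_of_nonneg f.nonneg f.hasSum_one.summable, f.hasSum_one.tsum_eq,
    ENNReal.ofReal_one]⟩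

/-- The new value of the counter `m` when the pair `x` is drawn: it decreases by the number of
new vertices that occur only in the present edge. -/
def nextCounter (z : ℤ) (x : Sym2 ℤ) : ℤ :=
  if 0 ∉ x then z else if x = s(-1, 0) then z - 2 else z - 1

/-- The vertices of the present edge when the pair `x` is drawn and the counter is `z ≤ 0`: a pair
without `0` is kept, `{0, j}` becomes `{z - 1, j}`, `{0, 0}` becomes the loop `{z - 1, z - 1}`, and
`{-1, 0}` becomes `{z - 1, z - 2}`. -/
def blipEdge (z : ℤ) (x : Sym2 ℤ) : Sym2 ℤ :=
  if 0 ∉ x then x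
  else if x = s(-1, 0) then s(z - 1, z - 2)
  else x.map fun j => if j = 0 then z - 1 else j

/-- The value of the counter before the edge labeled `n` is placed. -/
def counter (X : ℕ → Sym2 ℤ) : ℕ → ℤ
  | 0 => 0
  | n + 1 => nextCounter (counter X n) (X n)

/-- The selection function determined by a sequence of pairs of labels. -/
def selection (X : ℕ → Sym2 ℤ) : Interactions ℕ := fun n => blipEdge (counter X n) (X n)

/-- The distribution `ε_f` of the network induced by the selection function of an i.i.d. sequence
of pairs with distribution `f`. -/
noncomputable def networkLaw (f : PairSimplex) : Measure (Network ℕ) :=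
  (Measure.infinitePi fun _ : ℕ => pairLaw f).map fun X => inducedNetwork (selection X)

theorem measurable_counter (n : ℕ) : Measurable fun X : ℕ → Sym2 ℤ => counter X n := by
  induction n with
  | zero => exact measurable_const
  | succ n ih =>
    exact (measurable_from_prod_countable_right
      (f := fun p : ℤ × Sym2 ℤ => nextCounter p.1 p.2) fun _ => measurable_of_countable _).comp
      (ih.prodMk (measurable_pi_apply n))

theorem measurable_selection : Measurable selection :=
  measurable_pi_lambda _ fun n =>
    (measurable_from_prod_countable_right
      (f := fun p : ℤ × Sym2 ℤ => blipEdge p.1 p.2) fun _ => measurable_of_countable _).comp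
      ((measurable_counter n).prodMk (measurable_pi_apply n))

theorem measurable_inducedNetwork : Measurable (inducedNetwork : Interactions ℕ → Network ℕ) := by
  have h : ∀ n, Measurable[_, ⊤] fun I : Interactions ℕ => (inducedNetwork I).restrict n := by
    intro n
    have h1 : Measurable[_, ⊤] (inducedNetwork : Interactions (Fin n) → Network (Fin n)) :=
      @measurable_of_countable _ _ _ ⊤ _ _ _
    have h2 : Measurable fun (I : Interactions ℕ) (k : Fin n) => I k :=
      measurable_pi_lambda _ fun k => measurable_pi_apply _
    exact h1.comp h2
  rw [show (instMeasurableSpaceNetworkNat : MeasurableSpace (Network ℕ)) = _ from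
    network_measurableSpace_eq]
  refine Measurable.of_le_map (iSup_le fun n => ?_)
  exact MeasurableSpace.comap_le_iff_le_map.2 (h n).le_map

instance (f : PairSimplex) : IsProbabilityMeasure (networkLaw f) :=
  Measure.isProbabilityMeasure_map
    (measurable_inducedNetwork.comp measurable_selection).aemeasurable

end EdgeExch

/-! This is a de Finetti theorem, and existence comes from sampling. Drawing edges with replacement
from the first `N` edges of the network is the law generated by an empirical element of the simplex,
whose masses are the proportions of edges (`exists_empirical`). By exchangeability, the expected
probability of a network on `n` edges under this law differs from its probability under `Y` by at
most the chance that `n` draws repeat an edge, which tends to zero (`tendsto_integral_empirical`).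
What remains is a limit of the laws of the empirical elements, and this needs compactness.

The simplex is not compact, since mass can escape to ever larger labels; in the limit such labels
behave like blips. So `f` is recorded by its degrees, its masses of pairs of labels `≥ 1` and its
loop mass. These statistics determine `f` (`ext_of_stats`), and for ranked elements they fill a set
that is compact for pointwise convergence (`isCompact_statPolytope`, `exists_stats_eq`). If `f` is
ranked, label `m + 1` has degree at most `2 / (m + 1)`; a label beyond `m` is then unlikely to occur
in two of `n` edges and may be replaced by a blip, after which the law depends on finitely many
statistics. Hence the probabilities of finite networks are uniform limits of continuous functions
(`exists_continuous_approx`, `continuous_finiteProbs`).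

Elements that generate the same law are reorderings of each other, because the law of large numbers
makes the statistics visible as frequencies in the network (`isReordering_of_networkLaw_eq`). The
ranked elements with a given law form a compact set, so a lexicographically first one exists
(`exists_mem_rankedSimplex`), and it is unique (`eq_of_networkLaw_eq`). Thus the probabilities of
finite networks identify `RankedSimplex`, as a Borel space, with a compact space (`rankedEquiv`), on
which probability measures have limit points.

Uniqueness of the mixing measure: under a fixed `f` disjoint blocks of edges are independent, so
products of cylinder probabilities are again cylinder probabilities (`networkLaw_mul`). Their span
is an algebra that separates points, and integrals over it determine a measure on the compact space
(`mixing_measure_unique`). -/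

namespace EdgeExch

/-! ### Comparing networks -/

/-- Two processes with the same coincidences between edge endpoints induce the same network. -/
theorem sameNetwork_of_endpoints {S : Type} {I J : Interactions S} (e e' : S × Bool → ℤ)
    (hI : ∀ k, I k = s(e (k, false), e (k, true)))
    (hJ : ∀ k, J k = s(e' (k, false), e' (k, true)))
    (h : ∀ p q, e p = e q ↔ e' p = e' q) : SameNetwork I J := by
  have hf : Function.FactorsThrough e' e := fun p q hpq => (h p q).1 hpq
  have hmem : ∀ v ∈ I.vertices, ∃ p, e p = v := by
    rintro v ⟨k, hv⟩
    rw [hI, Sym2.mem_iff] at hv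
    rcases hv with rfl | rfl <;> exact ⟨_, rfl⟩
  refine ⟨Function.extend e e' 0, ?_, fun k => ?_⟩
  · intro a ha b hb hab
    obtain ⟨p, rfl⟩ := hmem a ha
    obtain ⟨q, rfl⟩ := hmem b hb
    rwa [hf.extend_apply, hf.extend_apply, ← h] at hab
  · rw [hI, hJ, Sym2.map_mk, hf.extend_apply, hf.extend_apply]

theorem Network.pullback_inducedNetwork {S T : Type} (g : T → S) (I : Interactions S) :
    (inducedNetwork I).pullback g = inducedNetwork (I ∘ g) := rfl

theorem Network.pullback_pullback {S T U : Type} (g : T → S) (h : U → T) (E : Network S) :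
    (E.pullback g).pullback h = E.pullback (g ∘ h) := by
  induction E using Quotient.inductionOn
  rfl

theorem exists_inducedNetwork {S : Type} (E : Network S) : ∃ I, inducedNetwork I = E :=
  Quotient.exists_rep E

theorem inducedNetwork_eq_iff {S : Type} {I J : Interactions S} :
    inducedNetwork I = inducedNetwork J ↔ SameNetwork I J := Quotient.eq

/-- A network is determined by its restrictions to finitely many edges. -/
theorem Network.ext_restrict {E F : Network ℕ} (h : ∀ n, E.restrict n = F.restrict n) :
    E = F := by
  obtain ⟨I, rfl⟩ := exists_inducedNetwork E
  obtain ⟨J, rfl⟩ := exists_inducedNetwork F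
  have h' : ∀ n, SameNetwork (fun k : Fin n => I k) (fun k : Fin n => J k) := fun n =>
    inducedNetwork_eq_iff.1 (h n)
  choose ρ hinj hρ' using h'
  have hρ : ∀ n k, k < n → J k = (I k).map (ρ n) := fun n k hk => hρ' n ⟨k, hk⟩
  rw [inducedNetwork_eq_iff]
  -- The bijections `ρ n` for different `n` need not be compatible. For a vertex `v` of edge `k`,
  -- however, `ρ n v` is one of the at most two endpoints of `J k` as soon as `k < n`, so it is
  -- constant along an ultrafilter.
  let U : Ultrafilter ℕ := Filter.hyperfilter ℕ
  have hU : ∀ k : ℕ, ∀ᶠ n in (U : Filter ℕ), k < n := fun k =>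
    Nat.hyperfilter_le_atTop (Filter.eventually_gt_atTop k)
  have hlim : ∀ v, v ∈ Interactions.vertices I →
      ∃ w, ∀ᶠ n in (U : Filter ℕ), ρ n v = w := by
    rintro v ⟨k, hv⟩
    have hmem : ∀ᶠ n in (U : Filter ℕ), ρ n v ∈ J k := by
      filter_upwards [hU k] with n hn
      rw [hρ n k hn, Sym2.mem_map]
      exact ⟨v, hv, rfl⟩
    induction hJ : J k with | _ a b
    rw [hJ] at hmem
    simp only [Sym2.mem_iff] at hmem
    rcases Ultrafilter.eventually_or.1 hmem with h | h
    exacts [⟨a, h⟩, ⟨b, h⟩]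
  choose! τ hτ using hlim
  refine ⟨τ, ?_, fun k => ?_⟩
  · intro a ha b hb hab
    have ha' := ha
    have hb' := hb
    obtain ⟨k, hk⟩ := ha
    obtain ⟨l, hl⟩ := hb
    obtain ⟨n, h1, h2, h3, h4⟩ := (((hτ a ha').and ((hτ b hb').and ((hU k).and (hU l))))).exists
    exact hinj n ⟨⟨k, h3⟩, hk⟩ ⟨⟨l, h4⟩, hl⟩ (by rw [h1, h2, hab])
  · induction hI : I k with | _ a b
    have ha : a ∈ Interactions.vertices I := ⟨k, by simp [hI]⟩
    have hb : b ∈ Interactions.vertices I := ⟨k, by simp [hI]⟩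
    obtain ⟨n, h1, h2, h3⟩ := ((hτ a ha).and ((hτ b hb).and (hU k))).exists
    rw [hρ n k h3]
    simp [hI, h1, h2]

/-! ### Topology, Borel structure and cylinder sets of the space of networks. -/

theorem isInducing_restrict :
    Topology.IsInducing (fun (E : Network ℕ) (n : ℕ) => E.restrict n) := ⟨rfl⟩

theorem isEmbedding_restrict :
    Topology.IsEmbedding (fun (E : Network ℕ) (n : ℕ) => E.restrict n) :=
  ⟨isInducing_restrict, fun _ _ h => Network.ext_restrict fun n => congrFun h n⟩

/-- This and second countability allow disjoint images of Borel sets of sequences, which are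
analytic sets of networks, to be separated by a Borel set. -/
instance : T2Space (Network ℕ) := isEmbedding_restrict.t2Space

instance : SecondCountableTopology (Network ℕ) := isEmbedding_restrict.secondCountableTopology

/-- The networks whose restriction to the first `n` edges belongs to `S`. -/
def cylinderSet (n : ℕ) (S : Set (Network (Fin n))) : Set (Network ℕ) :=
  Network.restrict n ⁻¹' S

theorem measurableSet_cylinderSet (n : ℕ) (S : Set (Network (Fin n))) :
    MeasurableSet (cylinderSet n S) := by
  have h : Continuous (Network.restrict n) :=
    (continuous_apply n).comp isInducing_restrict.continuous
  exact (isOpen_discrete S |>.preimage h).measurableSet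

theorem measurable_toNetwork {α : Type*} [MeasurableSpace α] {g : α → Network ℕ}
    (h : ∀ (n : ℕ) (S : Set (Network (Fin n))), MeasurableSet {a | (g a).restrict n ∈ S}) : Measurable g := by
  rw [show (instMeasurableSpaceNetworkNat : MeasurableSpace (Network ℕ)) = _ from
    network_measurableSpace_eq]
  refine Measurable.of_le_map (iSup_le fun n => ?_)
  rintro _ ⟨S, -, rfl⟩
  exact h n S

theorem restrict_pullback {m n : ℕ} (E : Network ℕ) (g : Fin m → Fin n) :
    (E.restrict n).pullback g = E.pullback fun k => (g k : ℕ) :=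
  Network.pullback_pullback _ _ _

theorem measurableSet_pullback_mem {n : ℕ} (g : Fin n → ℕ) (S : Set (Network (Fin n))) :
    MeasurableSet {E : Network ℕ | E.pullback g ∈ S} := by
  have hlt : ∀ k, g k < Finset.univ.sup g + 1 := fun k =>
    Nat.lt_succ_of_le (Finset.le_sup (Finset.mem_univ k))
  have h := measurableSet_cylinderSet (Finset.univ.sup g + 1)
    {F | F.pullback (fun k => (⟨g k, hlt k⟩ : Fin _)) ∈ S}
  simp only [cylinderSet, preimage, mem_ofPred_eq, restrict_pullback] at h
  exact h

theorem measurable_pullback (g : ℕ → ℕ) : Measurable (Network.pullback g) := by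
  refine measurable_toNetwork fun n S => ?_
  simp only [Network.restrict, Network.pullback_pullback]
  exact measurableSet_pullback_mem _ S

/-- The cylinder sets over a single finite network. -/
def cylinders : Set (Set (Network ℕ)) := {B | ∃ n E, B = cylinderSet n {E}} ∪ {∅}

theorem restrict_restrict {m n : ℕ} (h : m ≤ n) (E : Network ℕ) :
    E.restrict m = (E.restrict n).pullback (Fin.castLE h) := by
  rw [restrict_pullback]
  rfl

/-- Two cylinders over single networks are nested or disjoint, since the longer restriction
determines the shorter one. -/
theorem isPiSystem_cylinders : IsPiSystem cylinders := by
  have key : ∀ m n E F, m ≤ n → (cylinderSet m {E} ∩ cylinderSet n {F}).Nonempty →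
      cylinderSet m {E} ∩ cylinderSet n {F} = cylinderSet n {F} := by
    rintro m n E F h ⟨G, hG, hG'⟩
    refine inter_eq_right.2 fun H hH => ?_
    simp only [cylinderSet, mem_preimage, mem_singleton_iff] at *
    rw [restrict_restrict h, hH, ← hG', ← restrict_restrict h, hG]
  rintro A hA B hB hne
  rcases hA with ⟨m, E, rfl⟩ | rfl
  · rcases hB with ⟨n, F, rfl⟩ | rfl
    · rcases le_total m n with h | h
      · exact Or.inl ⟨n, F, key m n E F h hne⟩
      · rw [inter_comm] at hne ⊢
        exact Or.inl ⟨m, E, key n m F E h hne⟩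
    · simp at hne
  · simp at hne

theorem generateFrom_cylinders :
    (inferInstance : MeasurableSpace (Network ℕ)) = MeasurableSpace.generateFrom cylinders := by
  refine le_antisymm ?_ (MeasurableSpace.generateFrom_le ?_)
  · rw [network_measurableSpace_eq]
    refine iSup_le fun n => ?_
    rintro _ ⟨S, -, rfl⟩
    have h : Network.restrict n ⁻¹' S = ⋃ E ∈ S, cylinderSet n {E} := by
      ext G; simp [cylinderSet]
    rw [h]
    exact MeasurableSet.biUnion (to_countable S) fun E _ =>
      MeasurableSpace.measurableSet_generateFrom (Or.inl ⟨n, E, rfl⟩)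
  · rintro _ (⟨n, E, rfl⟩ | rfl)
    · exact measurableSet_cylinderSet n _
    · exact MeasurableSet.empty

/-- The law of a random network is determined by the laws of its finite restrictions. -/
theorem measure_network_ext {μ ν : Measure (Network ℕ)} [IsProbabilityMeasure μ]
    [IsProbabilityMeasure ν] (h : ∀ n E, μ (cylinderSet n {E}) = ν (cylinderSet n {E})) :
    μ = ν := by
  refine ext_of_generate_finite _ generateFrom_cylinders isPiSystem_cylinders ?_ (by simp)
  rintro _ (⟨n, E, rfl⟩ | rfl)
  · exact h n E
  · simp

/-! ### Fresh vertices for the labels `0` and `-1` -/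

/-- Labels `j ≥ 1` are kept, the labels `0` and `-1` are replaced by vertices that are used by the
edge number `n` only. -/
def freshLabel (n : ℕ) (j : ℤ) : ℤ := if 1 ≤ j then j else j - 2 * n - 1

/-- The process in which each occurrence of the labels `0` and `-1` gets its own vertex. -/
def expand {S : Type} (ι : S → ℕ) (X : S → Sym2 ℤ) : Interactions S :=
  fun k => (X k).map (freshLabel (ι k))

/-- The pairs of labels that can have positive mass in an element of the simplex. -/
def ProperPair (s : Sym2 ℤ) : Prop := (∀ i ∈ s, -1 ≤ i) ∧ (-1 ∈ s → s = s(-1, 0))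

theorem exists_endpoints {S : Type} (X : S → Sym2 ℤ) :
    ∃ e : S × Bool → ℤ, ∀ k, X k = s(e (k, false), e (k, true)) := by
  have h : ∀ k, ∃ p : ℤ × ℤ, X k = s(p.1, p.2) := fun k => by
    induction X k with | _ a b
    exact ⟨(a, b), rfl⟩
  choose p hp using h
  exact ⟨fun q => if q.2 then (p q.1).2 else (p q.1).1, fun k => by simpa using hp k⟩

/-- Coincidences among labels `≥ 1` in different edges and among labels of the same edge determine
the network. -/
theorem expand_sameNetwork_of_endpoints {S : Type} {ι ι' : S → ℕ} (hι : Function.Injective ι)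
    (hι' : Function.Injective ι') {X X' : S → Sym2 ℤ} (e e' : S × Bool → ℤ)
    (hX : ∀ k, X k = s(e (k, false), e (k, true)))
    (hX' : ∀ k, X' k = s(e' (k, false), e' (k, true)))
    (hge : ∀ p, -1 ≤ e p) (hge' : ∀ p, -1 ≤ e' p)
    (hin : ∀ k, e (k, false) = e (k, true) ↔ e' (k, false) = e' (k, true))
    (hcross : ∀ p q : S × Bool, p.1 ≠ q.1 →
      (e p = e q ∧ 1 ≤ e p ↔ e' p = e' q ∧ 1 ≤ e' p)) :
    SameNetwork (expand ι X) (expand ι' X') := by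
  refine sameNetwork_of_endpoints (fun p => freshLabel (ι p.1) (e p))
    (fun p => freshLabel (ι' p.1) (e' p)) (fun k => by simp [expand, hX])
    (fun k => by simp [expand, hX']) ?_
  -- At edge `n` the labels `0` and `-1` become `-2n - 1` and `-2n - 2`: negative, and different for
  -- different `n`. Endpoints in different edges therefore coincide only through a common label `≥
  -- 1`.
  have hfresh : ∀ (ι : S → ℕ), Function.Injective ι → ∀ e : S × Bool → ℤ, (∀ p, -1 ≤ e p) →
      ∀ p q : S × Bool, freshLabel (ι p.1) (e p) = freshLabel (ι q.1) (e q) ↔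
        (p.1 = q.1 ∧ e p = e q) ∨ (p.1 ≠ q.1 ∧ e p = e q ∧ 1 ≤ e p) := by
    intro ι hι e he p q
    have hp := he p
    have hq := he q
    by_cases hpq : p.1 = q.1
    · rw [hpq]
      simp only [true_and, ne_eq, not_true_eq_false, false_and, or_false]
      unfold freshLabel
      split_ifs <;> omega
    · have hne : ι p.1 ≠ ι q.1 := fun h => hpq (hι h)
      simp only [hpq, false_and, ne_eq, not_false_eq_true, true_and, false_or]
      unfold freshLabel
      split_ifs <;> omega
  rintro ⟨k, a⟩ ⟨l, b⟩
  rw [hfresh ι hι e hge, hfresh ι' hι' e' hge']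
  by_cases hkl : k = l
  · subst hkl
    have h := hin k
    cases a <;> cases b <;> simp [h]
    rw [eq_comm, h, eq_comm]
  · simp [hkl, hcross ⟨k, a⟩ ⟨l, b⟩ hkl]

/-- The numbering `ι` only serves to keep the blips of different edges apart. This makes subfamilies
of edges comparable with edges numbered from zero. -/
theorem expand_sameNetwork {S : Type} {ι ι' : S → ℕ} (hι : Function.Injective ι)
    (hι' : Function.Injective ι') {X : S → Sym2 ℤ} (hX : ∀ k, ProperPair (X k)) :
    SameNetwork (expand ι X) (expand ι' X) := by
  obtain ⟨e, he⟩ := exists_endpoints X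
  have hge : ∀ p, -1 ≤ e p := by
    rintro ⟨k, b⟩
    refine (hX k).1 _ ?_
    rw [he]
    cases b <;> simp
  exact expand_sameNetwork_of_endpoints hι hι' e e he he hge hge (fun _ => Iff.rfl)
    fun _ _ _ => Iff.rfl

/-- Renaming the labels `≥ 1` injectively does not change the network. -/
theorem expand_map_sameNetwork {S : Type} {ι : S → ℕ} (hι : Function.Injective ι)
    {X : S → Sym2 ℤ} (hX : ∀ k, ProperPair (X k)) {ρ : ℤ → ℤ}
    (hρ : InjOn ρ {i | ∃ k, i ∈ X k}) (hneg : ρ (-1) = -1) (hzero : ρ 0 = 0)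
    (hpos : ∀ k, ∀ i ∈ X k, 1 ≤ i → 1 ≤ ρ i) :
    SameNetwork (expand ι X) (expand ι fun k => (X k).map ρ) := by
  obtain ⟨e, he⟩ := exists_endpoints X
  have hmem : ∀ p : S × Bool, e p ∈ X p.1 := by
    rintro ⟨k, b⟩
    rw [he]
    cases b <;> simp
  have hge : ∀ p, -1 ≤ e p := fun p => (hX p.1).1 _ (hmem p)
  have hcases : ∀ p, (1 ≤ e p ∧ 1 ≤ ρ (e p)) ∨ (e p ≤ 0 ∧ ρ (e p) = e p) := by
    intro p
    have h := hge p
    rcases lt_or_ge 0 (e p) with h0 | h0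
    · exact Or.inl ⟨h0, hpos _ _ (hmem p) h0⟩
    · refine Or.inr ⟨h0, ?_⟩
      have : e p = 0 ∨ e p = -1 := by omega
      rcases this with h | h <;> simp [h, hneg, hzero]
  have heq : ∀ p q, ρ (e p) = ρ (e q) ↔ e p = e q := fun p q =>
    hρ.eq_iff ⟨_, hmem p⟩ ⟨_, hmem q⟩
  refine expand_sameNetwork_of_endpoints hι hι e (fun p => ρ (e p)) he (fun k => by simp [he])
    hge (fun p => ?_) (fun k => (heq _ _).symm) (fun p q _ => ?_)
  · have := hge p
    rcases hcases p with h | h <;> omega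
  · rw [heq]
    refine and_congr_right fun _ => ?_
    rcases hcases p with h | h <;> omega

/-! ### The selection function and fresh vertices -/

theorem nextCounter_le (z : ℤ) (x : Sym2 ℤ) : nextCounter z x ≤ z := by
  unfold nextCounter
  split_ifs <;> omega

theorem counter_antitone (X : ℕ → Sym2 ℤ) : Antitone (counter X) :=
  antitone_nat_of_succ_le fun _ => nextCounter_le _ _

theorem counter_nonpos (X : ℕ → Sym2 ℤ) (n : ℕ) : counter X n ≤ 0 :=
  counter_antitone X (Nat.zero_le n)

/-- The new vertices of edge `k` lie in the interval from `counter X (k + 1)` up to, but excluding,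
`counter X k`. These intervals are disjoint and consist of negative integers, so the selection
function has the same coincidences of endpoints as the fresh labels. -/
theorem selection_sameNetwork {X : ℕ → Sym2 ℤ} (hX : ∀ k, ProperPair (X k)) :
    SameNetwork (expand id X) (selection X) := by
  have hsel : ∀ k, ∃ a b a' b' : ℤ, X k = s(a, b) ∧ selection X k = s(a', b') ∧
      -1 ≤ a ∧ -1 ≤ b ∧ (a = b ↔ a' = b') ∧
      (1 ≤ a ∧ a' = a ∨ a ≤ 0 ∧ counter X (k + 1) ≤ a' ∧ a' < counter X k) ∧
      (1 ≤ b ∧ b' = b ∨ b ≤ 0 ∧ counter X (k + 1) ≤ b' ∧ b' < counter X k) := by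
    intro k
    have hz := counter_nonpos X k
    have hk := hX k
    simp only [selection, counter]
    generalize counter X k = z at *
    generalize X k = x at *
    induction x with | _ a b
    obtain ⟨h1, h2⟩ := hk
    have ha := h1 a (by simp)
    have hb := h1 b (by simp)
    simp only [Sym2.mem_iff] at h2
    by_cases h0 : (0 : ℤ) ∈ s(a, b)
    · by_cases hm : s(a, b) = s(-1, 0)
      · refine ⟨-1, 0, z - 1, z - 2, hm, by simp [blipEdge, hm], by norm_num, by norm_num, ?_⟩
        simp [nextCounter, hm]
      · have hna : a ≠ -1 := fun h => hm (h2 (Or.inl h.symm))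
        have hnb : b ≠ -1 := fun h => hm (h2 (Or.inr h.symm))
        refine ⟨a, b, if a = 0 then z - 1 else a, if b = 0 then z - 1 else b, rfl, ?_, ha, hb, ?_⟩
        · simp [blipEdge, h0, hm]
        · simp only [nextCounter, h0, hm, not_true_eq_false, if_false]
          split_ifs <;> omega
    · have hna : (-1 : ℤ) ∉ s(a, b) := fun h => h0 (by
        rw [Sym2.mem_iff] at h
        rw [h2 h]; simp)
      refine ⟨a, b, a, b, rfl, by simp [blipEdge, h0], ha, hb, Iff.rfl, ?_⟩
      simp only [Sym2.mem_iff, not_or] at h0 hna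
      omega
  choose a b a' b' hab hab' hga hgb hin hca hcb using hsel
  refine sameNetwork_of_endpoints
    (fun p => freshLabel p.1 (if p.2 then b p.1 else a p.1))
    (fun p => if p.2 then b' p.1 else a' p.1)
    (fun k => by simp [expand, hab]) (fun k => by simp [hab']) ?_
  set e : ℕ × Bool → ℤ := fun p => if p.2 then b p.1 else a p.1 with he
  set e' : ℕ × Bool → ℤ := fun p => if p.2 then b' p.1 else a' p.1 with he'
  have hge : ∀ p, -1 ≤ e p := by
    rintro ⟨k, _ | _⟩ <;> simp [he, hga, hgb]
  have hc : ∀ p : ℕ × Bool, 1 ≤ e p ∧ e' p = e p ∨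
      e p ≤ 0 ∧ counter X (p.1 + 1) ≤ e' p ∧ e' p < counter X p.1 := by
    rintro ⟨k, _ | _⟩
    exacts [hca k, hcb k]
  have hkey : ∀ p q : ℕ × Bool, p.1 < q.1 →
      (freshLabel p.1 (e p) = freshLabel q.1 (e q) ↔ e' p = e' q) := by
    intro p q hpq
    have h1 := hge p
    have h2 := hge q
    have h3 := hc p
    have h4 := hc q
    have h5 := counter_antitone X (Nat.succ_le_of_lt hpq)
    have h6 := counter_nonpos X p.1
    have h7 := counter_nonpos X q.1
    simp only [Nat.succ_eq_add_one] at h5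
    unfold freshLabel
    split_ifs <;> omega
  rintro ⟨k, c⟩ ⟨l, d⟩
  rcases lt_trichotomy k l with h | rfl | h
  · exact hkey (k, c) (l, d) h
  · have hk := hin k
    have h1 := hga k
    have h2 := hgb k
    have h3 : freshLabel k (a k) = freshLabel k (b k) ↔ a' k = b' k := by
      rw [← hk]
      unfold freshLabel
      split_ifs <;> omega
    cases c <;> cases d <;> simp [h3]
    rw [eq_comm, h3, eq_comm]
  · rw [eq_comm, hkey (l, d) (k, c) h, eq_comm]

end EdgeExch

namespace EdgeExch

/-! ### Laws of pairs of labels -/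

theorem pairLaw_singleton (f : PairSimplex) (s : Sym2 ℤ) :
    pairLaw f {s} = ENNReal.ofReal (f.mass s) := by
  rw [pairLaw, Measure.sum_apply _ (measurableSet_singleton s), tsum_eq_single s]
  · simp
  · intro t ht
    simp [ht]

theorem pairLaw_real_singleton (f : PairSimplex) (s : Sym2 ℤ) :
    (pairLaw f).real {s} = f.mass s := by
  rw [measureReal_def, pairLaw_singleton, ENNReal.toReal_ofReal (f.nonneg s)]

theorem pairLaw_real_apply (f : PairSimplex) (A : Set (Sym2 ℤ)) :
    (pairLaw f).real A = ∑' s, A.indicator f.mass s := by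
  rw [measureReal_def, ← Measure.tsum_indicator_apply_singleton _ A MeasurableSet.of_discrete,
    ENNReal.tsum_toReal_eq]
  · refine tsum_congr fun s => ?_
    by_cases hs : s ∈ A <;> simp [hs, pairLaw_singleton, f.nonneg s]
  · intro s
    by_cases hs : s ∈ A <;> simp [hs]

theorem PairSimplex.properPair_of_pos (f : PairSimplex) {s : Sym2 ℤ} (hs : f.mass s ≠ 0) :
    ProperPair s := by
  refine ⟨fun i hi => ?_, fun hm => ?_⟩
  · by_contra h
    exact hs (f.label_ge s i hi (not_le.1 h))
  · obtain ⟨j, rfl⟩ := Sym2.mem_iff_exists.1 hm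
    by_cases hj : j = 0
    · rw [hj]
    · exact absurd (f.neg_one j hj) hs

theorem pairLaw_eq_zero {f : PairSimplex} {A : Set (Sym2 ℤ)} (hA : ∀ s ∈ A, f.mass s = 0) :
    pairLaw f A = 0 := by
  rw [← measure_biUnion_null_iff (to_countable A) (s := fun s => {s})
    (μ := pairLaw f) |>.2 ?_]
  · simp
  · intro s hs
    rw [pairLaw_singleton, hA s hs, ENNReal.ofReal_zero]

theorem ae_mass_ne_zero (f : PairSimplex) : ∀ᵐ s ∂pairLaw f, f.mass s ≠ 0 :=
  pairLaw_eq_zero fun _ hs => not_not.1 hs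

/-- A degree is a probability, to which the law of large numbers applies. The sum over `j ≥ 0` omits
only pairs of `i` with a negative label, and these have mass zero; a loop at `i` counts once. -/
theorem PairSimplex.degree_eq (f : PairSimplex) {i : ℤ} (hi : 1 ≤ i) :
    f.degree i = (pairLaw f).real {s | i ∈ s} := by
  have hinj : Function.Injective fun j : ℕ => s(i, (j : ℤ)) := by
    intro a b h
    simpa using Sym2.congr_right.1 h
  rw [pairLaw_real_apply, ← hinj.tsum_eq]
  · exact tsum_congr fun j => by simp
  · intro s hs
    obtain ⟨his, hs⟩ := indicator_apply_ne_zero.1 hs |>.imp id id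
    obtain ⟨j, rfl⟩ := Sym2.mem_iff_exists.1 his
    obtain ⟨h1, h2⟩ := f.properPair_of_pos hs
    have hj : 0 ≤ j := by
      by_contra h
      have hj : j = -1 := by
        have := h1 j (by simp)
        omega
      subst hj
      have h3 : i ∈ s((-1 : ℤ), 0) := h2 (by simp) ▸ (by simp : i ∈ s(i, -1))
      simp at h3
      omega
    exact ⟨j.toNat, by simp [hj]⟩

theorem PairSimplex.degree_nonneg (f : PairSimplex) (i : ℤ) : 0 ≤ f.degree i :=
  tsum_nonneg fun _ => f.nonneg _

theorem PairSimplex.mem_active_of_mass_ne_zero (f : PairSimplex) {s : Sym2 ℤ}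
    (hs : f.mass s ≠ 0) {i : ℤ} (hi : i ∈ s) (h1 : 1 ≤ i) : i ∈ f.active := by
  refine ⟨h1, ?_⟩
  rw [f.degree_eq h1]
  refine lt_of_lt_of_le ((f.nonneg s).lt_of_ne hs.symm) ?_
  rw [← pairLaw_real_singleton]
  exact measureReal_mono (by simpa using hi)

/-- The labels that can be seen in a pair drawn from `f`. -/
theorem PairSimplex.label_of_mass_ne_zero (f : PairSimplex) {s : Sym2 ℤ}
    (hs : f.mass s ≠ 0) {i : ℤ} (hi : i ∈ s) : i = -1 ∨ i = 0 ∨ i ∈ f.active := by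
  have h := (f.properPair_of_pos hs).1 i hi
  rcases lt_or_ge 0 i with h0 | h0
  · exact Or.inr (Or.inr (f.mem_active_of_mass_ne_zero hs hi h0))
  · omega

theorem measure_le_of_singleton {α : Type*} [Countable α] [MeasurableSpace α]
    [MeasurableSingletonClass α] {μ ν : Measure α} (h : ∀ a, μ {a} ≤ ν {a}) : μ ≤ ν := by
  refine Measure.le_iff.2 fun s hs => ?_
  rw [← Measure.tsum_indicator_apply_singleton μ s hs,
    ← Measure.tsum_indicator_apply_singleton ν s hs]
  exact ENNReal.tsum_le_tsum fun a => indicator_le_indicator (h a)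

/-- The hypothesis says nothing about `g` on pairs outside the image of `ρ`. Comparing singletons
gives `≤`, and equality follows because both sides have total mass one. -/
theorem pairLaw_map_eq {f g : PairSimplex} {ρ : ℤ → ℤ}
    (hinj : InjOn ρ {i | i = -1 ∨ i = 0 ∨ i ∈ f.active})
    (h : ∀ s : Sym2 ℤ, (∀ i ∈ s, i = -1 ∨ i = 0 ∨ i ∈ f.active) →
      g.mass (s.map ρ) = f.mass s) : (pairLaw f).map (Sym2.map ρ) = pairLaw g := by
  have hm : Measurable (Sym2.map ρ) := measurable_of_countable _
  have : IsProbabilityMeasure ((pairLaw f).map (Sym2.map ρ)) :=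
    Measure.isProbabilityMeasure_map hm.aemeasurable
  refine Measure.eq_of_le_of_isProbabilityMeasure (measure_le_of_singleton fun t => ?_)
  rw [Measure.map_apply hm (measurableSet_singleton t)]
  set G : Set (Sym2 ℤ) := {s | ∀ i ∈ s, i = -1 ∨ i = 0 ∨ i ∈ f.active}
  have hG : ∀ᵐ s ∂pairLaw f, s ∈ G := by
    filter_upwards [ae_mass_ne_zero f] with s hs i hi
    exact f.label_of_mass_ne_zero hs hi
  have hGinj : InjOn (Sym2.map ρ) G := by
    intro a ha b hb hab
    have hl : ∀ s ∈ G, (s.map ρ).map (Function.invFunOn ρ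
        {i | i = -1 ∨ i = 0 ∨ i ∈ f.active}) = s := by
      intro s hs
      have hc := Sym2.map_congr (s := s) (f := Function.invFunOn ρ
        {i | i = -1 ∨ i = 0 ∨ i ∈ f.active} ∘ ρ) (g := id)
        fun i hi => hinj.leftInvOn_invFunOn (hs i hi)
      rw [Sym2.map_map, hc, Sym2.map_id, id]
    rw [← hl a ha, ← hl b hb, hab]
  by_cases ht : ∃ s ∈ G, s.map ρ = t
  · obtain ⟨s, hs, rfl⟩ := ht
    rw [pairLaw_singleton, h s hs, ← pairLaw_singleton]
    refine measure_mono_ae ?_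
    filter_upwards [hG] with a ha hab
    exact hGinj ha hs hab
  · refine le_of_eq_of_le ?_ zero_le
    rw [measure_eq_zero_iff_ae_notMem]
    filter_upwards [hG] with a ha hab
    exact ht ⟨a, ha, hab⟩

/-! ### Laws of networks -/

theorem ae_properPair (f : PairSimplex) :
    ∀ᵐ X ∂Measure.infinitePi fun _ : ℕ => pairLaw f, ∀ k, ProperPair (X k) := by
  refine ae_all_iff.2 fun k => ?_
  have h : ∀ᵐ s ∂pairLaw f, ProperPair s := by
    filter_upwards [ae_mass_ne_zero f] with s hs
    exact f.properPair_of_pos hs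
  exact (measurePreserving_eval_infinitePi (fun _ : ℕ => pairLaw f) k).quasiMeasurePreserving.ae h

/-- The network generated by a sequence of pairs of labels. -/
def generatedNetwork (X : ℕ → Sym2 ℤ) : Network ℕ := inducedNetwork (expand id X)

/-- The network generated by finitely many pairs of labels. -/
def finiteNetwork {n : ℕ} (y : Fin n → Sym2 ℤ) : Network (Fin n) :=
  inducedNetwork (expand Fin.val y)

theorem measurable_expand : Measurable fun X : ℕ → Sym2 ℤ => expand id X :=
  measurable_pi_lambda _ fun k => (measurable_of_countable _).comp (measurable_pi_apply k)

theorem measurable_generatedNetwork : Measurable generatedNetwork :=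
  measurable_inducedNetwork.comp measurable_expand

theorem networkLaw_eq_map (f : PairSimplex) :
    networkLaw f = (Measure.infinitePi fun _ : ℕ => pairLaw f).map generatedNetwork := by
  refine Measure.map_congr ?_
  filter_upwards [ae_properPair f] with X hX
  exact (inducedNetwork_eq_iff.2 (selection_sameNetwork hX)).symm

theorem generatedNetwork_pullback {n : ℕ} {u : Fin n → ℕ} (hu : Function.Injective u)
    {X : ℕ → Sym2 ℤ} (hX : ∀ k, ProperPair (X k)) :
    (generatedNetwork X).pullback u = finiteNetwork fun k => X (u k) :=
  inducedNetwork_eq_iff.2 (expand_sameNetwork hu Fin.val_injective fun k => hX (u k))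

/-- Any `n` distinct terms of an i.i.d. sequence have the same joint law, and the numbering of the
edges does not affect the network. -/
theorem networkLaw_pullback (f : PairSimplex) {n : ℕ} {u : Fin n → ℕ}
    (hu : Function.Injective u) (S : Set (Network (Fin n))) :
    networkLaw f {E | E.pullback u ∈ S} =
      Measure.pi (fun _ : Fin n => pairLaw f) {y | finiteNetwork y ∈ S} := by
  rw [networkLaw_eq_map, Measure.map_apply measurable_generatedNetwork
    (measurableSet_pullback_mem u S), ← Measure.infinitePi_eq_pi,
    ← Measure.map_infinitePi_infinitePi_of_inj (P := fun _ : ℕ => pairLaw f) hu,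
    Measure.map_apply (by fun_prop) (to_countable _).measurableSet]
  refine measure_congr ?_
  filter_upwards [ae_properPair f] with X hX
  exact propext (by
    change (generatedNetwork X).pullback u ∈ S ↔ finiteNetwork (fun k => X (u k)) ∈ S
    rw [generatedNetwork_pullback hu hX])

theorem networkLaw_cylinderSet (f : PairSimplex) (n : ℕ) (S : Set (Network (Fin n))) :
    networkLaw f (cylinderSet n S) =
      Measure.pi (fun _ : Fin n => pairLaw f) {y | finiteNetwork y ∈ S} :=
  networkLaw_pullback f Fin.val_injective S

/-- The restrictions of a generated network to disjoint sets of edges are independent. -/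
theorem networkLaw_mul (f : PairSimplex) (m n : ℕ) (S : Set (Network (Fin m)))
    (T : Set (Network (Fin n))) :
    networkLaw f (cylinderSet m S) * networkLaw f (cylinderSet n T) =
      networkLaw f (cylinderSet (m + n)
        {E | E.pullback (Fin.castAdd n) ∈ S ∧ E.pullback (Fin.natAdd m) ∈ T}) := by
  let u : Fin m ⊕ Fin n → ℕ := Sum.elim (fun k => k) fun k => m + k
  have hu : Function.Injective u := by
    rintro (a | a) (b | b) h <;> simp only [u, Sum.elim_inl, Sum.elim_inr] at h
    · rw [Fin.ext h]
    · omega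
    · omega
    · rw [Fin.ext (Nat.add_left_cancel h)]
  have hmp := measurePreserving_sumPiEquivProdPi (fun _ : Fin m ⊕ Fin n => pairLaw f)
  rw [networkLaw_cylinderSet, networkLaw_cylinderSet, ← Measure.prod_prod,
    ← hmp.measure_preimage (to_countable _).measurableSet.nullMeasurableSet,
    ← Measure.infinitePi_eq_pi,
    ← Measure.map_infinitePi_infinitePi_of_inj (P := fun _ : ℕ => pairLaw f) hu,
    Measure.map_apply (by fun_prop) (to_countable _).measurableSet, networkLaw_eq_map,
    Measure.map_apply measurable_generatedNetwork (measurableSet_cylinderSet _ _)]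
  refine measure_congr ?_
  filter_upwards [ae_properPair f] with X hX
  refine propext ?_
  change (finiteNetwork (fun k : Fin m => X k) ∈ S ∧
      finiteNetwork (fun k : Fin n => X (m + k)) ∈ T) ↔
    ((generatedNetwork X).restrict (m + n)).pullback (Fin.castAdd n) ∈ S ∧
      ((generatedNetwork X).restrict (m + n)).pullback (Fin.natAdd m) ∈ T
  rw [restrict_pullback, restrict_pullback, generatedNetwork_pullback _ hX,
    generatedNetwork_pullback _ hX]
  · rfl
  · exact Fin.val_injective.comp (Fin.natAdd_injective n m)
  · exact Fin.val_injective.comp (Fin.castAdd_injective m n)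

theorem PairSimplex.IsReordering.networkLaw_eq {f g : PairSimplex} (h : f.IsReordering g) :
    networkLaw f = networkLaw g := by
  obtain ⟨ρ, hneg, hzero, hbij, hmass⟩ := h
  have hpos : ∀ i ∈ f.active, 1 ≤ ρ i := fun i hi => (hbij.mapsTo hi).1
  have hinj : InjOn ρ {i | i = -1 ∨ i = 0 ∨ i ∈ f.active} := by
    rintro a (rfl | rfl | ha) b (rfl | rfl | hb) hab <;>
      first
      | rfl
      | exact hbij.injOn ha hb hab
      | (simp only [hneg, hzero] at hab; try have := hpos _ ‹_›
         omega)
  have hR : Measurable (Sym2.map ρ) := measurable_of_countable _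
  rw [networkLaw_eq_map, networkLaw_eq_map, ← pairLaw_map_eq hinj hmass,
    ← Measure.infinitePi_map_pi _ fun _ => hR,
    Measure.map_map measurable_generatedNetwork (by fun_prop)]
  refine Measure.map_congr ?_
  have hae : ∀ᵐ X ∂Measure.infinitePi fun _ : ℕ => pairLaw f, ∀ k, f.mass (X k) ≠ 0 :=
    ae_all_iff.2 fun k => (measurePreserving_eval_infinitePi
      (fun _ : ℕ => pairLaw f) k).quasiMeasurePreserving.ae (ae_mass_ne_zero f)
  filter_upwards [hae] with X hX
  refine inducedNetwork_eq_iff.2 (expand_map_sameNetwork Function.injective_id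
    (fun k => f.properPair_of_pos (hX k)) (hinj.mono ?_) hneg hzero ?_)
  · rintro i ⟨k, hi⟩
    exact f.label_of_mass_ne_zero (hX k) hi
  · intro k i hi h1
    exact hpos i (f.mem_active_of_mass_ne_zero (hX k) hi h1)

end EdgeExch

namespace EdgeExch

open Filter Topology

/-! ### An element of the simplex is determined by pair masses, degrees and the mass of loops -/

namespace PairSimplex

/-- The total mass of the loops. -/
noncomputable def loopMass (f : PairSimplex) : ℝ := (pairLaw f).real {s | s.IsDiag}

theorem real_eq_of_bijOn {f g : PairSimplex} {R : Sym2 ℤ → Sym2 ℤ} {A B : Set (Sym2 ℤ)}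
    (h : BijOn R A B) (hm : ∀ s ∈ A, g.mass (R s) = f.mass s) :
    (pairLaw f).real A = (pairLaw g).real B := by
  rw [pairLaw_real_apply, pairLaw_real_apply, ← tsum_subtype, ← tsum_subtype,
    ← (h.equiv R).tsum_eq]
  exact tsum_congr fun s => (hm s s.2).symm

theorem real_eq_of_label_bijOn {f g : PairSimplex} {ρ : ℤ → ℤ} {W W' : Set ℤ}
    (h : BijOn ρ W W') {P P' : Set (Sym2 ℤ)}
    (hP : ∀ s : Sym2 ℤ, (∀ i ∈ s, i ∈ W) → (s ∈ P ↔ s.map ρ ∈ P'))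
    (hm : ∀ s : Sym2 ℤ, (∀ i ∈ s, i ∈ W) → s ∈ P → g.mass (s.map ρ) = f.mass s) :
    (pairLaw f).real {s | (∀ i ∈ s, i ∈ W) ∧ s ∈ P} =
      (pairLaw g).real {s | (∀ i ∈ s, i ∈ W') ∧ s ∈ P'} := by
  refine real_eq_of_bijOn (R := Sym2.map ρ) ⟨?_, ?_, ?_⟩ fun s hs => hm s hs.1 hs.2
  · rintro s ⟨hs, hsP⟩
    refine ⟨fun i hi => ?_, (hP s hs).1 hsP⟩
    obtain ⟨j, hj, rfl⟩ := Sym2.mem_map.1 hi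
    exact h.mapsTo (hs j hj)
  · rintro a ⟨ha, -⟩ b ⟨hb, -⟩ hab
    have hl : ∀ s : Sym2 ℤ, (∀ i ∈ s, i ∈ W) → (s.map ρ).map (Function.invFunOn ρ W) = s := by
      intro s hs
      have hc := Sym2.map_congr (s := s) (f := Function.invFunOn ρ W ∘ ρ) (g := id)
        fun i hi => h.injOn.leftInvOn_invFunOn (hs i hi)
      rw [Sym2.map_map, hc, Sym2.map_id, id]
    rw [← hl a ha, ← hl b hb, hab]
  · rintro t ⟨ht, htP⟩
    induction t with | _ a b
    obtain ⟨a, ha, rfl⟩ := h.surjOn (ht a (by simp))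
    obtain ⟨b, hb, rfl⟩ := h.surjOn (ht b (by simp))
    have hs : ∀ i ∈ s(a, b), i ∈ W := by
      intro i hi
      rcases Sym2.mem_iff.1 hi with rfl | rfl <;> assumption
    exact ⟨s(a, b), ⟨hs, (hP _ hs).2 htP⟩, rfl⟩

theorem real_eq_add_mass {f : PairSimplex} {A B : Set (Sym2 ℤ)} {t : Sym2 ℤ}
    (h : ∀ s, f.mass s ≠ 0 → (s ∈ A ↔ s ∈ B ∨ s = t)) (ht : t ∉ B) :
    (pairLaw f).real A = (pairLaw f).real B + f.mass t := by
  rw [← pairLaw_real_singleton f t, ← measureReal_union (by simpa using ht)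
    (measurableSet_singleton t)]
  refine measureReal_congr ?_
  filter_upwards [ae_mass_ne_zero f] with s hs
  exact propext (h s hs)

/-- The masses that involve `0` or `-1` are recovered by subtraction: `{0, i}` is the degree of `i`
minus the active pairs at `i`, `{0, 0}` is the loop mass minus the active loops, and `{-1, 0}` is
what all other pairs leave of the total mass one. -/
theorem mass_map_eq_of_stats {f g : PairSimplex} {ρ : ℤ → ℤ} (hneg : ρ (-1) = -1)
    (hzero : ρ 0 = 0) (hbij : BijOn ρ f.active g.active)
    (hpair : ∀ i ∈ f.active, ∀ j ∈ f.active, g.mass s(ρ i, ρ j) = f.mass s(i, j))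
    (hdeg : ∀ i ∈ f.active, g.degree (ρ i) = f.degree i) (hloop : g.loopMass = f.loopMass)
    (s : Sym2 ℤ) (hs : ∀ i ∈ s, i = -1 ∨ i = 0 ∨ i ∈ f.active) :
    g.mass (s.map ρ) = f.mass s := by
  have hact : ∀ (f : PairSimplex), ∀ i ∈ f.active, i ≠ -1 ∧ i ≠ 0 := by
    intro f i hi
    have := hi.1
    omega
  have hpairs : ∀ s : Sym2 ℤ, (∀ i ∈ s, i ∈ f.active) → g.mass (s.map ρ) = f.mass s := by
    intro s hs
    induction s with | _ a b
    exact hpair a (hs a (by simp)) b (hs b (by simp))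
  have hmem : ∀ i ∈ f.active, ∀ s : Sym2 ℤ, (∀ j ∈ s, j ∈ f.active) →
      (i ∈ s ↔ ρ i ∈ s.map ρ) := by
    intro i hi s hs
    rw [Sym2.mem_map]
    refine ⟨fun h => ⟨i, h, rfl⟩, ?_⟩
    rintro ⟨j, hj, hij⟩
    rwa [← hbij.injOn (hs j hj) hi hij]
  have hzi : ∀ i ∈ f.active, g.mass s(0, ρ i) = f.mass s(0, i) := by
    have hsplit : ∀ (f : PairSimplex), ∀ i ∈ f.active, f.degree i =
        (pairLaw f).real {s | (∀ j ∈ s, j ∈ f.active) ∧ s ∈ {s : Sym2 ℤ | i ∈ s}} +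
          f.mass s(0, i) := by
      intro f i hi
      rw [f.degree_eq hi.1]
      refine real_eq_add_mass (fun s hs => ?_) fun h => ?_
      · simp only [mem_ofPred_eq]
        constructor
        · intro h
          obtain ⟨j, rfl⟩ := Sym2.mem_iff_exists.1 h
          rcases f.label_of_mass_ne_zero hs (i := j) (by simp) with rfl | rfl | hj
          · exact absurd (f.neg_one i (hact f i hi).2) (by rwa [Sym2.eq_swap])
          · exact Or.inr Sym2.eq_swap
          · refine Or.inl ⟨fun k hk => ?_, h⟩
            rcases Sym2.mem_iff.1 hk with rfl | rfl <;> assumption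
        · rintro (h | rfl)
          · exact h.2
          · simp
      · exact (hact f 0 (h.1 0 (by simp))).2 rfl
    intro i hi
    have h1 := hsplit f i hi
    have h2 := hsplit g (ρ i) (hbij.mapsTo hi)
    rw [← real_eq_of_label_bijOn (f := f) (P := {s | i ∈ s}) (P' := {s | ρ i ∈ s}) hbij (fun s hs => hmem i hi s hs)
      fun s hs _ => hpairs s hs, hdeg i hi] at h2
    linarith
  have hzz : g.mass s(0, 0) = f.mass s(0, 0) := by
    have hsplit : ∀ (f : PairSimplex), f.loopMass =
        (pairLaw f).real {s | (∀ j ∈ s, j ∈ f.active) ∧ s ∈ {s : Sym2 ℤ | s.IsDiag}} +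
          f.mass s(0, 0) := by
      intro f
      refine real_eq_add_mass (fun s hs => ?_) fun h => ?_
      · simp only [mem_ofPred_eq]
        induction s with | _ a b
        constructor
        · intro h
          obtain rfl := Sym2.mk_isDiag_iff.1 h
          rcases f.label_of_mass_ne_zero hs (i := a) (by simp) with rfl | rfl | hj
          · exact absurd (f.neg_one (-1) (by norm_num)) hs
          · exact Or.inr rfl
          · refine Or.inl ⟨fun k hk => ?_, h⟩
            rcases Sym2.mem_iff.1 hk with rfl | rfl <;> assumption
        · rintro (h | h)
          · exact h.2
          · rw [h]; simp
      · exact (hact f 0 (h.1 0 (by simp))).2 rfl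
    have h1 := hsplit f
    have h2 := hsplit g
    rw [← real_eq_of_label_bijOn (f := f) (P := {s | s.IsDiag}) hbij ?_
      fun s hs _ => hpairs s hs, hloop] at h2
    · linarith
    · intro s hs
      induction s with | _ a b
      simp only [mem_ofPred_eq, Sym2.mk_isDiag_iff, Sym2.map_mk]
      exact (hbij.injOn.eq_iff (hs a (by simp)) (hs b (by simp))).symm
  have hrest : ∀ s : Sym2 ℤ, (∀ i ∈ s, i = -1 ∨ i = 0 ∨ i ∈ f.active) → s ≠ s(-1, 0) →
      g.mass (s.map ρ) = f.mass s := by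
    intro s hs hne
    induction s with | _ a b
    have ha := hs a (by simp)
    have hb := hs b (by simp)
    rw [Sym2.map_mk]
    rcases ha with rfl | rfl | ha
    · have hb0 : b ≠ 0 := fun h => hne (by rw [h])
      have hb0' : ρ b ≠ 0 := by
        rcases hb with rfl | rfl | hb
        · rw [hneg]; norm_num
        · exact absurd rfl hb0
        · exact (hact g _ (hbij.mapsTo hb)).2
      rw [hneg, g.neg_one _ hb0', f.neg_one _ hb0]
    · rcases hb with rfl | rfl | hb
      · exact absurd Sym2.eq_swap hne
      · rw [hzero, hzz]
      · rw [hzero, hzi b hb]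
    · rcases hb with rfl | rfl | hb
      · rw [hneg, Sym2.eq_swap, g.neg_one _ (hact g _ (hbij.mapsTo ha)).2, Sym2.eq_swap,
          f.neg_one _ (hact f _ ha).2]
      · rw [hzero, Sym2.eq_swap, hzi a ha, Sym2.eq_swap]
      · exact hpair a ha b hb
  by_cases hne : s = s(-1, 0)
  · have hW : BijOn ρ {i | i = -1 ∨ i = 0 ∨ i ∈ f.active} {i | i = -1 ∨ i = 0 ∨ i ∈ g.active} := by
      refine ⟨?_, ?_, ?_⟩
      · rintro i (rfl | rfl | hi)
        · exact Or.inl hneg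
        · exact Or.inr (Or.inl hzero)
        · exact Or.inr (Or.inr (hbij.mapsTo hi))
      · rintro a (rfl | rfl | ha) b (rfl | rfl | hb) hab
        · rfl
        · omega
        · exact absurd (hab.symm.trans hneg) (hact g _ (hbij.mapsTo hb)).1
        · omega
        · rfl
        · exact absurd (hab.symm.trans hzero) (hact g _ (hbij.mapsTo hb)).2
        · exact absurd (hab.trans hneg) (hact g _ (hbij.mapsTo ha)).1
        · exact absurd (hab.trans hzero) (hact g _ (hbij.mapsTo ha)).2
        · exact hbij.injOn ha hb hab
      · rintro i (rfl | rfl | hi)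
        · exact ⟨-1, Or.inl rfl, hneg⟩
        · exact ⟨0, Or.inr (Or.inl rfl), hzero⟩
        · obtain ⟨j, hj, rfl⟩ := hbij.surjOn hi
          exact ⟨j, Or.inr (Or.inr hj), rfl⟩
    have hsplit : ∀ (f : PairSimplex), (pairLaw f).real univ =
        (pairLaw f).real {s | (∀ j ∈ s, j ∈ {i | i = -1 ∨ i = 0 ∨ i ∈ f.active}) ∧
          s ∈ ({s(-1, 0)}ᶜ : Set (Sym2 ℤ))} + f.mass s(-1, 0) := by
      intro f
      refine real_eq_add_mass (fun s hs => ?_) fun h => h.2 rfl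
      simp only [mem_univ, true_iff, mem_ofPred_eq, mem_compl_iff, mem_singleton_iff]
      by_cases h : s = s(-1, 0)
      · exact Or.inr h
      · exact Or.inl ⟨fun j hj => f.label_of_mass_ne_zero hs hj, h⟩
    have h1 := hsplit f
    have h2 := hsplit g
    rw [← real_eq_of_label_bijOn (f := f) (P := {s(-1, 0)}ᶜ) hW ?_ fun s hs hs' => hrest s hs hs']
      at h2
    · rw [probReal_univ] at h1 h2
      rw [hne, Sym2.map_mk, hneg, hzero]
      linarith
    · intro s hs
      induction s with | _ a b
      have ha := hs a (by simp)
      have hb := hs b (by simp)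
      have h1 : ∀ i ∈ {i | i = -1 ∨ i = 0 ∨ i ∈ f.active}, (ρ i = -1 ↔ i = -1) := fun i hi => by
        rw [← hneg, hW.injOn.eq_iff hi (Or.inl rfl), hneg]
      have h0 : ∀ i ∈ {i | i = -1 ∨ i = 0 ∨ i ∈ f.active}, (ρ i = 0 ↔ i = 0) := fun i hi => by
        rw [← hzero, hW.injOn.eq_iff hi (Or.inr (Or.inl rfl)), hzero]
      simp only [mem_compl_iff, mem_singleton_iff, Sym2.map_mk, Sym2.eq_iff, h1 a ha, h1 b hb,
        h0 a ha, h0 b hb]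
  · exact hrest s hs hne

theorem isReordering_of_stats {f g : PairSimplex} {ρ : ℤ → ℤ} (hbij : BijOn ρ f.active g.active)
    (hpair : ∀ i ∈ f.active, ∀ j ∈ f.active, g.mass s(ρ i, ρ j) = f.mass s(i, j))
    (hdeg : ∀ i ∈ f.active, g.degree (ρ i) = f.degree i) (hloop : g.loopMass = f.loopMass) :
    f.IsReordering g := by
  classical
  let τ : ℤ → ℤ := fun i => if i ∈ f.active then ρ i else i
  have hτ : ∀ i ∈ f.active, τ i = ρ i := fun i hi => if_pos hi
  have h1 : τ (-1) = -1 := if_neg fun h => absurd h.1 (by norm_num)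
  have h0 : τ 0 = 0 := if_neg fun h => absurd h.1 (by norm_num)
  have hb : BijOn τ f.active g.active := hbij.congr fun i hi => (hτ i hi).symm
  refine ⟨τ, h1, h0, hb, mass_map_eq_of_stats h1 h0 hb ?_ ?_ hloop⟩
  · intro i hi j hj
    rw [hτ i hi, hτ j hj, hpair i hi j hj]
  · intro i hi
    rw [hτ i hi, hdeg i hi]

theorem ext_of_stats {f g : PairSimplex}
    (hpair : ∀ i j : ℤ, 1 ≤ i → 1 ≤ j → f.mass s(i, j) = g.mass s(i, j))
    (hdeg : ∀ i : ℤ, 1 ≤ i → f.degree i = g.degree i) (hloop : f.loopMass = g.loopMass) :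
    f = g := by
  have hact : f.active = g.active := by
    ext i
    exact and_congr_right fun hi => by rw [hdeg i hi]
  ext s
  have key := mass_map_eq_of_stats (f := f) (g := g) (ρ := id) rfl rfl
    (hact ▸ bijOn_id _) (fun i hi j hj => (hpair i j hi.1 hj.1).symm)
    (fun i hi => (hdeg i hi.1).symm) hloop.symm
  by_contra hne
  have hlab : ∀ i ∈ s, i = -1 ∨ i = 0 ∨ i ∈ f.active := by
    intro i hi
    by_cases hf : f.mass s = 0
    · have hg : g.mass s ≠ 0 := fun h => hne (hf.trans h.symm)
      have := g.label_of_mass_ne_zero hg hi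
      rwa [← hact] at this
    · exact f.label_of_mass_ne_zero hf hi
  have h := key s hlab
  rw [Sym2.map_id] at h
  exact hne h.symm

theorem IsReordering.stats {f g : PairSimplex} (h : f.IsReordering g) :
    ∃ ρ : ℤ → ℤ, BijOn ρ f.active g.active ∧ (∀ i ∈ f.active, g.degree (ρ i) = f.degree i) ∧
      g.loopMass = f.loopMass := by
  obtain ⟨ρ, hneg, hzero, hbij, hmass⟩ := h
  have hpos : ∀ i ∈ f.active, 1 ≤ ρ i := fun i hi => (hbij.mapsTo hi).1
  have hinj : InjOn ρ {i | i = -1 ∨ i = 0 ∨ i ∈ f.active} := by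
    rintro a (rfl | rfl | ha) b (rfl | rfl | hb) hab <;>
      first
      | rfl
      | exact hbij.injOn ha hb hab
      | (simp only [hneg, hzero] at hab; try have := hpos _ ‹_›
         omega)
  have hmap := pairLaw_map_eq hinj hmass
  have hR : Measurable (Sym2.map ρ) := measurable_of_countable _
  refine ⟨ρ, hbij, fun i hi => ?_, ?_⟩
  · rw [g.degree_eq (hpos i hi), f.degree_eq hi.1, ← hmap,
      map_measureReal_apply hR MeasurableSet.of_discrete]
    refine measureReal_congr ?_
    filter_upwards [ae_mass_ne_zero f] with s hs
    refine propext ⟨fun h => ?_, fun h => Sym2.mem_map.2 ⟨i, h, rfl⟩⟩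
    obtain ⟨j, hj, hij⟩ := Sym2.mem_map.1 h
    change i ∈ s
    rwa [← hinj (f.label_of_mass_ne_zero hs hj) (Or.inr (Or.inr hi)) hij]
  · rw [loopMass, loopMass, ← hmap, map_measureReal_apply hR MeasurableSet.of_discrete]
    refine measureReal_congr ?_
    filter_upwards [ae_mass_ne_zero f] with s hs
    induction s with | _ a b
    exact propext (hinj.eq_iff (f.label_of_mass_ne_zero hs (by simp))
      (f.label_of_mass_ne_zero hs (by simp)))

theorem IsRanked.degree_antitone {f : PairSimplex} (hf : f.IsRanked) {i j : ℤ} (hi : 1 ≤ i)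
    (hij : i ≤ j) : f.degree j ≤ f.degree i := by
  induction j, hij using Int.leInduction with
  | base => exact le_rfl
  | succ j hj ih => exact (hf j (hi.trans hj)).trans ih

/-- Pigeonhole: if the inequality failed at `i`, the labels `1, …, i` of `f`, all of degree at least
`f.degree i`, would be sent injectively to labels of `g` smaller than `i`. -/
theorem IsRanked.degree_le_of_bijOn {f g : PairSimplex} (hf : f.IsRanked) (hg : g.IsRanked)
    {ρ : ℤ → ℤ} (hbij : BijOn ρ f.active g.active)
    (hdeg : ∀ i ∈ f.active, g.degree (ρ i) = f.degree i) {i : ℤ} (hi : 1 ≤ i) :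
    f.degree i ≤ g.degree i := by
  by_contra! hlt
  have h0 : 0 < f.degree i := (g.degree_nonneg i).trans_lt hlt
  have hact : ∀ k ∈ Finset.Icc 1 i, k ∈ f.active ∧ f.degree i ≤ f.degree k := by
    intro k hk
    obtain ⟨h1, h2⟩ := Finset.mem_Icc.1 hk
    exact ⟨⟨h1, h0.trans_le (hf.degree_antitone h1 h2)⟩, hf.degree_antitone h1 h2⟩
  have hmaps : ∀ k ∈ Finset.Icc 1 i, ρ k ∈ Finset.Ico 1 i := by
    intro k hk
    have h1 := (hbij.mapsTo (hact k hk).1).1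
    refine Finset.mem_Ico.2 ⟨h1, ?_⟩
    by_contra! h2
    have h3 := hg.degree_antitone hi h2
    rw [hdeg k (hact k hk).1] at h3
    linarith [(hact k hk).2]
  obtain ⟨a, ha, b, hb, hab, h⟩ := Finset.exists_ne_map_eq_of_card_lt_of_maps_to
    (by simp; omega) hmaps
  exact hab (hbij.injOn (hact a ha).1 (hact b hb).1 h)

theorem IsReordering.degree_eq {f g : PairSimplex} (h : f.IsReordering g) (hf : f.IsRanked)
    (hg : g.IsRanked) {i : ℤ} (hi : 1 ≤ i) : f.degree i = g.degree i := by
  obtain ⟨ρ, hbij, hdeg, -⟩ := h.stats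
  refine le_antisymm (hf.degree_le_of_bijOn hg hbij hdeg hi) ?_
  have hinv := hbij.invOn_invFunOn
  refine hg.degree_le_of_bijOn hf (ρ := Function.invFunOn ρ f.active)
    (hbij.symm hinv.symm) (fun k hk => ?_) hi
  have hk' : Function.invFunOn ρ f.active k ∈ f.active := hbij.surjOn.mapsTo_invFunOn hk
  rw [← hdeg _ hk', hinv.2 hk]

/-! ### The lexicographic ordering -/

/-- The masses of the pairs of labels `≥ 1` in lexicographic order, with zeros in between. -/
noncomputable def lexCoord (f : PairSimplex) (n : ℕ) : ℝ :=
  if 1 ≤ n - n.sqrt ^ 2 ∧ n - n.sqrt ^ 2 ≤ n.sqrt then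
    f.mass s(((n - n.sqrt ^ 2 : ℕ) : ℤ), (n.sqrt : ℤ)) else 0

/-- For `1 ≤ i ≤ j` the code `j ^ 2 + i` lies below `(j + 1) ^ 2`, so its integer square root is
`j`. Codes increase with the larger label first and then with the smaller one, which is the order of
the list of pairs; a number that codes no pair has coordinate `0` for every element and never
decides a comparison. -/
theorem lexCoord_eq (f : PairSimplex) {i j : ℕ} (hi : 1 ≤ i) (hij : i ≤ j) :
    f.lexCoord (j ^ 2 + i) = f.mass s((i : ℤ), (j : ℤ)) := by
  have h : (j ^ 2 + i).sqrt = j := by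
    rw [sq]
    exact Nat.sqrt_add_eq j (by omega)
  simp [lexCoord, h, hi, hij]

theorem lexCoord_cases (n : ℕ) : (∀ f : PairSimplex, f.lexCoord n = 0) ∨
    ∃ i j : ℕ, 1 ≤ i ∧ i ≤ j ∧ n = j ^ 2 + i := by
  by_cases h : 1 ≤ n - n.sqrt ^ 2 ∧ n - n.sqrt ^ 2 ≤ n.sqrt
  · exact Or.inr ⟨_, _, h.1, h.2, by have := h.1; omega⟩
  · exact Or.inl fun f => if_neg h

theorem lexBefore_iff {f g : PairSimplex} : f.LexBefore g ↔
    ∃ n, g.lexCoord n < f.lexCoord n ∧ ∀ m < n, f.lexCoord m = g.lexCoord m := by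
  constructor
  · rintro ⟨i, j, hi, hij, hlt, heq⟩
    lift i to ℕ using by omega
    lift j to ℕ using by omega
    norm_cast at hi hij
    refine ⟨j ^ 2 + i, by rwa [lexCoord_eq _ hi hij, lexCoord_eq _ hi hij], fun m hm => ?_⟩
    rcases lexCoord_cases m with h | ⟨k, l, hk, hkl, rfl⟩
    · rw [h, h]
    · rw [lexCoord_eq _ hk hkl, lexCoord_eq _ hk hkl]
      refine heq k l (by omega) (by omega) ?_
      rcases lt_trichotomy l j with h | rfl | h
      · exact Or.inl (by omega)
      · exact Or.inr ⟨rfl, by omega⟩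
      · exfalso
        have : (j + 1) ^ 2 ≤ l ^ 2 := Nat.pow_le_pow_left h 2
        nlinarith
  · rintro ⟨n, hlt, heq⟩
    rcases lexCoord_cases n with h | ⟨i, j, hi, hij, rfl⟩
    · rw [h, h] at hlt
      exact absurd hlt (lt_irrefl _)
    · rw [lexCoord_eq _ hi hij, lexCoord_eq _ hi hij] at hlt
      refine ⟨i, j, by omega, by omega, hlt, fun k l hk hkl h => ?_⟩
      lift k to ℕ using by omega
      lift l to ℕ using by omega
      norm_cast at hk hkl
      rw [← lexCoord_eq _ hk hkl, ← lexCoord_eq _ hk hkl]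
      refine heq _ ?_
      rcases h with h | ⟨h1, h2⟩
      · have : (l + 1) ^ 2 ≤ j ^ 2 := Nat.pow_le_pow_left (by omega) 2
        nlinarith
      · have : l = j := by omega
        subst this
        omega

theorem eq_of_not_lexBefore {f g : PairSimplex} (h : ¬ f.LexBefore g) (h' : ¬ g.LexBefore f)
    (i j : ℤ) (hi : 1 ≤ i) (hj : 1 ≤ j) : f.mass s(i, j) = g.mass s(i, j) := by
  have key : ∀ n, f.lexCoord n = g.lexCoord n := by
    intro n
    induction n using Nat.strong_induction_on with
    | _ n ih =>
      rw [lexBefore_iff] at h h'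
      push Not at h h'
      by_contra hne
      rcases lt_or_gt_of_ne hne with hlt | hlt
      · obtain ⟨m, hm, hm'⟩ := h' n hlt
        exact hm' (ih m hm).symm
      · obtain ⟨m, hm, hm'⟩ := h n hlt
        exact hm' (ih m hm)
  lift i to ℕ using by omega
  lift j to ℕ using by omega
  norm_cast at hi hj
  rcases le_total i j with hij | hij
  · rw [← lexCoord_eq f hi hij, key, lexCoord_eq g hi hij]
  · rw [Sym2.eq_swap, ← lexCoord_eq f hj hij, key, lexCoord_eq g hj hij]

end PairSimplex

/-! ### Frequencies determine the element of the simplex up to reordering -/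

/-- The set `B` of edge labels has asymptotic frequency `a`. -/
def HasFrequency (B : Set ℕ) (a : ℝ) : Prop :=
  Tendsto (fun n : ℕ => (∑ k ∈ Finset.range n, B.indicator (fun _ => (1 : ℝ)) k) / n) atTop (𝓝 a)

theorem HasFrequency.unique {B : Set ℕ} {a b : ℝ} (ha : HasFrequency B a)
    (hb : HasFrequency B b) : a = b := tendsto_nhds_unique ha hb

/-- A blip occurs in one edge only; its zero frequency is what distinguishes it from an active label
inside the network. -/
theorem hasFrequency_zero_of_subsingleton {B : Set ℕ} (hB : B.Subsingleton) :
    HasFrequency B 0 := by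
  refine squeeze_zero (fun n => ?_) (fun n => ?_) tendsto_one_div_atTop_nhds_zero_nat
  · exact div_nonneg (Finset.sum_nonneg fun k _ => indicator_nonneg (fun _ _ => zero_le_one) k)
      n.cast_nonneg
  · refine div_le_div_of_nonneg_right ?_ n.cast_nonneg
    rcases hB.eq_empty_or_singleton with rfl | ⟨b, rfl⟩
    · simp
    · simp only [indicator_apply, mem_singleton_iff, Finset.sum_ite_eq']
      split_ifs <;> norm_num

theorem ae_hasFrequency (f : PairSimplex) (A : Set (Sym2 ℤ)) :
    ∀ᵐ X ∂Measure.infinitePi fun _ : ℕ => pairLaw f,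
      HasFrequency {k | X k ∈ A} ((pairLaw f).real A) := by
  have hA : Measurable (A.indicator fun _ => (1 : ℝ)) := measurable_of_countable _
  have hmap : ∀ i, (Measure.infinitePi fun _ : ℕ => pairLaw f).map
      (fun X => A.indicator (fun _ => (1 : ℝ)) (X i)) =
      (pairLaw f).map (A.indicator fun _ => (1 : ℝ)) := fun i => by
    conv_rhs => rw [← Measure.infinitePi_map_eval (fun _ : ℕ => pairLaw f) i,
      Measure.map_map hA (measurable_pi_apply i)]
    rfl
  have hint : ∫ X, A.indicator (fun _ => (1 : ℝ)) (X 0)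
      ∂Measure.infinitePi (fun _ : ℕ => pairLaw f) = (pairLaw f).real A := by
    rw [← integral_indicator_one MeasurableSet.of_discrete]
    conv_rhs => rw [← Measure.infinitePi_map_eval (fun _ : ℕ => pairLaw f) 0,
      integral_map (measurable_pi_apply 0).aemeasurable
        (measurable_of_countable _).aestronglyMeasurable]
    rfl
  have h := ProbabilityTheory.strong_law_ae_real
    (μ := Measure.infinitePi fun _ : ℕ => pairLaw f)
    (fun k X => A.indicator (fun _ => (1 : ℝ)) (X k)) ?_ ?_ ?_
  · rw [hint] at h
    exact h
  · refine Integrable.of_bound (C := 1) (hA.comp (measurable_pi_apply 0)).aestronglyMeasurable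
      (ae_of_all _ fun X => ?_)
    by_cases h : X 0 ∈ A <;> simp [h]
  · intro i j hij
    exact (ProbabilityTheory.iIndepFun_infinitePi (P := fun _ : ℕ => pairLaw f)
      (X := fun _ => A.indicator fun _ => (1 : ℝ)) fun _ => hA).indepFun hij
  · intro i
    exact ⟨(hA.comp (measurable_pi_apply i)).aemeasurable,
      (hA.comp (measurable_pi_apply 0)).aemeasurable, (hmap i).trans (hmap 0).symm⟩

/-- The sequences of pairs that show the frequencies prescribed by `f`. -/
def typicalSequences (f : PairSimplex) : Set (ℕ → Sym2 ℤ) :=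
  {X | (∀ k, f.mass (X k) ≠ 0) ∧ (∀ i, HasFrequency {k | i ∈ X k} ((pairLaw f).real {s | i ∈ s})) ∧
    (∀ s, HasFrequency {k | X k = s} (f.mass s)) ∧
    HasFrequency {k | (X k).IsDiag} f.loopMass}

theorem ae_typicalSequences (f : PairSimplex) :
    ∀ᵐ X ∂Measure.infinitePi fun _ : ℕ => pairLaw f, X ∈ typicalSequences f := by
  have hae : ∀ᵐ X ∂Measure.infinitePi fun _ : ℕ => pairLaw f, ∀ k, f.mass (X k) ≠ 0 :=
    ae_all_iff.2 fun k => (measurePreserving_eval_infinitePi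
      (fun _ : ℕ => pairLaw f) k).quasiMeasurePreserving.ae (ae_mass_ne_zero f)
  have h1 := ae_all_iff.2 fun i : ℤ => ae_hasFrequency f {s | i ∈ s}
  have h2 := ae_all_iff.2 fun s : Sym2 ℤ => ae_hasFrequency f {s}
  simp only [pairLaw_real_singleton] at h2
  filter_upwards [hae, h1, h2, ae_hasFrequency f {s | s.IsDiag}] with X h3 h4 h5 h6
  exact ⟨h3, h4, h5, h6⟩

theorem one_le_of_mem_expand {X : ℕ → Sym2 ℤ} (hX : ∀ k, ProperPair (X k)) {v : ℤ} {k l : ℕ}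
    (hkl : k ≠ l) (hk : v ∈ expand id X k) (hl : v ∈ expand id X l) : 1 ≤ v := by
  obtain ⟨a, ha, rfl⟩ := Sym2.mem_map.1 hk
  obtain ⟨b, hb, hab⟩ := Sym2.mem_map.1 hl
  have h1 := (hX k).1 a ha
  have h2 := (hX l).1 b hb
  simp only [id, freshLabel] at hab ⊢
  split_ifs at hab ⊢ <;> omega

theorem mem_expand_iff {X : ℕ → Sym2 ℤ} (hX : ∀ k, ProperPair (X k)) {i : ℤ} (hi : 1 ≤ i)
    (k : ℕ) : i ∈ expand id X k ↔ i ∈ X k := by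
  refine Sym2.mem_map.trans ⟨?_, fun h => ⟨i, h, if_pos hi⟩⟩
  rintro ⟨a, ha, rfl⟩
  have h1 := (hX k).1 a ha
  simp only [id, freshLabel] at hi ⊢
  split_ifs at hi ⊢
  · exact ha
  · omega

theorem isDiag_expand_iff {X : ℕ → Sym2 ℤ} (hX : ∀ k, ProperPair (X k)) (k : ℕ) :
    (expand id X k).IsDiag ↔ (X k).IsDiag := by
  have h := (hX k).1
  unfold expand
  generalize X k = x at h ⊢
  induction x with | _ a b
  have h1 := h a (by simp)
  have h2 := h b (by simp)
  simp only [Sym2.map_mk, Sym2.mk_isDiag_iff, id, freshLabel]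
  split_ifs <;> omega

/-- A bijection of vertices that carries edge `k` to edge `k` preserves the frequency of each
vertex. The vertices of positive frequency are exactly the active labels, and the frequency is the
degree. -/
theorem hasFrequency_pos_of_generatedNetwork {f g : PairSimplex} {X Y : ℕ → Sym2 ℤ}
    (hX : X ∈ typicalSequences f) (hY : Y ∈ typicalSequences g) {ρ : ℤ → ℤ}
    (hρ : InjOn ρ (Interactions.vertices (expand id X)))
    (h : ∀ k, expand id Y k = (expand id X k).map ρ) :
    (∀ i ∈ f.active, ρ i ∈ g.active ∧ g.degree (ρ i) = f.degree i) ∧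
      ∀ v ∈ Interactions.vertices (expand id X), ρ v ∈ g.active → v ∈ f.active := by
  have hXp : ∀ k, ProperPair (X k) := fun k => f.properPair_of_pos (hX.1 k)
  have hYp : ∀ k, ProperPair (Y k) := fun k => g.properPair_of_pos (hY.1 k)
  have hmem : ∀ v ∈ Interactions.vertices (expand id X), ∀ k,
      ρ v ∈ expand id Y k ↔ v ∈ expand id X k := by
    intro v hv k
    rw [h, Sym2.mem_map]
    refine ⟨?_, fun hv' => ⟨v, hv', rfl⟩⟩
    rintro ⟨w, hw, hwv⟩
    rwa [← hρ ⟨k, hw⟩ hv hwv]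
  have hpos : ∀ {X : ℕ → Sym2 ℤ}, (∀ k, ProperPair (X k)) → ∀ {v : ℤ} {a : ℝ},
      HasFrequency {k | v ∈ expand id X k} a → 0 < a → 1 ≤ v := by
    intro X hXp v a ha h0
    by_contra hv
    refine h0.ne (HasFrequency.unique (hasFrequency_zero_of_subsingleton ?_) ha)
    intro k hk l hl
    by_contra hkl
    exact hv (one_le_of_mem_expand hXp hkl hk hl)
  have hfreq : ∀ {f : PairSimplex} {X : ℕ → Sym2 ℤ}, X ∈ typicalSequences f → ∀ {i : ℤ}, 1 ≤ i →
      HasFrequency {k | i ∈ expand id X k} (f.degree i) := by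
    intro f X hX i hi
    simp only [mem_expand_iff (fun k => f.properPair_of_pos (hX.1 k)) hi, f.degree_eq hi]
    exact hX.2.1 i
  have hvert : ∀ i ∈ f.active, i ∈ Interactions.vertices (expand id X) := by
    intro i hi
    by_contra hv
    refine hi.2.ne (HasFrequency.unique (hasFrequency_zero_of_subsingleton ?_) (hfreq hX hi.1))
    intro k hk
    exact absurd ⟨k, hk⟩ hv
  refine ⟨fun i hi => ?_, fun v hv hv' => ?_⟩
  · have h1 := hfreq hX hi.1
    simp only [← hmem i (hvert i hi)] at h1
    have h2 := hpos hYp h1 hi.2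
    have h3 := (hfreq hY h2).unique h1
    exact ⟨⟨h2, h3 ▸ hi.2⟩, h3⟩
  · have h1 := hfreq hY hv'.1
    simp only [hmem v hv] at h1
    have h2 := hpos hXp h1 hv'.2
    exact ⟨h2, (hfreq hX h2).unique h1 ▸ hv'.2⟩

/-- The set of edges `k` joining two given active vertices and the set of loops are also preserved
by the isomorphism, so pair masses and loop mass agree as well as degrees. -/
theorem isReordering_of_typical {f g : PairSimplex} {X Y : ℕ → Sym2 ℤ}
    (hX : X ∈ typicalSequences f) (hY : Y ∈ typicalSequences g)
    (h : generatedNetwork X = generatedNetwork Y) : f.IsReordering g := by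
  obtain ⟨ρ, hρ, hmap⟩ := inducedNetwork_eq_iff.1 h
  have hXp : ∀ k, ProperPair (X k) := fun k => f.properPair_of_pos (hX.1 k)
  have hYp : ∀ k, ProperPair (Y k) := fun k => g.properPair_of_pos (hY.1 k)
  obtain ⟨h1, h2⟩ := hasFrequency_pos_of_generatedNetwork hX hY hρ hmap
  have hfresh : ∀ i ∈ f.active, ∀ k, freshLabel k i = i := fun i hi k => if_pos hi.1
  have hvert : ∀ (f : PairSimplex) (X : ℕ → Sym2 ℤ), X ∈ typicalSequences f → ∀ i ∈ f.active,
      i ∈ Interactions.vertices (expand id X) := by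
    intro f X hX i hi
    by_contra hv
    have h3 := hX.2.1 i
    rw [← f.degree_eq hi.1] at h3
    refine hi.2.ne (HasFrequency.unique (hasFrequency_zero_of_subsingleton ?_) h3)
    intro k hk
    exact absurd ⟨k, (mem_expand_iff (fun k => f.properPair_of_pos (hX.1 k)) hi.1 k).2 hk⟩ hv
  have hinj : ∀ s t : Sym2 ℤ, (∀ i ∈ s, i ∈ Interactions.vertices (expand id X)) →
      (∀ i ∈ t, i ∈ Interactions.vertices (expand id X)) → s.map ρ = t.map ρ → s = t := by
    have hl : ∀ s : Sym2 ℤ, (∀ i ∈ s, i ∈ Interactions.vertices (expand id X)) →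
        (s.map ρ).map (Function.invFunOn ρ (Interactions.vertices (expand id X))) = s := by
      intro s hs
      have hc := Sym2.map_congr (s := s)
        (f := Function.invFunOn ρ (Interactions.vertices (expand id X)) ∘ ρ) (g := id)
        fun i hi => hρ.leftInvOn_invFunOn (hs i hi)
      rw [Sym2.map_map, hc, Sym2.map_id, id]
    intro s t hs ht hst
    rw [← hl s hs, ← hl t ht, hst]
  have hpairX : ∀ (f : PairSimplex) (X : ℕ → Sym2 ℤ), (∀ k, ProperPair (X k)) →
      ∀ i ∈ f.active, ∀ j ∈ f.active, ∀ k, expand id X k = s(i, j) ↔ X k = s(i, j) := by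
    intro f X hXp i hi j hj k
    have hi1 := hi.1
    have hj1 := hj.1
    have hp := (hXp k).1
    unfold expand
    generalize X k = x at hp ⊢
    induction x with | _ a b
    have ha := hp a (by simp)
    have hb := hp b (by simp)
    simp only [Sym2.map_mk, Sym2.eq_iff, id, freshLabel]
    split_ifs <;> omega
  refine PairSimplex.isReordering_of_stats (ρ := ρ) ⟨fun i hi => (h1 i hi).1, ?_, ?_⟩ ?_
    (fun i hi => (h1 i hi).2) ?_
  · intro i hi j hj hij
    exact hρ (hvert f X hX i hi) (hvert f X hX j hj) hij
  · intro w hw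
    obtain ⟨k, hk⟩ := hvert g Y hY w hw
    rw [hmap, Sym2.mem_map] at hk
    obtain ⟨v, hv, rfl⟩ := hk
    exact ⟨v, h2 v ⟨k, hv⟩ hw, rfl⟩
  · intro i hi j hj
    refine (hY.2.2.1 s(ρ i, ρ j)).unique ?_
    have h3 := hX.2.2.1 s(i, j)
    refine (congrArg (fun B => HasFrequency B (f.mass s(i, j))) ?_).mp h3
    ext k
    simp only [mem_ofPred_eq]
    rw [← hpairX f X hXp i hi j hj k,
      ← hpairX g Y hYp (ρ i) (h1 i hi).1 (ρ j) (h1 j hj).1 k, hmap]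
    refine ⟨fun h => by rw [h, Sym2.map_mk], fun h => hinj _ _ (fun v hv => ⟨k, hv⟩) ?_ ?_⟩
    · intro v hv
      rcases Sym2.mem_iff.1 hv with rfl | rfl
      exacts [hvert f X hX _ hi, hvert f X hX _ hj]
    · rw [h, Sym2.map_mk]
  · refine hY.2.2.2.unique ?_
    have h3 := hX.2.2.2
    refine (congrArg (fun B => HasFrequency B f.loopMass) ?_).mp h3
    ext k
    simp only [mem_ofPred_eq]
    rw [← isDiag_expand_iff hXp, ← isDiag_expand_iff hYp, hmap]
    have hk : ∀ v ∈ expand id X k, v ∈ Interactions.vertices (expand id X) := fun v hv => ⟨k, hv⟩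
    generalize expand id X k = s at hk
    induction s with | _ a b
    exact (hρ.eq_iff (hk a (by simp)) (hk b (by simp))).symm

/-- It suffices to find one network that is typical for both `f` and `g`. Otherwise the two sets of
typical networks, images of Borel sets of full measure, would be disjoint analytic sets; a Borel set
separating them would have probability one under `f` and zero under `g`. -/
theorem isReordering_of_networkLaw_eq {f g : PairSimplex} (h : networkLaw f = networkLaw g) :
    f.IsReordering g := by
  have hsub : ∀ f : PairSimplex, ∃ A ⊆ typicalSequences f, MeasurableSet A ∧
      ∀ᵐ X ∂Measure.infinitePi fun _ : ℕ => pairLaw f, X ∈ A := by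
    intro f
    obtain ⟨A, hA, hm, h0⟩ := exists_measurable_superset_of_null (ae_typicalSequences f)
    exact ⟨Aᶜ, compl_subset_comm.1 hA, hm.compl, by simpa [ae_iff] using h0⟩
  obtain ⟨A, hA, hAm, hA1⟩ := hsub f
  obtain ⟨B, hB, hBm, hB1⟩ := hsub g
  by_cases hd : Disjoint (generatedNetwork '' A) (generatedNetwork '' B)
  · exfalso
    obtain ⟨u, hAu, hBu, hu⟩ := (hAm.analyticSet_image measurable_generatedNetwork).measurablySeparable
      (hBm.analyticSet_image measurable_generatedNetwork) hd
    have h1 : ∀ᵐ E ∂networkLaw f, E ∈ u := by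
      rw [networkLaw_eq_map]
      refine (ae_map_iff measurable_generatedNetwork.aemeasurable hu).2 ?_
      filter_upwards [hA1] with X hX
      exact hAu ⟨X, hX, rfl⟩
    have h2 : ∀ᵐ E ∂networkLaw f, E ∉ u := by
      rw [h, networkLaw_eq_map]
      refine (ae_map_iff measurable_generatedNetwork.aemeasurable hu.compl).2 ?_
      filter_upwards [hB1] with X hX
      exact fun hXu => disjoint_left.1 hBu ⟨X, hX, rfl⟩ hXu
    obtain ⟨E, hE, hE'⟩ := (h1.and h2).exists
    exact hE' hE
  · obtain ⟨_, ⟨X, hX, rfl⟩, Y, hY, hXY⟩ := not_disjoint_iff.1 hd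
    exact isReordering_of_typical (hA hX) (hB hY) hXY.symm

/-- Elements of the ranked simplex are determined by the networks they generate. -/
theorem eq_of_networkLaw_eq {f g : PairSimplex} (hf : f ∈ RankedSimplex) (hg : g ∈ RankedSimplex)
    (h : networkLaw f = networkLaw g) : f = g := by
  have h1 := isReordering_of_networkLaw_eq h
  have h2 := isReordering_of_networkLaw_eq h.symm
  obtain ⟨-, -, -, hloop⟩ := h1.stats
  exact PairSimplex.ext_of_stats
    (PairSimplex.eq_of_not_lexBefore (hg.2 f h2 hf.1) (hf.2 g h1 hg.1))
    (fun i hi => h1.degree_eq hf.1 hg.1 hi) hloop.symm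

end EdgeExch

namespace EdgeExch

/-! ### Truncation: replacing large labels by blips -/

/-- The label that replaces the endpoint `a` of an edge with endpoints `a` and `b` when labels
larger than `m` are turned into blips. -/
def truncLabel (m a b : ℤ) : ℤ :=
  if a ≤ m ∧ b ≤ m then a
  else if a = b then 0
  else if 1 ≤ a ∧ a ≤ m then a
  else if 1 ≤ b ∧ b ≤ m then 0
  else if a < b then -1 else 0

/-- The pair in which labels larger than `m` are turned into blips. -/
def trunc (m : ℤ) : Sym2 ℤ → Sym2 ℤ :=
  Sym2.lift ⟨fun a b => s(truncLabel m a b, truncLabel m b a), fun _ _ => Sym2.eq_swap⟩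

theorem trunc_mk (m a b : ℤ) : trunc m s(a, b) = s(truncLabel m a b, truncLabel m b a) := rfl

/-- Whether an edge is a loop and which of its endpoints carry labels in `1, …, m` survive
truncation, and `expand_sameNetwork_of_endpoints` depends on little more. -/
theorem truncLabel_spec {m a b : ℤ} (hm : 0 ≤ m) (ha : -1 ≤ a) (hb : -1 ≤ b) :
    -1 ≤ truncLabel m a b ∧ (truncLabel m a b = truncLabel m b a ↔ a = b) ∧
      (1 ≤ truncLabel m a b → truncLabel m a b = a) ∧
      (1 ≤ truncLabel m a b ↔ 1 ≤ a ∧ a ≤ m) := by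
  unfold truncLabel
  split_ifs <;> first | omega | (simp only [false_iff]; omega)

/-- A label that occurs in a single edge is indistinguishable from a blip. -/
theorem finiteNetwork_trunc {n : ℕ} {y : Fin n → Sym2 ℤ} (hy : ∀ k, ProperPair (y k)) {m : ℤ}
    (hm : 0 ≤ m) (h : ∀ k l, k ≠ l → ∀ v, m < v → v ∈ y k → v ∉ y l) :
    finiteNetwork (fun k => trunc m (y k)) = finiteNetwork y := by
  obtain ⟨e, he⟩ := exists_endpoints y
  have hmem : ∀ p : Fin n × Bool, e p ∈ y p.1 := by
    rintro ⟨k, b⟩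
    rw [he]
    cases b <;> simp
  have hge : ∀ p, -1 ≤ e p := fun p => (hy p.1).1 _ (hmem p)
  have hs := fun p q => truncLabel_spec hm (hge p) (hge q)
  refine (inducedNetwork_eq_iff.2 (expand_sameNetwork_of_endpoints Fin.val_injective
    Fin.val_injective e (fun p => truncLabel m (e p) (e (p.1, !p.2))) he
    (fun k => by rw [he k]; rfl) hge (fun p => (hs p _).1) (fun k => ?_) ?_)).symm
  · exact (hs _ _).2.1.symm
  · intro p q hpq
    have h1 := (hs p (p.1, !p.2)).2.2
    have h2 := (hs q (q.1, !q.2)).2.2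
    have h3 : e p = e q → e p ≤ m := by
      intro heq
      by_contra! hlt
      exact h p.1 q.1 hpq (e p) hlt (hmem p) (heq ▸ hmem q)
    omega

/-! ### The law of a truncated pair -/

/-- The masses of pairs of labels `≥ 1`, the degrees, and the mass of the loops. -/
abbrev StatSpace : Type := ℝ × (ℤ → ℝ) × (Sym2 ℤ → ℝ)

open Classical in
/-- The vector of statistics of an element of the simplex. -/
noncomputable def PairSimplex.stats (f : PairSimplex) : StatSpace :=
  (f.loopMass, fun i => if 1 ≤ i then f.degree i else 0,
    fun s => if ∀ i ∈ s, 1 ≤ i then f.mass s else 0)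

/-- The pairs without `-1` that arise by truncation. -/
noncomputable def truncRange (m : ℤ) : Finset (Sym2 ℤ) :=
  (Finset.Icc 1 m).sym2 ∪ (Finset.Icc 0 m).image fun i => s(0, i)

theorem trunc_mem {m : ℤ} (hm : 0 ≤ m) {s : Sym2 ℤ} (hs : ProperPair s) :
    trunc m s = s(-1, 0) ∨ trunc m s ∈ truncRange m := by
  induction s with | _ a b
  obtain ⟨h1, h2⟩ := hs
  have ha := h1 a (by simp)
  have hb := h1 b (by simp)
  simp only [Sym2.mem_iff, Sym2.eq_iff] at h2
  rw [trunc_mk]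
  simp only [truncRange, Finset.mem_union, Finset.mk_mem_sym2_iff, Finset.mem_Icc,
    Finset.mem_image, Sym2.eq_iff]
  have key : (truncLabel m a b = -1 ∧ truncLabel m b a = 0 ∨
      truncLabel m a b = 0 ∧ truncLabel m b a = -1) ∨
      ((1 ≤ truncLabel m a b ∧ truncLabel m a b ≤ m) ∧
        1 ≤ truncLabel m b a ∧ truncLabel m b a ≤ m) ∨
      (truncLabel m a b = 0 ∧ 0 ≤ truncLabel m b a ∧ truncLabel m b a ≤ m) ∨
      (truncLabel m b a = 0 ∧ 0 ≤ truncLabel m a b ∧ truncLabel m a b ≤ m) := by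
    unfold truncLabel
    split_ifs <;> omega
  rcases key with h | h | ⟨h, h'⟩ | ⟨h, h'⟩
  · exact Or.inl h
  · exact Or.inr (Or.inl h)
  · exact Or.inr (Or.inr ⟨_, h', Or.inl ⟨h.symm, rfl⟩⟩)
  · exact Or.inr (Or.inr ⟨_, h', Or.inr ⟨h.symm, rfl⟩⟩)

theorem sum_truncRange {m : ℤ} (hm : 0 ≤ m) (h : Sym2 ℤ → ℝ) :
    ∑ s ∈ truncRange m, h s =
      ∑ s ∈ (Finset.Icc 1 m).sym2, h s + (∑ i ∈ Finset.Icc 1 m, h s(0, i) + h s(0, 0)) := by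
  have hinj : Function.Injective fun i : ℤ => s(0, i) := fun a b hab => Sym2.congr_right.1 hab
  rw [truncRange, Finset.sum_union, Finset.sum_image hinj.injOn]
  · congr 1
    have : Finset.Icc 0 m = insert 0 (Finset.Icc 1 m) := by
      ext i
      simp only [Finset.mem_Icc, Finset.mem_insert]
      omega
    rw [this, Finset.sum_insert (by simp), add_comm]
  · rw [Finset.disjoint_left]
    intro s hs hs'
    obtain ⟨i, -, rfl⟩ := Finset.mem_image.1 hs'
    simp at hs

theorem real_finset_eq_sum (f : PairSimplex) (t : Finset (Sym2 ℤ)) :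
    (pairLaw f).real t = ∑ s ∈ t, f.mass s := by
  rw [← sum_measureReal_singleton]
  simp only [pairLaw_real_singleton]

theorem trunc_eq_self_iff {m : ℤ} {s t : Sym2 ℤ} (hs : ProperPair s)
    (ht : t ∈ (Finset.Icc 1 m).sym2) : trunc m s = t ↔ s = t := by
  induction s with | _ a b
  induction t with | _ c d
  obtain ⟨h1, -⟩ := hs
  have ha := h1 a (by simp)
  have hb := h1 b (by simp)
  simp only [Finset.mk_mem_sym2_iff, Finset.mem_Icc] at ht
  simp only [trunc_mk, Sym2.eq_iff]
  unfold truncLabel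
  split_ifs <;> omega

theorem real_trunc_pair (f : PairSimplex) {m : ℤ} {t : Sym2 ℤ}
    (ht : t ∈ (Finset.Icc 1 m).sym2) : (pairLaw f).real (trunc m ⁻¹' {t}) = f.mass t := by
  rw [← pairLaw_real_singleton]
  refine measureReal_congr ?_
  filter_upwards [ae_mass_ne_zero f] with s hs
  exact propext (trunc_eq_self_iff (f.properPair_of_pos hs) ht)

/-- A truncated pair `{0, i}` comes from an edge joining `i` to `0` or to a label beyond `m`. Unlike
the mass of `{0, i}` itself, which is the degree minus an infinite sum, its probability involves
finitely many statistics and is therefore continuous in them. -/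
theorem real_trunc_zero_label (f : PairSimplex) {m : ℤ} {i : ℤ} (hi : 1 ≤ i)
    (him : i ≤ m) : (pairLaw f).real (trunc m ⁻¹' {s(0, i)}) =
      f.degree i - ∑ j ∈ Finset.Icc 1 m, f.mass s(i, j) := by
  have hinj : Function.Injective fun j : ℤ => s(i, j) := fun a b hab => Sym2.congr_right.1 hab
  rw [eq_sub_iff_add_eq, ← Finset.sum_image (f := f.mass) hinj.injOn, ← real_finset_eq_sum,
    f.degree_eq hi, ← measureReal_union _ MeasurableSet.of_discrete]
  · refine measureReal_congr ?_
    filter_upwards [ae_mass_ne_zero f] with s hs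
    have hp := f.properPair_of_pos hs
    refine propext ?_
    change trunc m s = s(0, i) ∨ s ∈ ((Finset.Icc 1 m).image fun j => s(i, j)) ↔ i ∈ s
    induction s with | _ a b
    obtain ⟨h1, h2⟩ := hp
    have ha := h1 a (by simp)
    have hb := h1 b (by simp)
    simp only [Sym2.mem_iff, Sym2.eq_iff] at h2
    simp only [trunc_mk, Finset.mem_image, Finset.mem_Icc, Sym2.eq_iff, Sym2.mem_iff]
    constructor
    · rintro (h | ⟨j, hj, h⟩)
      · unfold truncLabel at h
        split_ifs at h <;> omega
      · omega
    · intro h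
      by_cases h3 : (1 ≤ a ∧ a ≤ m) ∧ (1 ≤ b ∧ b ≤ m)
      · rcases h with rfl | rfl
        · exact Or.inr ⟨b, h3.2, by simp⟩
        · exact Or.inr ⟨a, h3.1, by simp⟩
      · refine Or.inl ?_
        unfold truncLabel
        split_ifs <;> omega
  · rw [disjoint_left]
    rintro s hs hs'
    obtain ⟨j, hj, rfl⟩ := Finset.mem_image.1 (Finset.mem_coe.1 hs')
    have hj := Finset.mem_Icc.1 hj
    simp only [mem_preimage, mem_singleton_iff, trunc_mk, Sym2.eq_iff] at hs
    unfold truncLabel at hs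
    split_ifs at hs <;> omega

theorem real_trunc_zero_zero (f : PairSimplex) (m : ℤ) :
    (pairLaw f).real (trunc m ⁻¹' {s(0, 0)}) =
      f.loopMass - ∑ j ∈ Finset.Icc 1 m, f.mass s(j, j) := by
  have hinj : Function.Injective fun j : ℤ => s(j, j) := fun a b hab => by
    simpa using hab
  rw [eq_sub_iff_add_eq, ← Finset.sum_image (f := f.mass) hinj.injOn, ← real_finset_eq_sum,
    PairSimplex.loopMass, ← measureReal_union _ MeasurableSet.of_discrete]
  · refine measureReal_congr ?_
    filter_upwards [ae_mass_ne_zero f] with s hs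
    have hp := f.properPair_of_pos hs
    refine propext ?_
    change trunc m s = s(0, 0) ∨ s ∈ ((Finset.Icc 1 m).image fun j => s(j, j)) ↔ s.IsDiag
    induction s with | _ a b
    obtain ⟨h1, h2⟩ := hp
    have ha := h1 a (by simp)
    have hb := h1 b (by simp)
    simp only [Sym2.mem_iff, Sym2.eq_iff] at h2
    simp only [trunc_mk, Finset.mem_image, Finset.mem_Icc, Sym2.eq_iff, Sym2.mk_isDiag_iff]
    constructor
    · rintro (h | ⟨j, hj, h⟩)
      · unfold truncLabel at h
        split_ifs at h <;> first | omega | grind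
      · omega
    · rintro rfl
      by_cases h3 : 1 ≤ a ∧ a ≤ m
      · exact Or.inr ⟨a, h3, by simp⟩
      · refine Or.inl ?_
        unfold truncLabel
        split_ifs <;> omega
  · rw [disjoint_left]
    rintro s hs hs'
    obtain ⟨j, hj, rfl⟩ := Finset.mem_image.1 (Finset.mem_coe.1 hs')
    have hj := Finset.mem_Icc.1 hj
    simp only [mem_preimage, mem_singleton_iff, trunc_mk, Sym2.eq_iff] at hs
    unfold truncLabel at hs
    split_ifs at hs <;> omega

theorem sum_real_trunc (f : PairSimplex) (m : ℤ) (t : Finset (Sym2 ℤ)) :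
    ∑ s ∈ t, (pairLaw f).real (trunc m ⁻¹' {s}) = (pairLaw f).real (trunc m ⁻¹' t) := by
  have h := sum_measureReal_preimage_singleton (μ := pairLaw f) t (f := trunc m)
    (fun _ _ => MeasurableSet.of_discrete)
  exact h

theorem neg_one_zero_notMem_truncRange (m : ℤ) : s(-1, 0) ∉ truncRange m := by
  simp only [truncRange, Finset.mem_union, Finset.mk_mem_sym2_iff, Finset.mem_Icc,
    Finset.mem_image, Sym2.eq_iff, not_or, not_exists]
  constructor
  · omega
  · intro i
    omega

theorem real_trunc_neg_one (f : PairSimplex) {m : ℤ} (hm : 0 ≤ m) :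
    (pairLaw f).real (trunc m ⁻¹' {s(-1, 0)}) =
      1 - ∑ s ∈ truncRange m, (pairLaw f).real (trunc m ⁻¹' {s}) := by
  rw [eq_sub_iff_add_eq, ← Finset.sum_insert (f := fun s => (pairLaw f).real (trunc m ⁻¹' {s}))
    (neg_one_zero_notMem_truncRange m), sum_real_trunc, ← probReal_univ (μ := pairLaw f)]
  refine measureReal_congr ?_
  filter_upwards [ae_mass_ne_zero f] with s hs
  refine propext (iff_of_true ?_ trivial)
  rw [Finset.coe_insert]
  exact trunc_mem hm (f.properPair_of_pos hs)

/-- The law of a truncated pair depends continuously on the statistics. -/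
theorem exists_continuous_trunc {m : ℤ} (hm : 0 ≤ m) (s : Sym2 ℤ) :
    ∃ q : StatSpace → ℝ, Continuous q ∧
      ∀ f : PairSimplex, (pairLaw f).real (trunc m ⁻¹' {s}) = q f.stats := by
  classical
  have hstat : ∀ (f : PairSimplex) (i j : ℤ), 1 ≤ i → 1 ≤ j →
      f.stats.2.2 s(i, j) = f.mass s(i, j) := fun f i j hi hj => by
    simp [PairSimplex.stats, hi, hj]
  have hrange : ∀ s ∈ truncRange m, ∃ q : StatSpace → ℝ, Continuous q ∧
      ∀ f : PairSimplex, (pairLaw f).real (trunc m ⁻¹' {s}) = q f.stats := by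
    intro s hs
    rcases Finset.mem_union.1 hs with hs | hs
    · refine ⟨fun x => x.2.2 s, by fun_prop, fun f => ?_⟩
      rw [real_trunc_pair f hs]
      have : ∀ i ∈ s, 1 ≤ i := fun i hi => (Finset.mem_Icc.1 (Finset.mem_sym2_iff.1 hs i hi)).1
      simp only [PairSimplex.stats]
      rw [if_pos this]
    · obtain ⟨i, hi, rfl⟩ := Finset.mem_image.1 hs
      obtain ⟨hi0, him⟩ := Finset.mem_Icc.1 hi
      rcases hi0.eq_or_lt with rfl | hi0
      · refine ⟨fun x => x.1 - ∑ j ∈ Finset.Icc 1 m, x.2.2 s(j, j), by fun_prop, fun f => ?_⟩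
        rw [real_trunc_zero_zero f m]
        congr 1
        refine Finset.sum_congr rfl fun j hj => ?_
        have := (Finset.mem_Icc.1 hj).1
        rw [hstat f j j this this]
      · replace hi0 : 1 ≤ i := hi0
        refine ⟨fun x => x.2.1 i - ∑ j ∈ Finset.Icc 1 m, x.2.2 s(i, j), by fun_prop, fun f => ?_⟩
        rw [real_trunc_zero_label f hi0 him]
        congr 1
        · simp only [PairSimplex.stats]
          rw [if_pos hi0]
        · refine Finset.sum_congr rfl fun j hj => ?_
          rw [hstat f i j hi0 (Finset.mem_Icc.1 hj).1]
  by_cases hs : s ∈ truncRange m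
  · exact hrange s hs
  by_cases hs' : s = s(-1, 0)
  · choose! q hq using hrange
    refine ⟨fun x => 1 - ∑ t ∈ truncRange m, q t x,
      continuous_const.sub (continuous_finsetSum _ fun t ht => (hq t ht).1), fun f => ?_⟩
    rw [hs', real_trunc_neg_one f hm]
    congr 1
    exact Finset.sum_congr rfl fun t ht => (hq t ht).2 f
  · refine ⟨fun _ => 0, continuous_const, fun f => ?_⟩
    rw [measureReal_eq_zero_iff, measure_eq_zero_iff_ae_notMem]
    filter_upwards [ae_mass_ne_zero f] with t ht htt
    simp only [mem_preimage, mem_singleton_iff] at htt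
    rcases trunc_mem hm (f.properPair_of_pos ht) with h | h
    · exact hs' (htt ▸ h)
    · exact hs (htt ▸ h)

/-! ### Continuity of the generated law in the statistics -/

/-- The sum is the expected number of different labels in a pair, and a pair has at most two. -/
theorem tsum_measure_mem_le (f : PairSimplex) : ∑' v : ℤ, pairLaw f {s | v ∈ s} ≤ 2 := by
  have h : ∀ v : ℤ, pairLaw f {s | v ∈ s} =
      ∫⁻ s, {s : Sym2 ℤ | v ∈ s}.indicator 1 s ∂pairLaw f := fun v =>
    (lintegral_indicator_one MeasurableSet.of_discrete).symm
  simp only [h]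
  rw [← lintegral_tsum fun v => (measurable_of_countable _).aemeasurable]
  calc _ ≤ ∫⁻ _, 2 ∂pairLaw f := lintegral_mono fun s => ?_
    _ = 2 := by simp
  induction s with | _ a b
  calc ∑' v : ℤ, {s : Sym2 ℤ | v ∈ s}.indicator (1 : Sym2 ℤ → ENNReal) s(a, b)
      ≤ ∑' v : ℤ, (({a} : Set ℤ).indicator 1 v + ({b} : Set ℤ).indicator 1 v) := by
        refine ENNReal.tsum_le_tsum fun v => ?_
        by_cases ha : v = a
        · simp [ha]
        · by_cases hb : v = b <;> simp [ha, hb]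
    _ = 2 := by
        rw [ENNReal.tsum_add, tsum_eq_single a (by simp +contextual),
          tsum_eq_single b (by simp +contextual)]
        simp [one_add_one_eq_two]

theorem measure_mem_eq_ofReal_degree (f : PairSimplex) {i : ℤ} (hi : 1 ≤ i) :
    pairLaw f {s | i ∈ s} = ENNReal.ofReal (f.degree i) := by
  rw [f.degree_eq hi, ofReal_measureReal]

/-- The first `m + 1` labels all have degree at least that of label `m + 1`, and their degrees add
up to at most `2`. -/
theorem PairSimplex.IsRanked.degree_le {f : PairSimplex} (hf : f.IsRanked) (m : ℕ) :
    f.degree (m + 1) ≤ 2 / (m + 1) := by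
  have h1 : ∑ v ∈ Finset.Icc (1 : ℤ) (m + 1), pairLaw f {s | v ∈ s} ≤ 2 :=
    (ENNReal.sum_le_tsum _).trans (tsum_measure_mem_le f)
  have h2 : ∑ v ∈ Finset.Icc (1 : ℤ) (m + 1), ENNReal.ofReal (f.degree (m + 1)) ≤ 2 := by
    refine (Finset.sum_le_sum fun v hv => ?_).trans h1
    obtain ⟨hv1, hv2⟩ := Finset.mem_Icc.1 hv
    rw [measure_mem_eq_ofReal_degree f hv1]
    exact ENNReal.ofReal_le_ofReal (hf.degree_antitone hv1 hv2)
  have hcard : (Finset.Icc (1 : ℤ) (m + 1)).card = m + 1 := by simp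
  rw [Finset.sum_const, hcard, nsmul_eq_mul, ← ENNReal.ofReal_natCast,
    ← ENNReal.ofReal_mul (by positivity)] at h2
  have h3 : ((m + 1 : ℕ) : ℝ) * f.degree (m + 1) ≤ 2 := by
    rw [show (2 : ENNReal) = ENNReal.ofReal 2 by simp] at h2
    exact (ENNReal.ofReal_le_ofReal_iff (by norm_num)).1 h2
  push_cast at h3
  rw [le_div_iff₀ (by positivity)]
  linarith

/-- By independence the union bound is the sum of the squared degrees beyond `m`, at most the
largest of them, `2 / (m + 1)`, times the total degree `2`. -/
theorem pi_repeated_label_le {f : PairSimplex} (hf : f.IsRanked) {n : ℕ} (m : ℕ) {k l : Fin n}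
    (hkl : k ≠ l) : Measure.pi (fun _ : Fin n => pairLaw f)
      {y | ∃ v : ℤ, (m : ℤ) < v ∧ v ∈ y k ∧ v ∈ y l} ≤ ENNReal.ofReal (4 / (m + 1)) := by
  have hset : ∀ v : ℤ, {y : Fin n → Sym2 ℤ | v ∈ y k ∧ v ∈ y l} =
      Set.pi (({k, l} : Finset (Fin n)) : Set (Fin n)) fun _ => {s : Sym2 ℤ | v ∈ s} := by
    intro v
    ext y
    simp
  calc Measure.pi (fun _ : Fin n => pairLaw f) {y | ∃ v : ℤ, (m : ℤ) < v ∧ v ∈ y k ∧ v ∈ y l}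
      ≤ Measure.pi (fun _ : Fin n => pairLaw f)
          (⋃ v : {v : ℤ // (m : ℤ) < v}, {y | (v : ℤ) ∈ y k ∧ (v : ℤ) ∈ y l}) := by
        refine measure_mono ?_
        rintro y ⟨v, hv, h⟩
        exact mem_iUnion.2 ⟨⟨v, hv⟩, h⟩
    _ ≤ ∑' v : {v : ℤ // (m : ℤ) < v}, Measure.pi (fun _ : Fin n => pairLaw f)
          {y | (v : ℤ) ∈ y k ∧ (v : ℤ) ∈ y l} := measure_iUnion_le _
    _ ≤ ∑' v : {v : ℤ // (m : ℤ) < v},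
          ENNReal.ofReal (2 / (m + 1)) * pairLaw f {s | (v : ℤ) ∈ s} := by
        refine ENNReal.tsum_le_tsum fun v => ?_
        rw [hset, Measure.pi_pi_finset, Finset.prod_pair hkl]
        refine mul_le_mul_left ?_ _
        have hv := v.2
        rw [measure_mem_eq_ofReal_degree f (by omega)]
        exact ENNReal.ofReal_le_ofReal
          ((hf.degree_antitone (by omega) (by omega)).trans (hf.degree_le m))
    _ ≤ ENNReal.ofReal (2 / (m + 1)) * 2 := by
        rw [ENNReal.tsum_mul_left]
        refine mul_le_mul_right ?_ _
        exact (ENNReal.tsum_comp_le_tsum_of_injective Subtype.val_injective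
          fun v : ℤ => pairLaw f {s | v ∈ s}).trans (tsum_measure_mem_le f)
    _ = ENNReal.ofReal (4 / (m + 1)) := by
        rw [show (2 : ENNReal) = ENNReal.ofReal 2 by simp, ← ENNReal.ofReal_mul (by positivity)]
        congr 1
        ring

theorem ae_pi_properPair (f : PairSimplex) (n : ℕ) :
    ∀ᵐ y ∂Measure.pi fun _ : Fin n => pairLaw f, ∀ k, ProperPair (y k) := by
  refine ae_all_iff.2 fun k => ?_
  have h : ∀ᵐ s ∂pairLaw f, ProperPair s := by
    filter_upwards [ae_mass_ne_zero f] with s hs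
    exact f.properPair_of_pos hs
  exact (measurePreserving_eval (fun _ : Fin n => pairLaw f) k).quasiMeasurePreserving.ae h

theorem abs_measureReal_sub_le {α : Type*} [MeasurableSpace α] {μ : Measure α}
    [IsFiniteMeasure μ] {A B C : Set α} (h : ∀ᵐ x ∂μ, x ∉ C → (x ∈ A ↔ x ∈ B)) :
    |μ.real A - μ.real B| ≤ μ.real C := by
  have key : ∀ A B : Set α, (∀ᵐ x ∂μ, x ∉ C → (x ∈ A ↔ x ∈ B)) →
      μ.real A - μ.real B ≤ μ.real C := by
    intro A B h
    rw [sub_le_iff_le_add']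
    refine le_trans ?_ (measureReal_union_le B C)
    refine ENNReal.toReal_mono (measure_ne_top _ _) (measure_mono_ae ?_)
    filter_upwards [h] with x hx hA
    by_cases hC : x ∈ C
    · exact Or.inr hC
    · exact Or.inl ((hx hC).1 hA)
  rw [abs_le]
  constructor
  · have := key B A (h.mono fun x hx hC => (hx hC).symm)
    linarith
  · exact key A B h

/-- The law of the first `n` edges is a uniform limit, over ranked elements of the simplex, of
continuous functions of the statistics. -/
theorem exists_continuous_approx (n : ℕ) (E : Network (Fin n)) (m : ℕ) :
    ∃ G : StatSpace → ℝ, Continuous G ∧ ∀ f : PairSimplex, f.IsRanked →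
      |(networkLaw f).real (cylinderSet n {E}) - G f.stats| ≤ n ^ 2 * (4 / (m + 1)) := by
  classical
  have hm : (0 : ℤ) ≤ m := by positivity
  choose q hq hqf using exists_continuous_trunc hm
  let R : Finset (Sym2 ℤ) := insert s(-1, 0) (truncRange m)
  let Z : Finset (Fin n → Sym2 ℤ) :=
    (Fintype.piFinset fun _ : Fin n => R).filter fun z => finiteNetwork z = E
  -- The approximation is the probability that the truncated pairs generate `E`: a finite sum over
  -- the truncated sequences `z` that do so, with a product over the independent edges.
  refine ⟨fun x => ∑ z ∈ Z, ∏ k, q (z k) x,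
    continuous_finsetSum _ fun z _ => continuous_finsetProd _ fun k _ => hq (z k),
    fun f hf => ?_⟩
  have hG : ∑ z ∈ Z, ∏ k, q (z k) f.stats =
      (Measure.pi fun _ : Fin n => pairLaw f).real
        {y | finiteNetwork (fun k => trunc m (y k)) = E} := by
    have h1 : ∀ z : Fin n → Sym2 ℤ, ∏ k, q (z k) f.stats =
        (Measure.pi fun _ : Fin n => pairLaw f).real ((fun y k => trunc m (y k)) ⁻¹' {z}) := by
      intro z
      have : ((fun (y : Fin n → Sym2 ℤ) k => trunc m (y k)) ⁻¹' {z}) =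
          Set.pi univ fun k => trunc m ⁻¹' {z k} := by
        ext y
        simp [funext_iff]
      rw [this, measureReal_def, Measure.pi_pi, ENNReal.toReal_prod]
      exact Finset.prod_congr rfl fun k _ => (hqf (z k) f).symm
    simp only [h1]
    rw [sum_measureReal_preimage_singleton Z fun _ _ => (to_countable _).measurableSet]
    refine measureReal_congr ?_
    filter_upwards [ae_pi_properPair f n] with y hy
    refine propext ?_
    change (fun k => trunc m (y k)) ∈ Z ↔ finiteNetwork (fun k => trunc m (y k)) = E
    refine Finset.mem_filter.trans (and_iff_right (Fintype.mem_piFinset.2 fun k => ?_))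
    simpa [R] using trunc_mem hm (hy k)
  change |_ - ∑ z ∈ Z, ∏ k, q (z k) f.stats| ≤ _
  rw [hG, measureReal_def, networkLaw_cylinderSet, ← measureReal_def]
  -- Truncation can change the network only if a label beyond `m` occurs in two different edges. The
  -- `n ^ 2` ordered pairs of edges include the diagonal, whose events are empty.
  refine (abs_measureReal_sub_le (C := ⋃ p : Fin n × Fin n,
    {y | p.1 ≠ p.2 ∧ ∃ v : ℤ, (m : ℤ) < v ∧ v ∈ y p.1 ∧ v ∈ y p.2}) ?_).trans ?_
  · filter_upwards [ae_pi_properPair f n] with y hy hC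
    simp only [mem_iUnion, mem_ofPred_eq, not_exists, not_and] at hC
    simp only [mem_singleton_iff]
    rw [finiteNetwork_trunc hy hm]
    intro k l hkl v hv hvk
    exact hC (k, l) hkl v hv hvk
  · have hle : ∀ p : Fin n × Fin n, (Measure.pi fun _ : Fin n => pairLaw f).real
        {y | p.1 ≠ p.2 ∧ ∃ v : ℤ, (m : ℤ) < v ∧ v ∈ y p.1 ∧ v ∈ y p.2} ≤ 4 / (m + 1) := by
      intro p
      by_cases hp : p.1 = p.2
      · simp [hp]; positivity
      · simp only [ne_eq, hp, not_false_eq_true, true_and]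
        exact ENNReal.toReal_le_of_le_ofReal (by positivity) (pi_repeated_label_le hf m hp)
    calc _ ≤ ∑ p : Fin n × Fin n, (Measure.pi fun _ : Fin n => pairLaw f).real
          {y | p.1 ≠ p.2 ∧ ∃ v : ℤ, (m : ℤ) < v ∧ v ∈ y p.1 ∧ v ∈ y p.2} :=
          measureReal_iUnion_fintype_le _
      _ ≤ ∑ _p : Fin n × Fin n, (4 / (m + 1) : ℝ) := Finset.sum_le_sum fun p _ => hle p
      _ = n ^ 2 * (4 / (m + 1)) := by
          rw [Finset.sum_const, Finset.card_univ, Fintype.card_prod, Fintype.card_fin,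
            nsmul_eq_mul]
          push_cast
          ring

end EdgeExch

namespace EdgeExch

open Filter Topology

/-! ### The compact space of statistics -/

/-- The statistics of the ranked elements of the simplex, described by closed conditions. -/
def statPolytope : Set StatSpace :=
  Icc 0 1 ∩ {x | (∀ i : ℤ, i < 1 → x.2.1 i = 0) ∧
    (∀ s : Sym2 ℤ, (∃ i ∈ s, i < 1) → x.2.2 s = 0) ∧
    (∀ i : ℤ, 1 ≤ i → x.2.1 (i + 1) ≤ x.2.1 i) ∧
    -- These last three families say that the masses of `{0, i}`, `{0, 0}` and `{-1, 0}` after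
    -- truncation at `m` are nonnegative. Each inequality involves finitely many coordinates, so it
    -- is preserved by pointwise limits.
    (∀ (m : ℕ) (i : ℤ), 1 ≤ i → i ≤ m →
      0 ≤ x.2.1 i - ∑ j ∈ Finset.Icc (1 : ℤ) m, x.2.2 s(i, j)) ∧
    (∀ m : ℕ, 0 ≤ x.1 - ∑ j ∈ Finset.Icc (1 : ℤ) m, x.2.2 s(j, j)) ∧
    ∀ m : ℕ, ∑ s ∈ (Finset.Icc (1 : ℤ) m).sym2, x.2.2 s +
      (∑ i ∈ Finset.Icc (1 : ℤ) m, (x.2.1 i - ∑ j ∈ Finset.Icc (1 : ℤ) m, x.2.2 s(i, j)) +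
        (x.1 - ∑ j ∈ Finset.Icc (1 : ℤ) m, x.2.2 s(j, j))) ≤ 1}

theorem isCompact_statPolytope : IsCompact statPolytope := by
  refine isCompact_Icc.inter_right ?_
  simp only [ofPred_and, ofPred_forall]
  refine .inter ?_ (.inter ?_ (.inter ?_ (.inter ?_ (.inter ?_ ?_))))
  · exact isClosed_iInter fun i => isClosed_iInter fun _ => isClosed_eq (by fun_prop) (by fun_prop)
  · exact isClosed_iInter fun i => isClosed_iInter fun _ => isClosed_eq (by fun_prop) (by fun_prop)
  · exact isClosed_iInter fun i => isClosed_iInter fun _ => isClosed_le (by fun_prop) (by fun_prop)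
  · exact isClosed_iInter fun m => isClosed_iInter fun i => isClosed_iInter fun _ =>
      isClosed_iInter fun _ => isClosed_le (by fun_prop) (by fun_prop)
  · exact isClosed_iInter fun m => isClosed_le (by fun_prop) (by fun_prop)
  · exact isClosed_iInter fun m => isClosed_le (by fun_prop) (by fun_prop)

instance : CompactSpace statPolytope := isCompact_iff_compactSpace.1 isCompact_statPolytope

theorem PairSimplex.stats_degree (f : PairSimplex) {i : ℤ} (hi : 1 ≤ i) :
    f.stats.2.1 i = f.degree i := if_pos hi

theorem PairSimplex.stats_mass (f : PairSimplex) {i j : ℤ} (hi : 1 ≤ i) (hj : 1 ≤ j) :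
    f.stats.2.2 s(i, j) = f.mass s(i, j) := by simp [stats, hi, hj]

theorem PairSimplex.stats_injective : Function.Injective PairSimplex.stats := by
  intro f g h
  refine ext_of_stats (fun i j hi hj => ?_) (fun i hi => ?_) (congrArg Prod.fst h)
  · rw [← stats_mass f hi hj, h, stats_mass g hi hj]
  · rw [← stats_degree f hi, h, stats_degree g hi]

theorem PairSimplex.IsRanked.stats_mem {f : PairSimplex} (hf : f.IsRanked) :
    f.stats ∈ statPolytope := by
  classical
  have hdeg1 : ∀ i : ℤ, 1 ≤ i → f.degree i ≤ 1 := fun i hi => by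
    rw [f.degree_eq hi]
    exact measureReal_le_one
  have hmass1 : ∀ s, f.mass s ≤ 1 := fun s => by
    rw [← pairLaw_real_singleton]
    exact measureReal_le_one
  have hrow : ∀ (m : ℕ) (i : ℤ), 1 ≤ i → i ≤ m →
      f.stats.2.1 i - ∑ j ∈ Finset.Icc (1 : ℤ) m, f.stats.2.2 s(i, j) =
        (pairLaw f).real (trunc m ⁻¹' {s(0, i)}) := by
    intro m i hi him
    rw [real_trunc_zero_label f hi him, f.stats_degree hi]
    congr 1
    exact Finset.sum_congr rfl fun j hj => f.stats_mass hi (Finset.mem_Icc.1 hj).1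
  have hdiag : ∀ m : ℕ, f.stats.1 - ∑ j ∈ Finset.Icc (1 : ℤ) m, f.stats.2.2 s(j, j) =
      (pairLaw f).real (trunc m ⁻¹' {s(0, 0)}) := by
    intro m
    rw [real_trunc_zero_zero f m]
    congr 1
    exact Finset.sum_congr rfl fun j hj =>
      f.stats_mass (Finset.mem_Icc.1 hj).1 (Finset.mem_Icc.1 hj).1
  refine ⟨⟨⟨measureReal_nonneg, fun i => ?_, fun s => ?_⟩,
    ⟨measureReal_le_one, fun i => ?_, fun s => ?_⟩⟩, fun i hi => ?_, ?_, fun i hi => ?_,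
    fun m i hi him => ?_, fun m => ?_, fun m => ?_⟩
  · simp only [stats]
    split_ifs
    exacts [f.degree_nonneg i, le_rfl]
  · simp only [stats]
    split_ifs
    exacts [f.nonneg s, le_rfl]
  · simp only [stats]
    split_ifs with hi
    exacts [hdeg1 i hi, zero_le_one]
  · simp only [stats]
    split_ifs
    exacts [hmass1 s, zero_le_one]
  · exact if_neg (by omega)
  · rintro s ⟨i, his, hi⟩
    exact if_neg fun h => by
      have := h i his
      omega
  · rw [f.stats_degree hi, f.stats_degree (by omega)]
    exact hf i hi
  · rw [hrow m i hi him]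
    exact measureReal_nonneg
  · rw [hdiag m]
    exact measureReal_nonneg
  · have h := sum_real_trunc f m (truncRange m)
    rw [sum_truncRange (by positivity)] at h
    rw [hdiag m]
    have h1 : ∑ s ∈ (Finset.Icc (1 : ℤ) m).sym2, f.stats.2.2 s =
        ∑ s ∈ (Finset.Icc (1 : ℤ) m).sym2, (pairLaw f).real (trunc m ⁻¹' {s}) := by
      refine Finset.sum_congr rfl fun s hs => ?_
      rw [real_trunc_pair f hs]
      exact if_pos fun i hi => (Finset.mem_Icc.1 (Finset.mem_sym2_iff.1 hs i hi)).1
    rw [h1, Finset.sum_congr rfl fun i hi => hrow m i (Finset.mem_Icc.1 hi).1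
      (Finset.mem_Icc.1 hi).2, h]
    exact measureReal_le_one

/-- The starting index `m₀` is there because the row condition of the polytope at `i` holds only for
`m ≥ i`. -/
theorem summable_of_exhaustion {α : Type*} {g : α → ℝ} (h0 : ∀ a, 0 ≤ g a) {F : ℕ → Finset α}
    (hF : Monotone F) (hsupp : ∀ a, g a ≠ 0 → ∃ m, a ∈ F m) {c : ℝ} (m₀ : ℕ)
    (hc : ∀ m ≥ m₀, ∑ a ∈ F m, g a ≤ c) : Summable g ∧ ∑' a, g a ≤ c := by
  classical
  have key : ∀ u : Finset α, ∑ a ∈ u, g a ≤ c := by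
    intro u
    choose! M hM using hsupp
    have hsub : u.filter (fun a => g a ≠ 0) ⊆ F (max m₀ (u.sup M)) := by
      intro a ha
      obtain ⟨hau, ha0⟩ := Finset.mem_filter.1 ha
      exact hF ((Finset.le_sup hau).trans (le_max_right _ _)) (hM a ha0)
    rw [← Finset.sum_filter_ne_zero]
    exact (Finset.sum_le_sum_of_subset_of_nonneg hsub fun a _ _ => h0 a).trans
      (hc _ (le_max_left _ _))
  have hs := summable_of_sum_le h0 key
  exact ⟨hs, hs.tsum_le_of_sum_le key⟩

theorem monotone_Icc_one : Monotone fun m : ℕ => Finset.Icc (1 : ℤ) m :=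
  fun _ _ h => Finset.Icc_subset_Icc_right (by exact_mod_cast h)

/-- Every point of the polytope is the vector of statistics of a ranked element. -/
theorem exists_stats_eq {x : StatSpace} (hx : x ∈ statPolytope) :
    ∃ f : PairSimplex, f.stats = x ∧ f.IsRanked := by
  classical
  obtain ⟨⟨⟨-, -, h0⟩, -⟩, hD0, hA0, hrank, hrow, hdiag, htot⟩ := hx
  obtain ⟨L, D, A⟩ := x
  simp only at h0 hD0 hA0 hrank hrow hdiag htot
  replace h0 : ∀ s, 0 ≤ A s := h0
  have hAneg : ∀ i j : ℤ, A s(i, j) ≠ 0 → 1 ≤ i ∧ 1 ≤ j := by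
    intro i j h
    constructor
    · by_contra hi
      exact h (hA0 _ ⟨i, by simp, by omega⟩)
    · by_contra hi
      exact h (hA0 _ ⟨j, by simp, by omega⟩)
  have hexh : ∀ j : ℤ, 1 ≤ j → ∃ m : ℕ, j ∈ Finset.Icc (1 : ℤ) m := fun j hj =>
    ⟨j.toNat, Finset.mem_Icc.2 ⟨hj, by omega⟩⟩
  have hArow : ∀ i : ℤ, 1 ≤ i → Summable (fun j => A s(i, j)) ∧ ∑' j, A s(i, j) ≤ D i := by
    intro i hi
    refine summable_of_exhaustion (fun j => h0 _) monotone_Icc_one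
      (fun j hj => hexh j (hAneg i j hj).2) i.toNat fun m hm => ?_
    linarith [hrow m i hi (by omega)]
  have hAdiag : Summable (fun j => A s(j, j)) ∧ ∑' j, A s(j, j) ≤ L := by
    refine summable_of_exhaustion (fun j => h0 _) monotone_Icc_one
      (fun j hj => hexh j (hAneg j j hj).2) 0 fun m _ => ?_
    linarith [hdiag m]
  -- The part of the degree of `i` not accounted for by pairs of positive labels becomes the mass of
  -- `{0, i}`, and the missing loop mass becomes that of `{0, 0}`. In a limit this is where mass
  -- carried off by escaping labels ends up.
  set D' : ℤ → ℝ := fun i => D i - ∑' j, A s(i, j) with hD'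
  set L' : ℝ := L - ∑' j, A s(j, j) with hL'
  have hD'0 : ∀ i, 1 ≤ i → 0 ≤ D' i := fun i hi => sub_nonneg.2 (hArow i hi).2
  have hL'0 : 0 ≤ L' := sub_nonneg.2 hAdiag.2
  let r : Sym2 ℤ → ℝ := Sym2.lift ⟨fun a b =>
    if a = 0 ∧ b = 0 then L' else if a = 0 ∧ 1 ≤ b then D' b
    else if b = 0 ∧ 1 ≤ a then D' a else A s(a, b), fun a b => by
      dsimp only
      rw [Sym2.eq_swap (a := b)]
      split_ifs <;> first | rfl | omega⟩
  have hr : ∀ a b, r s(a, b) = if a = 0 ∧ b = 0 then L' else if a = 0 ∧ 1 ≤ b then D' b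
    else if b = 0 ∧ 1 ≤ a then D' a else A s(a, b) := fun _ _ => rfl
  have hr0 : ∀ s, 0 ≤ r s := by
    intro s
    induction s with | _ a b
    rw [hr]
    split_ifs with h1 h2 h3
    exacts [hL'0, hD'0 b h2.2, hD'0 a h3.2, h0 _]
  have hrsupp : ∀ a b, r s(a, b) ≠ 0 →
      (a = 0 ∧ 0 ≤ b) ∨ (b = 0 ∧ 0 ≤ a) ∨ (1 ≤ a ∧ 1 ≤ b) := by
    intro a b h
    rw [hr] at h
    split_ifs at h with h1 h2 h3
    · omega
    · omega
    · omega
    · exact Or.inr (Or.inr (hAneg a b h))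
  have hrneg : ∀ i : ℤ, r s(-1, i) = 0 := by
    intro i
    by_contra h
    have := hrsupp _ _ h
    omega
  have hrA : ∀ i j : ℤ, 1 ≤ i → 1 ≤ j → r s(i, j) = A s(i, j) := by
    intro i j hi hj
    rw [hr, if_neg (by omega), if_neg (by omega), if_neg (by omega)]
  have hrD : ∀ i : ℤ, 1 ≤ i → r s(0, i) = D' i := by
    intro i hi
    rw [hr, if_neg (by omega), if_pos ⟨rfl, hi⟩]
  obtain ⟨hrs, hr1⟩ : Summable r ∧ ∑' s, r s ≤ 1 := by
    refine summable_of_exhaustion hr0 (F := fun m : ℕ => truncRange m) ?_ ?_ 0 fun m _ => ?_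
    · intro m n hmn
      have hmn' : (m : ℤ) ≤ n := by exact_mod_cast hmn
      exact Finset.union_subset_union (Finset.sym2_mono (monotone_Icc_one hmn))
        (Finset.image_subset_image (Finset.Icc_subset_Icc_right hmn'))
    · intro s hs
      induction s with | _ a b
      rcases hrsupp a b hs with ⟨rfl, h⟩ | ⟨rfl, h⟩ | h
      · exact ⟨b.toNat, Finset.mem_union_right _ (Finset.mem_image.2
          ⟨b, Finset.mem_Icc.2 ⟨h, by omega⟩, rfl⟩)⟩
      · exact ⟨a.toNat, Finset.mem_union_right _ (Finset.mem_image.2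
          ⟨a, Finset.mem_Icc.2 ⟨h, by omega⟩, Sym2.eq_swap⟩)⟩
      · exact ⟨(max a b).toNat, Finset.mem_union_left _ (Finset.mk_mem_sym2_iff.2
          ⟨Finset.mem_Icc.2 ⟨h.1, by omega⟩, Finset.mem_Icc.2 ⟨h.2, by omega⟩⟩)⟩
    · rw [sum_truncRange (by positivity)]
      -- `D'` and `L'` subtract the full sums, while the polytope condition subtracts the sums up to
      -- `m`, which are smaller; so the bound by `1` carries over.
      refine le_trans (add_le_add (le_of_eq ?_) (add_le_add (Finset.sum_le_sum fun i hi => ?_) ?_))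
        (htot m)
      · refine Finset.sum_congr rfl fun s hs => ?_
        induction s with | _ a b
        obtain ⟨h1, h2⟩ := Finset.mk_mem_sym2_iff.1 hs
        exact hrA a b (Finset.mem_Icc.1 h1).1 (Finset.mem_Icc.1 h2).1
      · have hi1 := (Finset.mem_Icc.1 hi).1
        rw [hrD i hi1, hD']
        exact sub_le_sub_left ((hArow i hi1).1.sum_le_tsum _ fun _ _ => h0 _) _
      · rw [hr, if_pos ⟨rfl, rfl⟩, hL']
        exact sub_le_sub_left (hAdiag.1.sum_le_tsum _ fun _ _ => h0 _) _
  -- Whatever is missing from total mass one is given to `{-1, 0}`, which enters none of the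
  -- statistics.
  let f : PairSimplex :=
    { mass := fun s => r s + if s = s(-1, 0) then 1 - ∑' s, r s else 0
      nonneg := fun s => by
        refine add_nonneg (hr0 s) ?_
        split_ifs
        exacts [sub_nonneg.2 hr1, le_rfl]
      label_ge := by
        intro s i hi hlt
        obtain ⟨j, rfl⟩ := Sym2.mem_iff_exists.1 hi
        rw [if_neg (by rw [Sym2.eq_iff]; omega), add_zero]
        by_contra h
        have := hrsupp _ _ h
        omega
      neg_one := by
        intro i hi
        rw [if_neg (by rw [Sym2.eq_iff]; omega), add_zero, hrneg]
      hasSum_one := by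
        have h := hrs.hasSum.add (hasSum_ite_eq s((-1 : ℤ), (0 : ℤ)) (1 - ∑' s, r s))
        rwa [add_sub_cancel] at h }
  have hf : ∀ a b : ℤ, 0 ≤ a → 0 ≤ b → f.mass s(a, b) = r s(a, b) := by
    intro a b ha hb
    change r s(a, b) + (if s(a, b) = s(-1, 0) then 1 - ∑' s, r s else 0) = _
    rw [if_neg (by rw [Sym2.eq_iff]; omega), add_zero]
  have hfneg : ∀ a b : ℤ, b < 0 → a ≠ 0 → f.mass s(a, b) = 0 := by
    intro a b hb ha
    change r s(a, b) + (if s(a, b) = s(-1, 0) then 1 - ∑' s, r s else 0) = _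
    rw [if_neg (by rw [Sym2.eq_iff]; omega), add_zero]
    by_contra h
    have := hrsupp _ _ h
    omega
  have hdeg : ∀ i : ℤ, 1 ≤ i → f.degree i = D i := by
    intro i hi
    have hinj : Function.Injective fun j : ℤ => s(i, j) := fun a b hab => Sym2.congr_right.1 hab
    have hterm : ∀ j : ℤ, {s | i ∈ s}.indicator f.mass s(i, j) =
        (if j = 0 then D' i else 0) + A s(i, j) := by
      intro j
      rw [indicator_of_mem (by simp)]
      rcases lt_trichotomy j 0 with hj | rfl | hj
      · rw [hfneg i j hj (by omega), if_neg (by omega), hA0 _ ⟨j, by simp, by omega⟩, add_zero]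
      · rw [hf _ _ (by omega) le_rfl, Sym2.eq_swap, hrD i hi, if_pos rfl,
          hA0 _ ⟨0, by simp, by omega⟩, add_zero]
      · rw [hf _ _ (by omega) hj.le, hrA i j hi hj, if_neg (by omega), zero_add]
    rw [f.degree_eq hi, pairLaw_real_apply, ← hinj.tsum_eq]
    · simp only [hterm]
      rw [((hasSum_ite_eq (0 : ℤ) (D' i)).summable).tsum_add (hArow i hi).1, tsum_ite_eq, hD']
      ring
    · intro s hs
      have his : s ∈ {s : Sym2 ℤ | i ∈ s} := mem_of_indicator_ne_zero (Function.mem_support.1 hs)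
      obtain ⟨j, rfl⟩ := Sym2.mem_iff_exists.1 his
      exact ⟨j, rfl⟩
  have hloop : f.loopMass = L := by
    have hinj : Function.Injective fun j : ℤ => s(j, j) := fun a b hab => by simpa using hab
    have hterm : ∀ j : ℤ, {s : Sym2 ℤ | s.IsDiag}.indicator f.mass s(j, j) =
        (if j = 0 then L' else 0) + A s(j, j) := by
      intro j
      rw [indicator_of_mem (by simp)]
      rcases lt_trichotomy j 0 with hj | rfl | hj
      · rw [hfneg j j hj (by omega), if_neg (by omega), hA0 _ ⟨j, by simp, by omega⟩, add_zero]
      · rw [hf _ _ le_rfl le_rfl, hr, if_pos ⟨rfl, rfl⟩, if_pos rfl,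
          hA0 _ ⟨0, by simp, by omega⟩, add_zero]
      · rw [hf _ _ hj.le hj.le, hrA j j hj hj, if_neg (by omega), zero_add]
    rw [PairSimplex.loopMass, pairLaw_real_apply, ← hinj.tsum_eq]
    · simp only [hterm]
      rw [((hasSum_ite_eq (0 : ℤ) L').summable).tsum_add hAdiag.1, tsum_ite_eq, hL']
      ring
    · intro s hs
      have hs' : s.IsDiag := mem_of_indicator_ne_zero (Function.mem_support.1 hs)
      induction s with | _ a b
      obtain rfl := Sym2.mk_isDiag_iff.1 hs'
      exact ⟨a, rfl⟩
  refine ⟨f, Prod.ext hloop (Prod.ext ?_ ?_), fun i hi => ?_⟩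
  · funext i
    by_cases hi : 1 ≤ i
    · rw [f.stats_degree hi, hdeg i hi]
    · exact (if_neg hi).trans (hD0 i (by omega)).symm
  · funext s
    induction s with | _ a b
    by_cases h : 1 ≤ a ∧ 1 ≤ b
    · rw [f.stats_mass h.1 h.2, hf a b (by omega) (by omega), hrA a b h.1 h.2]
    · refine Eq.trans (if_neg fun h' => h ⟨h' a (by simp), h' b (by simp)⟩) ?_
      by_contra hA
      exact h (hAneg a b (Ne.symm hA))
  · rw [hdeg i hi, hdeg _ (by omega)]
    exact hrank i hi

/-- The ranked element of the simplex with given statistics. -/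
noncomputable def simplexOf (x : statPolytope) : PairSimplex := (exists_stats_eq x.2).choose

theorem stats_simplexOf (x : statPolytope) : (simplexOf x).stats = x :=
  (exists_stats_eq x.2).choose_spec.1

theorem isRanked_simplexOf (x : statPolytope) : (simplexOf x).IsRanked :=
  (exists_stats_eq x.2).choose_spec.2

theorem simplexOf_stats {f : PairSimplex} (hf : f.IsRanked) :
    simplexOf ⟨f.stats, hf.stats_mem⟩ = f :=
  PairSimplex.stats_injective (stats_simplexOf _)

/-! ### The probabilities of finite networks -/

/-- The probabilities of all finite networks under the law generated by `f`. -/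
noncomputable def finiteProbs (f : PairSimplex) : (Σ n, Network (Fin n)) → ℝ :=
  fun c => (networkLaw f).real (cylinderSet c.1 {c.2})

theorem finiteProbs_eq_iff {f g : PairSimplex} :
    finiteProbs f = finiteProbs g ↔ networkLaw f = networkLaw g := by
  refine ⟨fun h => measure_network_ext fun n E => ?_, fun h => funext fun c => by
    rw [finiteProbs, finiteProbs, h]⟩
  have := congrFun h ⟨n, E⟩
  exact (measureReal_eq_measureReal_iff).1 this

/-- The error bound of `exists_continuous_approx` is the same at all points of the polytope, since
all of them come from ranked elements; a uniform limit of continuous functions is continuous. -/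
theorem continuous_finiteProbs : Continuous fun x : statPolytope => finiteProbs (simplexOf x) := by
  refine continuous_pi fun ⟨n, E⟩ => ?_
  choose G hG hGf using exists_continuous_approx n E
  have hlim : Tendsto (fun m : ℕ => (n : ℝ) ^ 2 * (4 / (m + 1))) atTop (𝓝 0) := by
    have h := (tendsto_one_div_add_atTop_nhds_zero_nat (𝕜 := ℝ)).const_mul ((n : ℝ) ^ 2 * 4)
    rw [mul_zero] at h
    refine h.congr fun m => ?_
    ring
  have hunif : TendstoUniformly (fun (m : ℕ) (x : statPolytope) => G m x)
      (fun x => finiteProbs (simplexOf x) ⟨n, E⟩) atTop := by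
    rw [Metric.tendstoUniformly_iff]
    intro ε hε
    filter_upwards [hlim.eventually_lt_const hε] with m hm x
    have h := hGf m (simplexOf x) (isRanked_simplexOf x)
    rw [stats_simplexOf] at h
    exact h.trans_lt hm
  exact hunif.continuous (.of_forall fun m => (hG m).comp continuous_subtype_val)

/-! ### Lexicographic maximization -/

/-- Maximize `u 0` on `C`, then `u 1` on the set of maximizers, and so on. This gives a decreasing
sequence of nonempty compact sets, and any point of their intersection will do. -/
theorem exists_lex_max {K : Type*} [TopologicalSpace K] [T2Space K] {C : Set K} (hC : IsCompact C)
    (hne : C.Nonempty) {u : ℕ → K → ℝ} (hu : ∀ n, Continuous (u n)) :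
    ∃ x ∈ C, ∀ y ∈ C, ∀ n, (∀ m < n, u m y = u m x) → u n y ≤ u n x := by
  let T : ℕ → Set K := fun n => Nat.rec C (fun n S => {x ∈ S | ∀ y ∈ S, u n y ≤ u n x}) n
  have hT : ∀ n, T (n + 1) = {x ∈ T n | ∀ y ∈ T n, u n y ≤ u n x} := fun n => rfl
  have hprop : ∀ n, IsCompact (T n) ∧ (T n).Nonempty := by
    intro n
    induction n with
    | zero => exact ⟨hC, hne⟩
    | succ n ih =>
      obtain ⟨x, hx, hmax⟩ := ih.1.exists_isMaxOn ih.2 (hu n).continuousOn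
      refine ⟨?_, x, hx, hmax⟩
      have : T (n + 1) = T n ∩ {x | ∀ y ∈ T n, u n y ≤ u n x} := rfl
      rw [this]
      refine ih.1.inter_right ?_
      simp only [ofPred_forall]
      exact isClosed_iInter fun y => isClosed_iInter fun _ => isClosed_le continuous_const (hu n)
  have hsub : ∀ n, T (n + 1) ⊆ T n := fun n x hx => hx.1
  obtain ⟨x, hx⟩ := IsCompact.nonempty_iInter_of_sequence_nonempty_isCompact_isClosed T hsub
    (fun n => (hprop n).2) (hprop 0).1 fun n => (hprop n).1.isClosed
  rw [mem_iInter] at hx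
  refine ⟨x, hx 0, fun y hy n hyn => ?_⟩
  have hmem : ∀ m ≤ n, y ∈ T m := by
    intro m hm
    induction m with
    | zero => exact hy
    | succ m ih =>
      refine ⟨ih (by omega), fun z hz => ?_⟩
      rw [hyn m (by omega)]
      exact (hx (m + 1)).2 z hz
  exact (hx (n + 1)).2 y (hmem n le_rfl)

/-- The lexicographic coordinates in terms of the statistics. -/
noncomputable def lexStat (n : ℕ) (x : StatSpace) : ℝ :=
  if 1 ≤ n - n.sqrt ^ 2 ∧ n - n.sqrt ^ 2 ≤ n.sqrt then
    x.2.2 s(((n - n.sqrt ^ 2 : ℕ) : ℤ), (n.sqrt : ℤ)) else 0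

theorem lexStat_stats (n : ℕ) (f : PairSimplex) : lexStat n f.stats = f.lexCoord n := by
  unfold lexStat PairSimplex.lexCoord
  split_ifs with h
  · exact f.stats_mass (by exact_mod_cast h.1) (by exact_mod_cast h.1.trans h.2)
  · rfl

theorem continuous_lexStat (n : ℕ) : Continuous (lexStat n) := by
  unfold lexStat
  split_ifs <;> fun_prop

/-- Every ranked element generates the same network as an element of the ranked simplex. -/
theorem exists_mem_rankedSimplex {f : PairSimplex} (hf : f.IsRanked) :
    ∃ g ∈ RankedSimplex, networkLaw g = networkLaw f := by
  have hclosed : IsClosed {x : statPolytope | finiteProbs (simplexOf x) = finiteProbs f} :=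
    isClosed_eq continuous_finiteProbs continuous_const
  -- The fibre of ranked elements that generate the same law as `f` is compact and contains every
  -- ranked reordering of each of its members, so nothing that competes with its lexicographic
  -- maximum lies outside it.
  obtain ⟨x, hx, hmax⟩ := exists_lex_max hclosed.isCompact
    ⟨⟨f.stats, hf.stats_mem⟩, by rw [mem_ofPred_eq, simplexOf_stats hf]⟩
    fun n => (continuous_lexStat n).comp continuous_subtype_val
  have hxf := finiteProbs_eq_iff.1 hx
  refine ⟨simplexOf x, ⟨isRanked_simplexOf x, fun g hg hgr hlex => ?_⟩, hxf⟩
  obtain ⟨n, hlt, heq⟩ := PairSimplex.lexBefore_iff.1 hlex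
  simp only [← lexStat_stats, stats_simplexOf] at hlt heq
  refine hlt.not_ge (hmax ⟨g.stats, hgr.stats_mem⟩ ?_ n heq)
  rw [mem_ofPred_eq, simplexOf_stats hgr, finiteProbs_eq_iff, ← hxf]
  exact hg.networkLaw_eq.symm

/-! ### The ranked simplex is a Borel set -/

theorem abs_pairLaw_real_sub_le (f g : PairSimplex) (A : Set (Sym2 ℤ)) :
    |(pairLaw f).real A - (pairLaw g).real A| ≤ dist f g := by
  have hle : ∀ s, |A.indicator f.mass s - A.indicator g.mass s| ≤ |f.mass s - g.mass s| := by
    intro s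
    by_cases hs : s ∈ A <;> simp [hs]
  have hs := PairSimplex.summable_abs_sub f g
  have hs' : Summable fun s => |A.indicator f.mass s - A.indicator g.mass s| :=
    Summable.of_nonneg_of_le (fun s => abs_nonneg _) hle hs
  have hnorm := norm_tsum_le_tsum_norm (f := fun s => A.indicator f.mass s - A.indicator g.mass s)
    hs'
  rw [(f.hasSum_one.summable.indicator A).tsum_sub (g.hasSum_one.summable.indicator A),
    ← pairLaw_real_apply, ← pairLaw_real_apply] at hnorm
  rw [PairSimplex.dist_eq]
  exact hnorm.trans (hs'.tsum_le_tsum hle hs)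

theorem continuous_pairLaw_real (A : Set (Sym2 ℤ)) :
    Continuous fun f : PairSimplex => (pairLaw f).real A := by
  refine continuous_iff_continuousAt.2 fun f => ?_
  rw [ContinuousAt, tendsto_iff_dist_tendsto_zero]
  refine squeeze_zero (fun _ => dist_nonneg) (fun g => abs_pairLaw_real_sub_le g f A) ?_
  exact tendsto_iff_dist_tendsto_zero.1 tendsto_id

theorem continuous_stats : Continuous PairSimplex.stats := by
  classical
  refine (continuous_pairLaw_real _).prodMk (.prodMk (continuous_pi fun i => ?_)
    (continuous_pi fun s => ?_))
  · split_ifs with hi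
    · simp only [PairSimplex.degree_eq _ hi]
      exact continuous_pairLaw_real _
    · exact continuous_const
  · split_ifs
    · exact (continuous_apply s).comp PairSimplex.continuous_mass
    · exact continuous_const

/-- A ranked element is excluded when another ranked element with the same law, equivalently a
reordering, comes before it. With the place `n` of the first difference fixed and the difference at
least `1 / (k + 1)`, such pairs form a compact set `Q n k`; its projection is compact, so countably
many closed sets are removed from the closed set of ranked elements. -/
theorem measurableSet_rankedSimplex : MeasurableSet RankedSimplex := by
  let Q : ℕ → ℕ → Set (statPolytope × statPolytope) := fun n k =>
    {p | finiteProbs (simplexOf p.1) = finiteProbs (simplexOf p.2) ∧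
      lexStat n p.1 + 1 / (k + 1) ≤ lexStat n p.2 ∧ ∀ m < n, lexStat m p.2 = lexStat m p.1}
  have hQ : ∀ n k, IsCompact (Q n k) := by
    intro n k
    refine IsClosed.isCompact ?_
    have h1 : ∀ n, Continuous fun p : statPolytope × statPolytope => lexStat n p.1 := fun n =>
      (continuous_lexStat n).comp (continuous_subtype_val.comp continuous_fst)
    have h2 : ∀ n, Continuous fun p : statPolytope × statPolytope => lexStat n p.2 := fun n =>
      (continuous_lexStat n).comp (continuous_subtype_val.comp continuous_snd)
    simp only [Q, ofPred_and, ofPred_forall]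
    refine .inter (isClosed_eq (continuous_finiteProbs.comp continuous_fst)
      (continuous_finiteProbs.comp continuous_snd)) (.inter
      (isClosed_le ((h1 n).add continuous_const) (h2 n)) ?_)
    exact isClosed_iInter fun m => isClosed_iInter fun _ => isClosed_eq (h2 m) (h1 m)
  have hranked : IsClosed {f : PairSimplex | f.IsRanked} := by
    have : {f : PairSimplex | f.IsRanked} = {f | ∀ i : ℤ, 1 ≤ i →
        f.stats.2.1 (i + 1) ≤ f.stats.2.1 i} := by
      ext f
      refine forall_congr' fun i => forall_congr' fun hi => ?_
      rw [f.stats_degree hi, f.stats_degree (by omega)]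
    rw [this]
    simp only [ofPred_forall]
    have hc : ∀ i : ℤ, Continuous fun f : PairSimplex => f.stats.2.1 i := fun i =>
      (continuous_apply i).comp (continuous_fst.comp (continuous_snd.comp continuous_stats))
    exact isClosed_iInter fun i => isClosed_iInter fun _ => isClosed_le (hc _) (hc _)
  have heq : RankedSimplex = {f | f.IsRanked} \
      ⋃ n, ⋃ k, PairSimplex.stats ⁻¹' ((fun p => (p.1 : StatSpace)) '' Q n k) := by
    ext f
    refine ⟨fun hf => ⟨hf.1, fun hmem => ?_⟩, fun ⟨hf, hnot⟩ => ⟨hf, fun g hg hgr hlex => ?_⟩⟩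
    · simp only [mem_iUnion, mem_preimage] at hmem
      obtain ⟨n, k, ⟨x, y⟩, ⟨h1, h2, h3⟩, hxf⟩ := hmem
      have hx : simplexOf x = f := PairSimplex.stats_injective ((stats_simplexOf x).trans hxf)
      rw [hx] at h1
      refine hf.2 (simplexOf y) (isReordering_of_networkLaw_eq (finiteProbs_eq_iff.1 h1))
        (isRanked_simplexOf y) (PairSimplex.lexBefore_iff.2 ⟨n, ?_, fun m hm => ?_⟩)
      · rw [← lexStat_stats, ← lexStat_stats, stats_simplexOf, ← hx, stats_simplexOf]
        have : (0 : ℝ) < 1 / (k + 1) := by positivity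
        linarith
      · rw [← lexStat_stats, ← lexStat_stats, stats_simplexOf, ← hx, stats_simplexOf]
        exact h3 m hm
    · obtain ⟨n, hlt, h3⟩ := PairSimplex.lexBefore_iff.1 hlex
      obtain ⟨k, hk⟩ := exists_nat_one_div_lt (sub_pos.2 hlt)
      simp only [← lexStat_stats] at hk h3
      refine hnot (mem_iUnion.2 ⟨n, mem_iUnion.2 ⟨k, ⟨(⟨f.stats, PairSimplex.IsRanked.stats_mem hf⟩,
        ⟨g.stats, hgr.stats_mem⟩), ⟨?_, ?_, h3⟩, rfl⟩⟩⟩)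
      · rw [simplexOf_stats hf, simplexOf_stats hgr, finiteProbs_eq_iff]
        exact hg.networkLaw_eq
      · change lexStat n f.stats + _ ≤ lexStat n g.stats
        linarith
  rw [heq]
  refine hranked.measurableSet.diff (.iUnion fun n => .iUnion fun k => ?_)
  exact (((hQ n k).image (continuous_subtype_val.comp continuous_fst)).isClosed.preimage
    continuous_stats).measurableSet

end EdgeExch

namespace EdgeExch

open Filter Topology

/-! ### The ranked simplex as a compact set of probabilities of finite networks -/

/-- This exhibits the simplex as a Borel subset of a countable product of lines, which makes
`RankedSimplex` standard Borel. Writing the total mass as a sum in `ENNReal` states summability and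
the value `1` in one measurable condition. -/
theorem measurableEmbedding_mass :
    MeasurableEmbedding (PairSimplex.mass : PairSimplex → Sym2 ℤ → ℝ) := by
  refine MeasurableEmbedding.iff_comap_eq.2 ⟨fun f g h => PairSimplex.ext h,
    PairSimplex.measurableSpace_eq.symm, ?_⟩
  have heq : range PairSimplex.mass = {x : Sym2 ℤ → ℝ | (∀ s, 0 ≤ x s) ∧
      (∀ s, ∀ i ∈ s, i < -1 → x s = 0) ∧ (∀ i : ℤ, i ≠ 0 → x s(-1, i) = 0) ∧
      ∑' s, ENNReal.ofReal (x s) = 1} := by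
    ext x
    constructor
    · rintro ⟨f, rfl⟩
      refine ⟨f.nonneg, f.label_ge, f.neg_one, ?_⟩
      rw [← ENNReal.ofReal_tsum_of_nonneg f.nonneg f.hasSum_one.summable, f.hasSum_one.tsum_eq,
        ENNReal.ofReal_one]
    · rintro ⟨h1, h2, h3, h4⟩
      have h5 := ENNReal.hasSum_toReal (f := fun s => ENNReal.ofReal (x s)) (by simp [h4])
      simp only [ENNReal.toReal_ofReal (h1 _)] at h5
      have h6 : ∑' s, x s = 1 := by
        have := congrArg ENNReal.toReal h4
        rw [ENNReal.tsum_toReal_eq fun s => ENNReal.ofReal_ne_top] at this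
        simpa only [ENNReal.toReal_ofReal (h1 _), ENNReal.toReal_one] using this
      exact ⟨⟨x, h1, h2, h3, h6 ▸ h5⟩, rfl⟩
  rw [heq]
  simp only [ofPred_and, ofPred_forall]
  refine .inter (.iInter fun s => ?_) (.inter (.iInter fun s => .iInter fun i => .iInter fun _ =>
    .iInter fun _ => ?_) (.inter (.iInter fun i => .iInter fun _ => ?_) ?_))
  · exact measurableSet_le measurable_const (measurable_pi_apply s)
  · exact measurableSet_eq_fun (measurable_pi_apply s) measurable_const
  · exact measurableSet_eq_fun (measurable_pi_apply _) measurable_const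
  · exact measurableSet_eq_fun (.tsum fun s => (measurable_pi_apply s).ennreal_ofReal)
      measurable_const

/-- The probabilities of finite networks as a function on the ranked simplex. -/
noncomputable def rankedProbs (f : RankedSimplex) : (Σ n, Network (Fin n)) → ℝ :=
  finiteProbs (f : PairSimplex)

instance : Countable (Σ n, Network (Fin n)) := inferInstance

theorem measurable_rankedProbs : Measurable rankedProbs := by
  have h : rankedProbs = (fun x : statPolytope => finiteProbs (simplexOf x)) ∘
      fun f : RankedSimplex => ⟨(f : PairSimplex).stats, f.2.1.stats_mem⟩ := by
    funext f
    exact congrArg finiteProbs (simplexOf_stats f.2.1).symm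
  rw [h]
  exact (continuous_finiteProbs.comp
    ((continuous_stats.comp continuous_subtype_val).subtype_mk _)).measurable

theorem rankedProbs_injective : Function.Injective rankedProbs := fun f g h =>
  Subtype.ext (eq_of_networkLaw_eq f.2 g.2 (finiteProbs_eq_iff.1 h))

/-- By the Lusin–Souslin theorem an injective measurable map on a standard Borel space has Borel
images and a measurable inverse. -/
theorem measurableEmbedding_rankedProbs : MeasurableEmbedding rankedProbs := by
  have hm : MeasurableEmbedding fun f : RankedSimplex => (f : PairSimplex).mass :=
    measurableEmbedding_mass.comp (MeasurableEmbedding.subtype_coe measurableSet_rankedSimplex)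
  have := hm.measurableSet_range.standardBorel
  let e := hm.equivRange
  have h : rankedProbs = (rankedProbs ∘ e.symm) ∘ e := by
    funext f
    simp
  rw [h]
  exact ((measurable_rankedProbs.comp e.symm.measurable).measurableEmbedding
    (rankedProbs_injective.comp e.symm.injective)).comp e.measurableEmbedding

/-- Passing from all ranked elements to the lexicographically first ones loses no law, so the range
is the continuous image of the whole compact polytope. -/
theorem range_rankedProbs :
    range rankedProbs = range fun x : statPolytope => finiteProbs (simplexOf x) := by
  ext y
  constructor
  · rintro ⟨f, rfl⟩
    exact ⟨⟨(f : PairSimplex).stats, f.2.1.stats_mem⟩,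
      congrArg finiteProbs (simplexOf_stats f.2.1)⟩
  · rintro ⟨x, rfl⟩
    obtain ⟨g, hg, h⟩ := exists_mem_rankedSimplex (isRanked_simplexOf x)
    exact ⟨⟨g, hg⟩, finiteProbs_eq_iff.2 h⟩

theorem isCompact_range_rankedProbs : IsCompact (range rankedProbs) := by
  rw [range_rankedProbs]
  exact isCompact_range continuous_finiteProbs

instance : CompactSpace (range rankedProbs) :=
  isCompact_iff_compactSpace.1 isCompact_range_rankedProbs

instance : PolishSpace (range rankedProbs) := isCompact_range_rankedProbs.isClosed.polishSpace

/-- The ranked simplex is Borel isomorphic to a compact space. -/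
noncomputable def rankedEquiv : RankedSimplex ≃ᵐ range rankedProbs :=
  measurableEmbedding_rankedProbs.equivRange

theorem rankedEquiv_apply (f : RankedSimplex) :
    (rankedEquiv f : (Σ n, Network (Fin n)) → ℝ) = finiteProbs (f : PairSimplex) :=
  congrArg Subtype.val (measurableEmbedding_rankedProbs.equivRange_apply f)

/-- A coordinate on the compact space of probabilities of finite networks. -/
noncomputable def coordFunction (c : Σ n, Network (Fin n)) :
    BoundedContinuousFunction (range rankedProbs) ℝ :=
  BoundedContinuousFunction.mkOfCompact
    ⟨fun y => y.1 c, (continuous_apply c).comp continuous_subtype_val⟩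

theorem coordFunction_rankedEquiv (f : RankedSimplex) (n : ℕ) (E : Network (Fin n)) :
    coordFunction ⟨n, E⟩ (rankedEquiv f) =
      (networkLaw (f : PairSimplex)).real (cylinderSet n {E}) :=
  congrFun (rankedEquiv_apply f) ⟨n, E⟩

theorem measurable_networkLaw : Measurable fun f : RankedSimplex =>
    networkLaw (f : PairSimplex) := by
  refine .measure_of_isPiSystem_of_isProbabilityMeasure generateFrom_cylinders
    isPiSystem_cylinders ?_
  rintro _ (⟨n, E, rfl⟩ | rfl)
  · have h : (fun f : RankedSimplex => networkLaw (f : PairSimplex) (cylinderSet n {E})) =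
        fun f => ENNReal.ofReal (rankedProbs f ⟨n, E⟩) := by
      funext f
      exact (ofReal_measureReal (measure_ne_top _ _)).symm
    rw [h]
    exact ((measurable_pi_apply _).comp measurable_rankedProbs).ennreal_ofReal
  · simp

theorem measurable_networkLaw_real {B : Set (Network ℕ)} (hB : MeasurableSet B) :
    Measurable fun f : RankedSimplex => (networkLaw (f : PairSimplex)).real B :=
  ((Measure.measurable_coe hB).comp measurable_networkLaw).ennreal_toReal

theorem integrable_networkLaw_real (φ : Measure RankedSimplex) [IsProbabilityMeasure φ]
    {B : Set (Network ℕ)} (hB : MeasurableSet B) :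
    Integrable (fun f : RankedSimplex => (networkLaw (f : PairSimplex)).real B) φ := by
  refine Integrable.of_bound (C := 1) (measurable_networkLaw_real hB).aestronglyMeasurable
    (ae_of_all _ fun f => ?_)
  rw [Real.norm_of_nonneg measureReal_nonneg]
  exact measureReal_le_one

theorem lintegral_networkLaw (φ : Measure RankedSimplex) [IsProbabilityMeasure φ]
    {B : Set (Network ℕ)} (hB : MeasurableSet B) :
    ∫⁻ f : RankedSimplex, networkLaw (f : PairSimplex) B ∂φ =
      ENNReal.ofReal (∫ f : RankedSimplex, (networkLaw (f : PairSimplex)).real B ∂φ) := by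
  rw [ofReal_integral_eq_lintegral_ofReal (integrable_networkLaw_real φ hB)
    (ae_of_all _ fun f => measureReal_nonneg)]
  exact lintegral_congr fun f => (ofReal_measureReal (measure_ne_top _ _)).symm

/-! ### Uniqueness of the mixing measure -/

/-- The probabilities of cylinder sets as functions on the ranked simplex; they are closed under
multiplication. -/
noncomputable def cylinderFunctions : Submonoid (RankedSimplex → ℝ) where
  carrier := {g | ∃ (n : ℕ) (S : Set (Network (Fin n))),
    g = fun f : RankedSimplex => (networkLaw (f : PairSimplex)).real (cylinderSet n S)}
  one_mem' := ⟨0, univ, by funext f; simp [cylinderSet]⟩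
  mul_mem' := by
    rintro _ _ ⟨m, S, rfl⟩ ⟨n, T, rfl⟩
    refine ⟨m + n, {E | E.pullback (Fin.castAdd n) ∈ S ∧ E.pullback (Fin.natAdd m) ∈ T}, ?_⟩
    funext f
    rw [Pi.mul_apply, measureReal_def, measureReal_def, measureReal_def, ← networkLaw_mul,
      ENNReal.toReal_mul]

/-- The generators are closed under multiplication, so the algebra is just their linear span and
linearity of the integral suffices. -/
theorem integral_eq_of_mem_adjoin {φ ψ : Measure RankedSimplex} [IsProbabilityMeasure φ]
    [IsProbabilityMeasure ψ]
    (h : ∀ B, MeasurableSet B → ∫⁻ f : RankedSimplex, networkLaw (f : PairSimplex) B ∂φ =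
      ∫⁻ f : RankedSimplex, networkLaw (f : PairSimplex) B ∂ψ)
    {g : RankedSimplex → ℝ} (hg : g ∈ Algebra.adjoin ℝ (cylinderFunctions : Set _)) :
    ∫ f, g f ∂φ = ∫ f, g f ∂ψ := by
  rw [← Subalgebra.mem_toSubmodule, Algebra.adjoin_eq_span, Submonoid.closure_eq] at hg
  have key : Integrable g φ ∧ Integrable g ψ ∧ ∫ f, g f ∂φ = ∫ f, g f ∂ψ := by
    induction hg using Submodule.span_induction with
    | mem g hg =>
      obtain ⟨n, S, rfl⟩ := hg
      have hB := measurableSet_cylinderSet n S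
      refine ⟨integrable_networkLaw_real φ hB, integrable_networkLaw_real ψ hB, ?_⟩
      have h1 := h _ hB
      rw [lintegral_networkLaw φ hB, lintegral_networkLaw ψ hB] at h1
      exact (ENNReal.ofReal_eq_ofReal_iff (integral_nonneg fun f => measureReal_nonneg)
        (integral_nonneg fun f => measureReal_nonneg)).1 h1
    | zero => exact ⟨integrable_zero _ _ _, integrable_zero _ _ _, by simp⟩
    | add g₁ g₂ _ _ h₁ h₂ =>
      refine ⟨h₁.1.add h₂.1, h₁.2.1.add h₂.2.1, ?_⟩
      simp only [Pi.add_apply]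
      rw [integral_add h₁.1 h₂.1, integral_add h₁.2.1 h₂.2.1, h₁.2.2, h₂.2.2]
    | smul a g _ h =>
      refine ⟨h.1.smul a, h.2.1.smul a, ?_⟩
      simp only [Pi.smul_apply, integral_smul, h.2.2]
  exact key.2.2

/-- A measure on the ranked simplex is determined by the mixture of network laws. -/
theorem mixing_measure_unique {φ ψ : Measure RankedSimplex} [IsProbabilityMeasure φ]
    [IsProbabilityMeasure ψ]
    (h : ∀ B, MeasurableSet B → ∫⁻ f : RankedSimplex, networkLaw (f : PairSimplex) B ∂φ =
      ∫⁻ f : RankedSimplex, networkLaw (f : PairSimplex) B ∂ψ) : φ = ψ := by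
  have : IsProbabilityMeasure (φ.map rankedEquiv) :=
    Measure.isProbabilityMeasure_map rankedEquiv.measurable.aemeasurable
  have : IsProbabilityMeasure (ψ.map rankedEquiv) :=
    Measure.isProbabilityMeasure_map rankedEquiv.measurable.aemeasurable
  -- These are the continuous functions on the compact range whose pullback to `RankedSimplex` lies
  -- in the span of the cylinder probabilities. They include the coordinates, which separate points.
  let A₀ : Subalgebra ℝ (BoundedContinuousFunction (range rankedProbs) ℝ) :=
    { carrier := {g | (fun f => g (rankedEquiv f)) ∈
        Algebra.adjoin ℝ (cylinderFunctions : Set (RankedSimplex → ℝ))}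
      mul_mem' := fun {a b} ha hb => Subalgebra.mul_mem
        (Algebra.adjoin ℝ (cylinderFunctions : Set (RankedSimplex → ℝ)))
        (x := fun f => a (rankedEquiv f)) (y := fun f => b (rankedEquiv f)) ha hb
      add_mem' := fun {a b} ha hb => Subalgebra.add_mem
        (Algebra.adjoin ℝ (cylinderFunctions : Set (RankedSimplex → ℝ)))
        (x := fun f => a (rankedEquiv f)) (y := fun f => b (rankedEquiv f)) ha hb
      algebraMap_mem' := fun r => Subalgebra.algebraMap_mem
        (Algebra.adjoin ℝ (cylinderFunctions : Set (RankedSimplex → ℝ))) r }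
  have hstar : ∀ a : BoundedContinuousFunction (range rankedProbs) ℝ, star a = a := fun a =>
    BoundedContinuousFunction.ext fun x => star_trivial (a x)
  let A : StarSubalgebra ℝ (BoundedContinuousFunction (range rankedProbs) ℝ) :=
    { A₀ with star_mem' := fun {a} ha => by rwa [hstar] }
  have hmap : φ.map rankedEquiv = ψ.map rankedEquiv := by
    refine ext_of_forall_mem_subalgebra_integral_eq_of_polish (𝕜 := ℝ) (A := A) ?_ fun g hg => ?_
    · intro x y hxy
      have hne : ∃ c, x.1 c ≠ y.1 c := by
        by_contra! hc
        exact hxy (Subtype.ext (funext hc))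
      obtain ⟨⟨n, E⟩, hc⟩ := hne
      refine ⟨coordFunction ⟨n, E⟩, ⟨(coordFunction ⟨n, E⟩).toContinuousMap,
        ⟨coordFunction ⟨n, E⟩, ?_, rfl⟩, rfl⟩, hc⟩
      exact Algebra.subset_adjoin ⟨n, {E}, funext fun f => coordFunction_rankedEquiv f n E⟩
    · rw [integral_map_equiv, integral_map_equiv]
      exact integral_eq_of_mem_adjoin h hg
  have h1 := congrArg (Measure.map rankedEquiv.symm) hmap
  rwa [MeasurableEquiv.map_symm_map, MeasurableEquiv.map_symm_map] at h1

/-! ### Empirical elements of the simplex -/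

/-- A finite network has a representative with labels `1, 2, …` in order of nonincreasing
degree. -/
theorem exists_ranked_representative {N : ℕ} (E : Network (Fin N)) :
    ∃ I : Interactions (Fin N), inducedNetwork I = E ∧ (∀ k, ∀ i ∈ I k, 1 ≤ i) ∧
      ∀ i : ℤ, 1 ≤ i → {k | i + 1 ∈ I k}.ncard ≤ {k | i ∈ I k}.ncard := by
  classical
  obtain ⟨I, rfl⟩ := exists_inducedNetwork E
  have hfin : I.vertices.Finite := by
    have : I.vertices = ⋃ k, {v | v ∈ I k} := by
      ext v
      simp [Interactions.vertices]
    rw [this]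
    refine finite_iUnion fun k => ?_
    induction I k with | _ a b
    exact (toFinite {a, b}).subset fun v hv => by simpa using hv
  have := hfin.fintype
  let e : Fin (Fintype.card I.vertices) ≃ I.vertices := (Fintype.equivFin _).symm
  -- The sign is negative so that sorting in increasing order puts the vertices of large degree
  -- first.
  let cnt : Fin (Fintype.card I.vertices) → ℤ := fun a => -({k | (e a : ℤ) ∈ I k}.ncard : ℤ)
  let σ := Tuple.sort cnt
  have hσ : Monotone (cnt ∘ σ) := Tuple.monotone_sort cnt
  let τ : I.vertices ≃ Fin (Fintype.card I.vertices) := e.symm.trans σ.symm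
  let ρ : ℤ → ℤ := fun v => if h : v ∈ I.vertices then ((τ ⟨v, h⟩ : ℕ) : ℤ) + 1 else 0
  have hρ : ∀ v : I.vertices, ρ v = ((τ v : ℕ) : ℤ) + 1 := fun v => dif_pos v.2
  have hinj : InjOn ρ I.vertices := by
    intro a ha b hb hab
    have h1 := hρ ⟨a, ha⟩
    have h2 := hρ ⟨b, hb⟩
    simp only at h1 h2
    rw [hab, h2] at h1
    have h3 : τ ⟨a, ha⟩ = τ ⟨b, hb⟩ := Fin.ext (by omega)
    exact congrArg Subtype.val (τ.injective h3)
  have hmem : ∀ (a : Fin (Fintype.card I.vertices)) (k : Fin N),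
      ((a : ℕ) : ℤ) + 1 ∈ (I k).map ρ ↔ (e (σ a) : ℤ) ∈ I k := by
    intro a k
    rw [Sym2.mem_map]
    constructor
    · rintro ⟨v, hv, hva⟩
      have hv' : v ∈ I.vertices := ⟨k, hv⟩
      have h1 := hρ ⟨v, hv'⟩
      simp only at h1
      rw [hva] at h1
      have h3 : a = τ ⟨v, hv'⟩ := Fin.ext (by omega)
      rw [h3]
      simpa [τ] using hv
    · intro h
      refine ⟨e (σ a), h, ?_⟩
      rw [hρ]
      simp [τ]
  refine ⟨fun k => (I k).map ρ, (inducedNetwork_eq_iff.2 ⟨ρ, hinj, fun k => rfl⟩).symm, ?_, ?_⟩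
  · intro k i hi
    obtain ⟨v, hv, rfl⟩ := Sym2.mem_map.1 hi
    have := hρ ⟨v, k, hv⟩
    simp only at this
    omega
  · intro i hi
    -- Labels start at `1` and sorted indices at `0`, so label `i + 1` has index `i.toNat`; if that
    -- index is out of range, no edge carries the label.
    by_cases hlt : i.toNat < Fintype.card I.vertices
    · have h1 := hσ (a := ⟨i.toNat - 1, by omega⟩) (b := ⟨i.toNat, hlt⟩)
        (Fin.mk_le_mk.2 (by omega))
      have e1 : i = (((⟨i.toNat - 1, by omega⟩ : Fin (Fintype.card I.vertices)) : ℕ) : ℤ) + 1 := by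
        simp only
        omega
      have e2 : i + 1 = (((⟨i.toNat, hlt⟩ : Fin (Fintype.card I.vertices)) : ℕ) : ℤ) + 1 := by
        simp only
        omega
      have s1 : {k | i ∈ (I k).map ρ} = {k | (e (σ ⟨i.toNat - 1, by omega⟩) : ℤ) ∈ I k} := by
        ext k
        have := hmem ⟨i.toNat - 1, by omega⟩ k
        rwa [← e1] at this
      have s2 : {k | i + 1 ∈ (I k).map ρ} = {k | (e (σ ⟨i.toNat, hlt⟩) : ℤ) ∈ I k} := by
        ext k
        have := hmem ⟨i.toNat, hlt⟩ k
        rwa [← e2] at this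
      rw [s1, s2]
      simp only [cnt, Function.comp_apply] at h1
      omega
    · have : {k | i + 1 ∈ (I k).map ρ} = ∅ := by
        refine eq_empty_of_forall_notMem fun k hk => ?_
        obtain ⟨v, hv, hvi⟩ := Sym2.mem_map.1 hk
        have h1 := hρ ⟨v, k, hv⟩
        have h2 := (τ ⟨v, k, hv⟩).2
        simp only at h1
        omega
      rw [this]
      simp

/-- The uniform distribution on `Fin N`. -/
noncomputable def uniformFin (N : ℕ) : Measure (Fin N) := (N : ENNReal)⁻¹ • Measure.count

theorem isProbabilityMeasure_uniformFin {N : ℕ} (hN : N ≠ 0) :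
    IsProbabilityMeasure (uniformFin N) := by
  constructor
  rw [uniformFin, Measure.smul_apply, Measure.count_univ, smul_eq_mul, ENat.card_eq_coe_fintype_card,
    Fintype.card_fin]
  exact ENNReal.inv_mul_cancel (by exact_mod_cast hN) (by simp)

theorem uniformFin_real {N : ℕ} (A : Set (Fin N)) :
    (uniformFin N).real A = (N : ℝ)⁻¹ * A.ncard := by
  rw [measureReal_def, uniformFin, Measure.smul_apply, smul_eq_mul, ENNReal.toReal_mul,
    Measure.count_apply (toFinite A).measurableSet]
  rw [← (toFinite A).cast_ncard_eq, ENat.toENNReal_coe, ENNReal.toReal_natCast]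
  simp

theorem pi_uniformFin_real {N : ℕ} (hN : N ≠ 0) (n : ℕ) (A : Finset (Fin n → Fin N)) :
    (Measure.pi fun _ : Fin n => uniformFin N).real A = A.card / (N : ℝ) ^ n := by
  have := isProbabilityMeasure_uniformFin hN
  rw [← sum_measureReal_singleton]
  have h : ∀ u : Fin n → Fin N, (Measure.pi fun _ : Fin n => uniformFin N).real {u} =
      ((N : ℝ) ^ n)⁻¹ := by
    intro u
    rw [measureReal_def, Measure.pi_singleton, ENNReal.toReal_prod]
    simp only [← measureReal_def, uniformFin_real]
    simp
  simp only [h, Finset.sum_const, nsmul_eq_mul]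
  rfl

/-- A law on pairs of labels `≥ 1` is the law of an element of the simplex. -/
theorem exists_pairLaw_eq (μ : Measure (Sym2 ℤ)) [IsProbabilityMeasure μ]
    (h : ∀ᵐ s ∂μ, ∀ i ∈ s, 1 ≤ i) : ∃ f : PairSimplex, pairLaw f = μ := by
  have hzero : ∀ s : Sym2 ℤ, (∃ i ∈ s, i < 1) → μ.real {s} = 0 := by
    rintro s ⟨i, hi, hlt⟩
    rw [measureReal_eq_zero_iff, measure_eq_zero_iff_ae_notMem]
    filter_upwards [h] with t ht hts
    rw [mem_singleton_iff] at hts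
    subst hts
    have := ht i hi
    omega
  have htot : ∑' s, μ {s} = 1 := by
    have := Measure.tsum_indicator_apply_singleton μ univ MeasurableSet.univ
    simpa using this
  have hsum := ENNReal.hasSum_toReal (f := fun s => μ {s}) (by simp [htot])
  have h1 : ∑' s, (μ {s}).toReal = 1 := by
    rw [← ENNReal.tsum_toReal_eq fun s => measure_ne_top _ _, htot, ENNReal.toReal_one]
  rw [h1] at hsum
  refine ⟨⟨fun s => μ.real {s}, fun s => measureReal_nonneg, fun s i hi hlt =>
    hzero s ⟨i, hi, by omega⟩, fun i _ => hzero _ ⟨-1, by simp, by omega⟩, hsum⟩, ?_⟩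
  refine Measure.ext_of_singleton fun s => ?_
  rw [pairLaw_singleton]
  exact ofReal_measureReal (measure_ne_top _ _)

/-- Sampling edges of a finite network with replacement is a mixture component. -/
theorem exists_empirical {N : ℕ} (hN : N ≠ 0) (E : Network (Fin N)) :
    ∃ f ∈ RankedSimplex, ∀ (n : ℕ) (F : Network (Fin n)),
      (networkLaw f).real (cylinderSet n {F}) =
        {u : Fin n → Fin N | E.pullback u = F}.ncard / (N : ℝ) ^ n := by
  classical
  have := isProbabilityMeasure_uniformFin hN
  obtain ⟨I, rfl, hpos, hcnt⟩ := exists_ranked_representative E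
  have hI : Measurable I := measurable_of_countable _
  have : IsProbabilityMeasure ((uniformFin N).map I) :=
    Measure.isProbabilityMeasure_map hI.aemeasurable
  obtain ⟨f, hf⟩ := exists_pairLaw_eq ((uniformFin N).map I)
    ((ae_map_iff hI.aemeasurable MeasurableSet.of_discrete).2 (ae_of_all _ hpos))
  have hreal : ∀ A : Set (Sym2 ℤ), (pairLaw f).real A = (N : ℝ)⁻¹ * {k | I k ∈ A}.ncard := by
    intro A
    rw [hf, map_measureReal_apply hI MeasurableSet.of_discrete, uniformFin_real]
    rfl
  have hranked : f.IsRanked := by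
    intro i hi
    rw [f.degree_eq hi, f.degree_eq (by omega), hreal, hreal]
    exact mul_le_mul_of_nonneg_left (by exact_mod_cast hcnt i hi) (by positivity)
  obtain ⟨g, hg, hgf⟩ := exists_mem_rankedSimplex hranked
  refine ⟨g, hg, fun n F => ?_⟩
  have hset : (fun (u : Fin n → Fin N) k => I (u k)) ⁻¹' {y | finiteNetwork y ∈ ({F} : Set _)} =
      ((Finset.univ.filter fun u : Fin n → Fin N => (inducedNetwork I).pullback u = F :
        Finset _) : Set (Fin n → Fin N)) := by
    ext u
    -- All labels of the representative are `≥ 1`, so there are no blips to expand and an edge drawn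
    -- twice keeps its vertices. Hence the sample is the pullback along `u` even when `u` is not
    -- injective.
    have hu : expand Fin.val (fun k => I (u k)) = I ∘ u := by
      funext k
      have hc := Sym2.map_congr (s := I (u k)) (f := freshLabel k) (g := id)
        fun i hi => if_pos (hpos _ i hi)
      simp only [expand, Function.comp_apply]
      rw [hc, Sym2.map_id, id]
    rw [Finset.coe_filter]
    simp [finiteNetwork, hu, Network.pullback_inducedNetwork]
  rw [hgf, measureReal_def, networkLaw_cylinderSet, hf,
    ← Measure.pi_map_pi fun _ => hI.aemeasurable,
    Measure.map_apply (measurable_of_countable _) (to_countable _).measurableSet, hset,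
    ← measureReal_def, pi_uniformFin_real hN]
  congr 2
  rw [← ncard_coe_finset]
  simp

/-! ### Existence of the mixing measure -/

theorem EdgeExchangeable.measure_pullback {Ω : Type*} [MeasurableSpace Ω] {P : Measure Ω}
    {Y : Ω → Network ℕ} (hY : Measurable Y) (h : EdgeExchangeable P Y) {n : ℕ} {u : Fin n → ℕ}
    (hu : Function.Injective u) (F : Network (Fin n)) :
    P {ω | (Y ω).pullback u = F} = P (Y ⁻¹' cylinderSet n {F}) := by
  -- The injection `u` of the first `n` edge labels extends to a permutation of all of them.
  -- Relabeling pulls back along the inverse, so it is `σ.symm` that brings edge `u k` to place `k`.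
  obtain ⟨σ, hσ⟩ := (Equiv.Perm.isMultiplyPretransitive ℕ n).exists_smul_eq
    (⟨Fin.val, Fin.val_injective⟩ : Fin n ↪ ℕ) ⟨u, hu⟩
  have hσu : ∀ k : Fin n, σ k = u k := fun k => DFunLike.congr_fun hσ k
  have h1 : (P.map fun ω => (Y ω).relabel σ.symm) (cylinderSet n {F}) =
      P.map Y (cylinderSet n {F}) := by rw [h σ.symm]
  have hm : Measurable fun ω => (Y ω).relabel σ.symm := (measurable_pullback _).comp hY
  rw [Measure.map_apply hm (measurableSet_cylinderSet _ _),
    Measure.map_apply hY (measurableSet_cylinderSet _ _)] at h1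
  rw [← h1]
  congr 1
  ext ω
  have : ((Y ω).relabel σ.symm).restrict n = (Y ω).pullback u := by
    rw [Network.relabel, Network.restrict, Network.pullback_pullback]
    congr 1
    funext k
    exact hσu k
  simp only [mem_ofPred_eq, mem_preimage, cylinderSet, mem_singleton_iff, this]

/-- Among the `N ^ n` samples the injective ones number `N (N - 1) ⋯ (N - n + 1)`, which is
asymptotic to `N ^ n`. -/
theorem tendsto_card_not_injective (n : ℕ) :
    Tendsto (fun N : ℕ => ({u : Fin n → Fin N | ¬ Function.Injective u}.ncard : ℝ) / (N : ℝ) ^ n)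
      atTop (𝓝 0) := by
  have hcard : ∀ N : ℕ, ({u : Fin n → Fin N | ¬ Function.Injective u}.ncard : ℝ) =
      (N : ℝ) ^ n - N.descFactorial n := by
    intro N
    have h1 : {u : Fin n → Fin N | Function.Injective u}.ncard = N.descFactorial n := by
      have h := Fintype.card_embedding_eq (α := Fin n) (β := Fin N)
      rw [Fintype.card_fin, Fintype.card_fin] at h
      rw [← h, ← Nat.card_eq_fintype_card, ← Nat.card_coe_set_eq]
      exact Nat.card_congr (Equiv.subtypeInjectiveEquivEmbedding _ _)
    have h2 := ncard_add_ncard_compl {u : Fin n → Fin N | Function.Injective u}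
    rw [h1, Nat.card_eq_fintype_card, Fintype.card_fun, Fintype.card_fin, Fintype.card_fin] at h2
    rw [eq_sub_iff_add_eq']
    exact_mod_cast h2
  have hz : ∀ᶠ N : ℕ in atTop, (N : ℝ) ^ n ≠ 0 := by
    filter_upwards [eventually_gt_atTop 0] with N hN
    positivity
  have h := (Asymptotics.isEquivalent_iff_tendsto_one hz).1 (isEquivalent_descFactorial n)
  have h' := h.const_sub 1
  rw [sub_self] at h'
  refine h'.congr' ?_
  filter_upwards [hz] with N hN
  rw [hcard, sub_div, div_self hN]
  rfl

/-- The integral is the average, over all samples `u`, of the probability that the edges of `Y`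
picked by `u` form `F`. By exchangeability an injective `u` contributes exactly the limit; any other
is off by at most `1`, and those are asymptotically negligible. -/
theorem tendsto_integral_empirical {Ω : Type*} [MeasurableSpace Ω] (P : Measure Ω)
    [IsProbabilityMeasure P] {Y : Ω → Network ℕ} (hY : Measurable Y) (hexch : EdgeExchangeable P Y)
    (h : ∀ N, Network (Fin N) → RankedSimplex)
    (hh : ∀ N ≠ 0, ∀ (E : Network (Fin N)) (n : ℕ) (F : Network (Fin n)),
      (networkLaw (h N E : PairSimplex)).real (cylinderSet n {F}) =
        {u : Fin n → Fin N | E.pullback u = F}.ncard / (N : ℝ) ^ n)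
    (n : ℕ) (F : Network (Fin n)) :
    Tendsto (fun N => ∫ ω, (networkLaw (h N ((Y ω).restrict N) : PairSimplex)).real
      (cylinderSet n {F}) ∂P) atTop (𝓝 (P.real (Y ⁻¹' cylinderSet n {F}))) := by
  classical
  rw [tendsto_iff_dist_tendsto_zero]
  refine squeeze_zero' (.of_forall fun _ => dist_nonneg) ?_ (tendsto_card_not_injective n)
  filter_upwards [eventually_ne_atTop 0] with N hN
  have hNn : (0 : ℝ) < (N : ℝ) ^ n := by positivity
  set p := P.real (Y ⁻¹' cylinderSet n {F})
  let q : (Fin n → Fin N) → ℝ := fun u => P.real {ω | (Y ω).pullback (fun k => (u k : ℕ)) = F}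
  have hms : ∀ u : Fin n → Fin N,
      MeasurableSet {ω | (Y ω).pullback (fun k => (u k : ℕ)) = F} := fun u =>
    hY (measurableSet_pullback_mem _ {F})
  have hint : ∫ ω, (networkLaw (h N ((Y ω).restrict N) : PairSimplex)).real
      (cylinderSet n {F}) ∂P = (∑ u, q u) / (N : ℝ) ^ n := by
    have h1 : ∀ ω, (networkLaw (h N ((Y ω).restrict N) : PairSimplex)).real (cylinderSet n {F}) =
        (∑ u : Fin n → Fin N,
          {ω | (Y ω).pullback (fun k => (u k : ℕ)) = F}.indicator 1 ω) / (N : ℝ) ^ n := by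
      intro ω
      rw [hh N hN]
      congr 1
      simp only [indicator_apply, Pi.one_apply, mem_ofPred_eq, Finset.sum_boole, ← restrict_pullback]
      rw [← ncard_coe_finset]
      simp
    simp only [h1]
    rw [integral_div, integral_finsetSum]
    · congr 1
      exact Finset.sum_congr rfl fun u _ => integral_indicator_one (hms u)
    · intro u _
      exact (integrable_const (1 : ℝ)).indicator (hms u)
  have hq : ∀ u : Fin n → Fin N, |q u - p| ≤ if Function.Injective u then 0 else 1 := by
    intro u
    split_ifs with hu
    · have := hexch.measure_pullback hY (Fin.val_injective.comp hu) F
      have hqp : q u = p := congrArg ENNReal.toReal this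
      rw [hqp, sub_self, abs_zero]
    · rw [abs_le]
      have h1 : 0 ≤ q u := measureReal_nonneg
      have h2 : q u ≤ 1 := measureReal_le_one
      have h3 : 0 ≤ p := measureReal_nonneg
      have h4 : p ≤ 1 := measureReal_le_one
      constructor <;> linarith
  have hcard : (Fintype.card (Fin n → Fin N) : ℝ) = (N : ℝ) ^ n := by simp
  have hdiff : (∑ u, q u) / (N : ℝ) ^ n - p = (∑ u, (q u - p)) / (N : ℝ) ^ n := by
    rw [Finset.sum_sub_distrib, Finset.sum_const, Finset.card_univ, nsmul_eq_mul, hcard, sub_div,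
      mul_div_cancel_left₀ _ hNn.ne']
  rw [hint, Real.dist_eq, hdiff, abs_div, abs_of_pos hNn]
  refine div_le_div_of_nonneg_right ?_ hNn.le
  refine (Finset.abs_sum_le_sum_abs _ _).trans ((Finset.sum_le_sum fun u _ => hq u).trans ?_)
  rw [← Finset.sum_filter_add_sum_filter_not Finset.univ fun u : Fin n → Fin N =>
    Function.Injective u]
  rw [Finset.sum_congr rfl fun u hu => if_pos (Finset.mem_filter.1 hu).2,
    Finset.sum_congr (s₁ := Finset.univ.filter fun u : Fin n → Fin N => ¬ Function.Injective u) rfl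
      fun u hu => if_neg (Finset.mem_filter.1 hu).2]
  simp only [Finset.sum_const_zero, zero_add, Finset.sum_const, nsmul_eq_mul, mul_one]
  rw [← ncard_coe_finset]
  simp

/-- An edge exchangeable random network is a mixture of the networks generated by elements of the
ranked simplex. -/
theorem exists_mixing_measure {Ω : Type*} [MeasurableSpace Ω] (P : Measure Ω)
    [IsProbabilityMeasure P] {Y : Ω → Network ℕ} (hY : Measurable Y)
    (hexch : EdgeExchangeable P Y) : ∃ φ : Measure RankedSimplex, IsProbabilityMeasure φ ∧
      ∀ B : Set (Network ℕ), MeasurableSet B →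
        P (Y ⁻¹' B) = ∫⁻ f : RankedSimplex, networkLaw (f : PairSimplex) B ∂φ := by
  have hex : ∀ (N : ℕ) (E : Network (Fin N)), ∃ f : RankedSimplex, N ≠ 0 → ∀ (n : ℕ)
      (F : Network (Fin n)), (networkLaw (f : PairSimplex)).real (cylinderSet n {F}) =
        {u : Fin n → Fin N | E.pullback u = F}.ncard / (N : ℝ) ^ n := by
    intro N E
    by_cases hN : N = 0
    -- With no edges to sample from, an arbitrary element is chosen; it plays no role in the limit.
    · obtain ⟨f, hf, -⟩ := exists_empirical one_ne_zero
        (inducedNetwork fun _ : Fin 1 => s((1 : ℤ), 1))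
      exact ⟨⟨f, hf⟩, fun h => absurd hN h⟩
    · obtain ⟨f, hf, h⟩ := exists_empirical hN E
      exact ⟨⟨f, hf⟩, fun _ => h⟩
  choose h hh using hex
  have hmeas : ∀ N, Measurable fun ω => rankedEquiv (h N ((Y ω).restrict N)) := fun N A _ =>
    hY (measurableSet_cylinderSet N {E | rankedEquiv (h N E) ∈ A})
  let ν : ℕ → ProbabilityMeasure (range rankedProbs) := fun N =>
    ⟨P.map fun ω => rankedEquiv (h N ((Y ω).restrict N)),
      Measure.isProbabilityMeasure_map (hmeas N).aemeasurable⟩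
  -- Probability measures on a compact space form a compact space, so the laws `ν N` converge along
  -- an ultrafilter. Coordinates are continuous, so their integrals converge too, and
  -- `tendsto_integral_empirical` identifies the limits.
  let U : Ultrafilter ℕ := hyperfilter ℕ
  obtain ⟨μ, -, hμ⟩ := isCompact_univ.ultrafilter_le_nhds (U.map ν) (by simp)
  have hμ' : Tendsto ν U (𝓝 μ) := hμ
  have hcoord : ∀ (n : ℕ) (F : Network (Fin n)),
      ∫ y, coordFunction ⟨n, F⟩ y ∂(μ : Measure (range rankedProbs)) =
        P.real (Y ⁻¹' cylinderSet n {F}) := by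
    intro n F
    refine tendsto_nhds_unique
      (ProbabilityMeasure.tendsto_iff_forall_integral_tendsto.1 hμ' (coordFunction ⟨n, F⟩)) ?_
    have h1 := (tendsto_integral_empirical P hY hexch h (fun N hN E => hh N E hN) n F).mono_left
      Nat.hyperfilter_le_atTop
    refine h1.congr fun N => ?_
    simp only [← coordFunction_rankedEquiv]
    exact (integral_map (hmeas N).aemeasurable
      (coordFunction ⟨n, F⟩).continuous.aestronglyMeasurable).symm
  let φ : Measure RankedSimplex := (μ : Measure (range rankedProbs)).map rankedEquiv.symm
  have hφ : IsProbabilityMeasure φ :=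
    Measure.isProbabilityMeasure_map rankedEquiv.symm.measurable.aemeasurable
  have hbind : IsProbabilityMeasure
      (φ.bind fun f : RankedSimplex => networkLaw (f : PairSimplex)) :=
    isProbabilityMeasure_bind measurable_networkLaw.aemeasurable
      (ae_of_all _ fun f => inferInstance)
  have hPY : IsProbabilityMeasure (P.map Y) := Measure.isProbabilityMeasure_map hY.aemeasurable
  have heq : P.map Y = φ.bind fun f : RankedSimplex => networkLaw (f : PairSimplex) := by
    refine measure_network_ext fun n F => ?_
    have hB := measurableSet_cylinderSet n {F}
    rw [Measure.map_apply hY hB, Measure.bind_apply hB measurable_networkLaw.aemeasurable,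
      lintegral_networkLaw φ hB, ← ofReal_measureReal (measure_ne_top _ _), ← hcoord n F]
    congr 1
    rw [integral_map_equiv]
    refine integral_congr_ae (ae_of_all _ fun y => ?_)
    have := coordFunction_rankedEquiv (rankedEquiv.symm y) n F
    rwa [MeasurableEquiv.apply_symm_apply] at this
  refine ⟨φ, hφ, fun B hB => ?_⟩
  rw [← Measure.map_apply hY hB, heq, Measure.bind_apply hB measurable_networkLaw.aemeasurable]

end EdgeExch

theorem theoremA2 {Ω : Type*} [MeasurableSpace Ω] (P : MeasureTheory.Measure Ω)
    [MeasureTheory.IsProbabilityMeasure P] (Y : Ω → EdgeExch.Network ℕ) (hY : Measurable Y)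
    (hexch : EdgeExch.EdgeExchangeable P Y) :
    ∃! φ : MeasureTheory.Measure EdgeExch.RankedSimplex,
      MeasureTheory.IsProbabilityMeasure φ ∧
        ∀ B : Set (EdgeExch.Network ℕ), MeasurableSet B →
          P (Y ⁻¹' B) = ∫⁻ f : EdgeExch.RankedSimplex, EdgeExch.networkLaw (f : EdgeExch.PairSimplex) B ∂φ := by
  obtain ⟨φ, hφ, h⟩ := EdgeExch.exists_mixing_measure P hY hexch
  refine ⟨φ, ⟨hφ, h⟩, ?_⟩
  rintro ψ ⟨hψ, h'⟩
  exact EdgeExch.mixing_measure_unique fun B hB => (h' B hB).symm.trans (h B hB)
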